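/- **Setting.** Let $E\ge 2$. A pipeline consists of operators $a_e:\mathbb R^{d_{e-1}}\times\mathbb R^{d_{w_e}}\to\mathbb R^{d_e}$, $e=1,\dots,E$, with $d_E=1$, and a probability law $\mathcal D$ on $\mathbb R^{d_0}$. For $\boldsymbol w=(w_1,\dots,w_E)$ put $y_0=x$, $y_e=a_e(y_{e-1},w_e)$, $L(x;\boldsymbol w)=y_E$, $\ell(\boldsymbol w)=\mathbb E_{x\sim\mathcal D}L(x;\boldsymbol w)$. Write $\nabla_1a_e,\nabla_2a_e$ for the Jacobians of $a_e$ in its first and second argument. **Algorithm (Clapping with Adam).** Parameters: $\gamma,\varepsilon>0$, $\beta_1,\beta_2\in(0,1)$, $p\in(0,1]$. Start from weights $\boldsymbol w^{(1)}$ and $\tilde y_e^{(0)}=0,\tilde v_e^{(0)}=0,\tilde u_e^{(0)}=0,\upsilon_e^{(0)}=0$. At iteration $t=1,2,\dots$: 1. (lazy sampling) if $t=1$, draw $x^{(1)}\sim\mathcal D$; if $t\ge2$, with probability $p$ draw a fresh $x^{(t)}\sim\mathcal D$, otherwise keep $x^{(t)}=x^{(t-1)}$; 2. (forward) $\tilde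 y_0^{(t)}=x^{(t)}$; for $e=1,\dots,E-1$: $y_e^{(t)}=a_e(\tilde y_{e-1}^{(t)},w_e^{(t)})$ and $\tilde y_e^{(t)}=\tilde y_e^{(t-1)}+\mathcal C_F(y_e^{(t)}-\tilde y_e^{(t-1)})$; 3. (backward) $\tilde v_E^{(t)}=1$; for $e=E,\dots,2$: $v_{e-1}^{(t)}=\nabla_1a_e(\tilde y_{e-1}^{(t)},w_e^{(t)})^{\mathsf T}\tilde v_e^{(t)}$ and $\tilde v_{e-1}^{(t)}=\tilde v_{e-1}^{(t-1)}+\mathcal C_B(v_{e-1}^{(t)}-\tilde v_{e-1}^{(t-1)})$; 4. (Adam update, coordinatewise) with $g_e^{(t)}=\nabla_2a_e(\tilde y_{e-1}^{(t)},w_e^{(t)})^{\mathsf T}\tilde v_e^{(t)}$, for $e=1,\dots,E$: $\tilde u_e^{(t)}=(1-\beta_1)\tilde u_e^{(t-1)}+\beta_1g_e^{(t)}$, $\upsilon_e^{(t)}=(1-\beta_2)\upsilon_e^{(t-1)}+\beta_2(g_e^{(t)})^{\odot2}$, $w_e^{(t+1)}=w_e^{(t)}-\gamma\,\tilde u_e^{(t)}/\sqrt{\upsilon_e^{(t)}+\varepsilon}$.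 In the variant FC this is done at every iteration. In the variant FU, at every iteration in which a sample is drawn (including $t=1$), the exact values are sent instead: $\tilde y_e^{(t)}=y_e^{(t)}$, $\tilde v_e^{(t)}=v_e^{(t)}$. The compressors may be random; samples, lazy sampling decisions and compressor randomness are independent. **Assumptions.** (A1) $\ell$ is differentiable and $\nabla\ell$ is $L_{\nabla\ell}$-Lipschitz; all $a_e$ are differentiable with $\|\nabla_1a_e\|,\|\nabla_2a_e\|\le C_a$; for $e\le E-1$, $a_e$ is $L_a$-Lipschitz in each argument; for $e\ge2$, $\nabla_1a_e,\nabla_2a_e$ are $L_{\nabla a}$-Lipschitz in each argument; and $\nabla_2a_1(x,\cdot)$ is $L_{\nabla a}$-Lipschitz for every $x$. (A2) $L(\cdot;\boldsymbol w)$ and $\nabla L(\cdot;\boldsymbol w)$ are integrable, $\mathbb E_x\nabla L(x;\boldsymbol w)=\nabla\ell(\boldsymbol w)$ and $\mathbb E_x\|\nabla L(x;\boldsymbol w)-\nabla\ell(\boldsymbol w)\|^2\le\sigma^2$ for all $\boldsymbol w$. (A3) $\mathbb E\|y-\mathcal C_F(y)\|^2\le\omega_F^2\|y\|^2$ and $\mathbb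 E\|y-\mathcal C_B(y)\|^2\le\omega_B^2\|y\|^2$ for all vectors $y$, with $\omega_F,\omega_B\in[0,1)$. (A4) $\mathbb E\|x_1-x_2\|^2\le\varphi^2$ for independent $x_1,x_2\sim\mathcal D$. (A5) Almost surely $\|g_e^{(t)}\|\le M_1$ for all $e$ and all $t\le T$. (A6) $\ell$ is bounded below, $\ell(\boldsymbol w^{(1)})-\inf\ell\le\Delta$, and at $\boldsymbol w^{(1)}$ the activations satisfy $\mathbb E_x\|y_e\|^2\le B^2$ for $1\le e\le E-1$. Fix $E$ and the constants $\mathcal K=(L_{\nabla\ell},C_a,L_a,L_{\nabla a},M_1,\varepsilon,\Delta,B)$, where $\varepsilon>0$ and the others are nonnegative. **Claim (FU).** For every $p\in(0,1]$ there is a constant $C=C(E,\mathcal K,p)$ such that for all $\sigma,\varphi\ge0$, $\omega_F,\omega_B\in[0,1)$ and $T\ge1$ there are $\gamma>0$ and $\beta_1\in(0,1)$ such that, for every pipeline, compressors, $\boldsymbol w^{(1)}$ and $\beta_2\in(0,1)$ satisfying (A1)–(A6), the FU variant satisfies $$\frac1T\sum_{t=1}^T\mathbb E\|\nabla\ell(\boldsymbol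 w^{(t)})\|^2\le C\left(\frac{\sigma}{\sqrt T}+\frac1{T(1-\omega_B)^{E-1}(1-\omega_F)^{E-1}}\right).$$ **Claim (FC).** For every $\kappa\ge0$ there is a constant $C=C(E,\mathcal K,\kappa)$ such that for all $\sigma,\varphi\ge0$ with $\varphi\le\kappa\sigma$ or $\sigma=0$, all $\omega_F,\omega_B\in[0,1)$ and $T\ge1$ there are $\gamma>0$, $\beta_1\in(0,1)$ and $p\in(0,1]$ such that, for every pipeline, compressors, $\boldsymbol w^{(1)}$ and $\beta_2\in(0,1)$ satisfying (A1)–(A6), the FC variant satisfies $$\frac1T\sum_{t=1}^T\mathbb E\|\nabla\ell(\boldsymbol w^{(t)})\|^2\le C\left(\frac{\sigma^{4/3}}{T^{1/3}(1-\omega_B)^{\frac{4(E-1)}3}(1-\omega_F)^{\frac{4(E-1)}3}}+\frac1T\left(\frac1{(1-\omega_B)^{E-1}(1-\omega_F)^{E-1}}+\frac{\omega_F^2+\omega_B}{(1-\omega_B)^{2(E-1)}(1-\omega_F)^2}+\frac1{(1-\omega_F)^{2(E-2)-1}}\right)\right).$$ In both claims the expectations are finite. -/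

import Mathlib

open MeasureTheory
open scoped Gradient

noncomputable section

namespace Clapping

universe u

/-- Euclidean space of dimension `n` with its `ℓ²` norm. -/
abbrev Vec (n : ℕ) : Type := EuclideanSpace ℝ (Fin n)

/-- A pipeline of `E` workers. The operator `a e` of the worker with (zero-based) number `e : Fin E`
takes the activation `y_e` of dimension `d e.castSucc` and the block of weights `w_e`, and returns
the activation of dimension `d e.succ`. The input `y_0 = x` has the law `D`, and the last activation
is the scalar loss. -/
structure Pipeline (E : ℕ) where
  d : Fin (E + 1) → ℕ
  dw : Fin E → ℕ
  d_last : d (Fin.last E) = 1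
  a : (e : Fin E) → Vec (d e.castSucc) → Vec (dw e) → Vec (d e.succ)
  D : Measure (Vec (d 0))
  D_prob : IsProbabilityMeasure D

attribute [instance] Pipeline.D_prob

variable {E : ℕ}

namespace Pipeline

variable (P : Pipeline E)

/-- All the weights `w = (w_1, …, w_E)`, with the Euclidean norm. -/
abbrev Params : Type := PiLp 2 (fun e : Fin E => Vec (P.dw e))

/-- One vector for every position `0, …, E` of the pipeline. -/
abbrev Layers : Type := (i : Fin (E + 1)) → Vec (P.d i)

/-- Activations of the exact (uncompressed) forward pass. -/
def act (x : Vec (P.d 0)) (w : P.Params) : P.Layers :=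
  Fin.induction (motive := fun i => Vec (P.d i)) x (fun e y => P.a e y (w e))

/-- The loss `L(x; w) = y_E`; the sum has one term, because `d_E = 1`. -/
def loss (x : Vec (P.d 0)) (w : P.Params) : ℝ :=
  ∑ j, P.act x w (Fin.last E) j

/-- The objective `ℓ(w) = 𝔼_{x ∼ D} L(x; w)`. -/
def risk (w : P.Params) : ℝ := ∫ x, P.loss x w ∂P.D

/-- Jacobian `∇₁ a_e(y, w)` in the incoming activation. -/
def jac₁ (e : Fin E) (y : Vec (P.d e.castSucc)) (w : Vec (P.dw e)) :
    Vec (P.d e.castSucc) →L[ℝ] Vec (P.d e.succ) :=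
  fderiv ℝ (fun y' => P.a e y' w) y

/-- Jacobian `∇₂ a_e(y, w)` in the weights. -/
def jac₂ (e : Fin E) (y : Vec (P.d e.castSucc)) (w : Vec (P.dw e)) :
    Vec (P.dw e) →L[ℝ] Vec (P.d e.succ) :=
  fderiv ℝ (fun w' => P.a e y w') w

end Pipeline

/-- A randomized compressor acting on the vectors at each position of a pipeline;
`s` is the random seed, with law `ν`. -/
structure Compressor {n : ℕ} (d : Fin n → ℕ) where
  S : Type u
  mS : MeasurableSpace S
  ν : Measure S
  ν_prob : IsProbabilityMeasure ν
  map : (i : Fin n) → S → Vec (d i) → Vec (d i)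
  measurable_map : ∀ i, Measurable (fun q : S × Vec (d i) => map i q.1 q.2)

attribute [instance] Compressor.mS Compressor.ν_prob

/-- `𝔼 ‖y - C(y)‖² ≤ ω² ‖y‖²` for every vector `y`. -/
def Compressor.Contractive {n : ℕ} {d : Fin n → ℕ} (C : Compressor.{u} d) (ω : ℝ) : Prop :=
  ∀ i (y : Vec (d i)),
    ∫⁻ s, ENNReal.ofReal (‖y - C.map i s y‖ ^ 2) ∂C.ν ≤ ENNReal.ofReal (ω ^ 2 * ‖y‖ ^ 2)

/-- `FU`: no compression at the iterations in which a new sample is drawn.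
`FC`: compression at every iteration. -/
inductive Variant
  | FU
  | FC

/-- Parameters of the algorithm: step size `γ`, Adam coefficients `β₁`, `β₂`, Adam regularization
`ε`, lazy sampling rate `p`. -/
structure Hyper where
  γ : ℝ
  β₁ : ℝ
  β₂ : ℝ
  ε : ℝ
  p : ℝ

section Algorithm

variable (P : Pipeline E) (CF CB : Compressor.{u} P.d)

/-- The fresh randomness of one iteration: a candidate sample, a uniform coin that decides whether
the sample is replaced, and the seeds of the forward and of the backward compressions. -/
abbrev Round : Type u :=
  Vec (P.d 0) × unitInterval × (Fin (E + 1) → CF.S) × (Fin (E + 1) → CB.S)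

/-- Law of the randomness of one iteration: all components are independent. -/
def roundLaw : Measure (Round P CF CB) :=
  P.D.prod ((volume : Measure unitInterval).prod
    ((Measure.pi fun _ => CF.ν).prod (Measure.pi fun _ => CB.ν)))

instance : IsProbabilityMeasure (roundLaw P CF CB) := by
  unfold roundLaw; infer_instance

/-- Law of the randomness of the whole run: the iterations are independent. -/
def law : Measure (ℕ → Round P CF CB) :=
  Measure.infinitePi (fun _ : ℕ => roundLaw P CF CB)

/-- State after an iteration `t`: the sample `x`, the transmitted activations `y` (`ỹ`) and
activation gradients `v` (`ṽ`), the gradient estimate `g` of this iteration, the first and second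
moment estimates `m` (`ũ`) and `s` (`υ`), and the weights `w` to be used at iteration `t + 1`. -/
structure State where
  x : Vec (P.d 0)
  y : P.Layers
  v : P.Layers
  g : P.Params
  m : P.Params
  s : P.Params
  w : P.Params

variable {P} in
open Classical in
/-- Forward pass with error feedback: `ỹ_0 = x`, `y_e = a_e(ỹ_{e-1}, w_e)`, and
`ỹ_e = y_e` if the communication is exact, `ỹ_e = ỹ_e^{old} + C(y_e - ỹ_e^{old})` otherwise.
(The entry at position `E` is not used by the algorithm.) -/
def forward (exact : Prop) (seed : Fin (E + 1) → CF.S) (yold : P.Layers)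
    (x : Vec (P.d 0)) (w : P.Params) : P.Layers :=
  Fin.induction (motive := fun i => Vec (P.d i)) x fun e yt =>
    if exact then P.a e yt (w e)
    else yold e.succ + CF.map e.succ (seed e.succ) (P.a e yt (w e) - yold e.succ)

variable {P} in
open Classical in
/-- Backward pass with error feedback: `ṽ_E = 1`, `v_{e-1} = ∇₁ a_e(ỹ_{e-1}, w_e)ᵀ ṽ_e`, and
`ṽ_{e-1} = v_{e-1}` if the communication is exact, `ṽ_{e-1} = ṽ_{e-1}^{old} + C(v_{e-1} -
ṽ_{e-1}^{old})` otherwise. (The entry at position `0` is not used by the algorithm.) -/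
def backward (exact : Prop) (seed : Fin (E + 1) → CB.S) (vold : P.Layers)
    (y : P.Layers) (w : P.Params) : P.Layers :=
  Fin.reverseInduction (motive := fun i => Vec (P.d i)) (WithLp.toLp 2 fun _ => 1) fun e vt =>
    let v := ContinuousLinearMap.adjoint (P.jac₁ e (y e.castSucc) (w e)) vt
    if exact then v
    else vold e.castSucc + CB.map e.castSucc (seed e.castSucc) (v - vold e.castSucc)

/-- A new sample is drawn at the first iteration, and with probability `p` at each later one. -/
def Fresh (p : ℝ) (n : ℕ) (coin : unitInterval) : Prop := n = 0 ∨ (coin : ℝ) ≤ p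

open Classical in
/-- One iteration of Clapping with Adam (iteration number `n + 1`). -/
def step (vr : Variant) (h : Hyper) (n : ℕ) (z : Round P CF CB) (st : State P) : State P :=
  let fresh : Prop := Fresh h.p n z.2.1
  let exact : Prop := vr = Variant.FU ∧ fresh
  let x := if fresh then z.1 else st.x
  let y := forward CF exact z.2.2.1 st.y x st.w
  let v := backward CB exact z.2.2.2 st.v y st.w
  let g : P.Params := WithLp.toLp 2 fun e =>
    ContinuousLinearMap.adjoint (P.jac₂ e (y e.castSucc) (st.w e)) (v e.succ)
  let m : P.Params := (1 - h.β₁) • st.m + h.β₁ • g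
  let s : P.Params := WithLp.toLp 2 fun e => WithLp.toLp 2 fun j =>
    (1 - h.β₂) * st.s e j + h.β₂ * g e j ^ 2
  let w : P.Params := WithLp.toLp 2 fun e => WithLp.toLp 2 fun j =>
    st.w e j - h.γ * (m e j / Real.sqrt (s e j + h.ε))
  ⟨x, y, v, g, m, s, w⟩

/-- State after the first `n` iterations, started from the weights `w₁` and zero memories. -/
def run (vr : Variant) (h : Hyper) (w₁ : P.Params) :
    ℕ → (ℕ → Round P CF CB) → State P
  | 0, _ => ⟨0, 0, 0, 0, 0, 0, w₁⟩
  | n + 1, z => step P CF CB vr h n (z n) (run vr h w₁ n z)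

end Algorithm

/-- Constants of the assumptions: Lipschitz constant `Lℓ` of `∇ℓ`, bound `Ca` of the Jacobians,
Lipschitz constants `La` and `LG` of the operators and of their Jacobians, bound `M₁` of the
gradient estimates, Adam regularization `ε`, bound `Δ` of the initial gap `ℓ(w₁) - inf ℓ`, and
bound `B` of the second moments of the activations at the initial weights. -/
structure Constants where
  Lℓ : ℝ
  Ca : ℝ
  La : ℝ
  LG : ℝ
  M₁ : ℝ
  ε : ℝ
  Δ : ℝ
  B : ℝ
  Lℓ_nonneg : 0 ≤ Lℓ
  Ca_nonneg : 0 ≤ Ca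
  La_nonneg : 0 ≤ La
  LG_nonneg : 0 ≤ LG
  M₁_nonneg : 0 ≤ M₁
  ε_pos : 0 < ε
  Δ_nonneg : 0 ≤ Δ
  B_nonneg : 0 ≤ B

/-- Smoothness of the objective and of the operators. -/
structure Smoothness (K : Constants) (P : Pipeline E) : Prop where
  risk_diff : Differentiable ℝ P.risk
  risk_grad_lip : ∀ w w' : P.Params, ‖∇ P.risk w - ∇ P.risk w'‖ ≤ K.Lℓ * ‖w - w'‖
  a_diff : ∀ e, Differentiable ℝ
    (fun q : Vec (P.d e.castSucc) × Vec (P.dw e) => P.a e q.1 q.2)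
  jac₁_bound : ∀ e y w, ‖P.jac₁ e y w‖ ≤ K.Ca
  jac₂_bound : ∀ e y w, ‖P.jac₂ e y w‖ ≤ K.Ca
  a_lip : ∀ e, e.succ ≠ Fin.last E → ∀ y y' w w',
    ‖P.a e y w - P.a e y' w'‖ ≤ K.La * (‖y - y'‖ + ‖w - w'‖)
  jac₁_lip : ∀ e : Fin E, (e : ℕ) ≠ 0 → ∀ y y' w w',
    ‖P.jac₁ e y w - P.jac₁ e y' w'‖ ≤ K.LG * (‖y - y'‖ + ‖w - w'‖)
  jac₂_lip : ∀ e : Fin E, (e : ℕ) ≠ 0 → ∀ y y' w w',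
    ‖P.jac₂ e y w - P.jac₂ e y' w'‖ ≤ K.LG * (‖y - y'‖ + ‖w - w'‖)
  /-- for the first worker, only in its weights -/
  jac₂_first_lip : ∀ e : Fin E, (e : ℕ) = 0 → ∀ y w w',
    ‖P.jac₂ e y w - P.jac₂ e y w'‖ ≤ K.LG * ‖w - w'‖

/-- The stochastic gradient is unbiased with variance at most `σ²`. -/
structure UnbiasedGradient (σ : ℝ) (P : Pipeline E) : Prop where
  loss_integrable : ∀ w, Integrable (fun x => P.loss x w) P.D
  grad_integrable : ∀ w, Integrable (fun x => ∇ (P.loss x) w) P.D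
  unbiased : ∀ w, ∫ x, ∇ (P.loss x) w ∂P.D = ∇ P.risk w
  variance : ∀ w,
    ∫⁻ x, ENNReal.ofReal (‖∇ (P.loss x) w - ∇ P.risk w‖ ^ 2) ∂P.D ≤ ENNReal.ofReal (σ ^ 2)

/-- Two independent samples satisfy `𝔼 ‖x₁ - x₂‖² ≤ φ²`. -/
def BoundedSpread (φ : ℝ) (P : Pipeline E) : Prop :=
  ∫⁻ q, ENNReal.ofReal (‖q.1 - q.2‖ ^ 2) ∂(P.D.prod P.D) ≤ ENNReal.ofReal (φ ^ 2)

/-- The starting point: `ℓ(w₁) - inf ℓ ≤ Δ`, and the activations sent between the workers at `w₁`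
have second moments at most `B²`. -/
structure InitialPoint (K : Constants) (P : Pipeline E) (w₁ : P.Params) : Prop where
  gap : ∀ w, P.risk w₁ - P.risk w ≤ K.Δ
  act_bound : ∀ i : Fin (E + 1), i ≠ 0 → i ≠ Fin.last E →
    ∫⁻ x, ENNReal.ofReal (‖P.act x w₁ i‖ ^ 2) ∂P.D ≤ ENNReal.ofReal (K.B ^ 2)

/-- In the first `T` iterations, the gradient estimates of all workers are bounded by `M₁`. -/
def BoundedEstimates (K : Constants) (P : Pipeline E) (CF CB : Compressor.{u} P.d) (vr : Variant)
    (h : Hyper) (w₁ : P.Params) (T : ℕ) : Prop :=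
  ∀ᵐ z ∂(law P CF CB), ∀ t < T, ∀ e, ‖(run P CF CB vr h w₁ (t + 1) z).g e‖ ≤ K.M₁

/-- `(1 / T) ∑_{t=1}^T 𝔼 ‖∇ℓ(w^{(t)})‖²` is well defined and at most `R`. -/
def AvgGradSqLE (P : Pipeline E) (CF CB : Compressor.{u} P.d) (vr : Variant)
    (h : Hyper) (w₁ : P.Params) (T : ℕ) (R : ℝ) : Prop :=
  (∀ t < T, Integrable (fun z => ‖∇ P.risk (run P CF CB vr h w₁ t z).w‖ ^ 2) (law P CF CB)) ∧
  (1 / (T : ℝ)) * ∑ t ∈ Finset.range T,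
    ∫ z, ‖∇ P.risk (run P CF CB vr h w₁ t z).w‖ ^ 2 ∂(law P CF CB) ≤ R

/-- With the parameters `γ, β₁, p`, after `T` iterations and for every `β₂ ∈ (0, 1)`, the bound `R`
holds for every pipeline, compressors and starting point that satisfy the assumptions. -/
def Guarantee (E : ℕ) (K : Constants) (vr : Variant) (σ φ ωF ωB : ℝ) (T : ℕ)
    (γ β₁ p R : ℝ) : Prop :=
  ∀ (P : Pipeline E) (CF CB : Compressor.{u} P.d) (w₁ : P.Params) (β₂ : ℝ),
    β₂ ∈ Set.Ioo (0 : ℝ) 1 →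
    Smoothness K P → UnbiasedGradient σ P → CF.Contractive ωF → CB.Contractive ωB →
    BoundedSpread φ P → InitialPoint K P w₁ →
    BoundedEstimates K P CF CB vr ⟨γ, β₁, β₂, K.ε, p⟩ w₁ T →
    AvgGradSqLE P CF CB vr ⟨γ, β₁, β₂, K.ε, p⟩ w₁ T R

end Clapping

end

open MeasureTheory
open scoped Gradient
noncomputable section
namespace Clapping
universe u
variable {E : ℕ}

/-! By the almost sure bound of the gradient estimates, Adam is descent with a diagonal
preconditioner whose entries lie in `[precondLo, precondUp]`, whatever β₂ is. The descent inequality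
therefore reduces the claim to a bound of the sum over the rounds of 𝔼‖m − ∇ℓ(w)‖², where m is the
averaged gradient estimate. This error splits into averaged sampling noise and a residual.

Noise. A sample is reused for about 1/p rounds, so after its first use its noise is correlated with
the weights. The noise is therefore frozen at the weights at which the sample was drawn, where it is
centred given the past. Its correlation with the running average contracts by 1 − p in every round,
which gives a second moment of order β₁σ²/p (`integral_avgNoise_le`). Unfreezing costs a Lipschitz
constant times the distance travelled since the last draw, that is, 2/p times the weight changes
(`ctrl_lag`).

Compression. With error feedback, the vector to be compressed obeys a linear recursion of rate ω,
forced by the motion of its target and started by a transient of size O(1). Every L² norm is split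
into a part that is ℓ² in time (motion) and a part that is ℓ¹ in time (transient). The predicate
`Ctrl` records this split and is stable under the recursion at the price 1/(1 − ω). Passing through
the E − 1 links in both directions costs 1/θ, with θ the `contraction` (`ctrl_forward`,
`ctrl_backward`, `ctrl_errG`). The split pays off because averaging with rate β turns ℓ¹ mass V into
only βV² of energy (`sum_sq_averaging_le`): for β ≤ θ, a transient of mass 1/θ costs at most 1/β
instead of 1/θ².

Sample changes force the first link. In FU they happen only in exact rounds and disappear; in FC
they contribute mean square at most pφ² per round (`dy_zero_le`).

Closing the loop. The residual is driven by the weight changes, which are at most γ `precondUp` ‖m‖.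
With γ = cβ₁, c small, β₁ ≤ θ and β₁ ≤ p, this feedback is absorbed by the negative multiple of ‖m‖²
in the descent inequality (`descent_arith`). What remains is a constant times 1/(β₁T) + β₁σ²/p +
drift/θ², and the rates follow by choosing β₁, and in FC also p. For σ = 0 the noise vanishes almost
surely, and p may be smaller than β₁. -/

/-! ### Linear recursions in ℓ¹ and ℓ², and mixed control of sequences -/

/-- The solution of `s 0 = f 0`, `s (n + 1) = ω s n + f (n + 1)`. -/
def linRec (ω : ℝ) (f : ℕ → ℝ) : ℕ → ℝ
  | 0 => f 0
  | n + 1 => ω * linRec ω f n + f (n + 1)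

lemma linRec_nonneg {ω : ℝ} (hω : 0 ≤ ω) {f : ℕ → ℝ} (hf : ∀ n, 0 ≤ f n) (n : ℕ) :
    0 ≤ linRec ω f n := by
  induction n with
  | zero => exact hf 0
  | succ n ih => exact add_nonneg (mul_nonneg hω ih) (hf _)

/-- Summing the recursion telescopes. The boundary term keeps this an identity, so that the
induction closes and the ℓ¹ bound follows by dropping it. -/
lemma sum_linRec_aux (ω : ℝ) (f : ℕ → ℝ) (n : ℕ) :
    (1 - ω) * ∑ k ∈ Finset.range (n + 1), linRec ω f k + ω * linRec ω f n
      = ∑ k ∈ Finset.range (n + 1), f k := by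
  induction n with
  | zero => simp only [linRec, zero_add, Finset.range_one, Finset.sum_singleton]; ring
  | succ n ih =>
    rw [Finset.sum_range_succ, Finset.sum_range_succ f, ← ih]
    simp only [linRec]; ring

lemma sum_linRec_le {ω : ℝ} (hω : 0 ≤ ω) {f : ℕ → ℝ} (hf : ∀ n, 0 ≤ f n) (T : ℕ) :
    (1 - ω) * ∑ k ∈ Finset.range T, linRec ω f k ≤ ∑ k ∈ Finset.range T, f k := by
  cases T with
  | zero => simp
  | succ n =>
    rw [← sum_linRec_aux ω f n]
    have := mul_nonneg hω (linRec_nonneg hω hf n)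
    linarith

lemma linRec_le_sum {ω : ℝ} (hω : 0 ≤ ω) (hω1 : ω ≤ 1) {f : ℕ → ℝ} (hf : ∀ n, 0 ≤ f n) (n : ℕ) :
    linRec ω f n ≤ ∑ k ∈ Finset.range (n + 1), f k := by
  induction n with
  | zero => simp [linRec]
  | succ n ih =>
    rw [Finset.sum_range_succ]
    have := mul_le_mul_of_nonneg_right hω1 (linRec_nonneg hω hf n)
    simp only [linRec]; linarith

/-- Convexity of the square, applied to ω·s + (1 − ω)·(f/(1 − ω)), shows that the squares satisfy a
recursion of the same rate with forcing f²/(1 − ω). Summation then costs a second factor 1/(1 − ω).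
-/
lemma sum_sq_linRec_aux {ω : ℝ} (hω : 0 ≤ ω) (hω1 : ω < 1) (f : ℕ → ℝ) (n : ℕ) :
    (1 - ω) * ∑ k ∈ Finset.range (n + 1), linRec ω f k ^ 2 + ω * linRec ω f n ^ 2
      ≤ (∑ k ∈ Finset.range (n + 1), f k ^ 2) / (1 - ω) := by
  have h1 : 0 < 1 - ω := by linarith
  induction n with
  | zero =>
    rw [le_div_iff₀ h1]
    simp only [linRec, zero_add, Finset.range_one, Finset.sum_singleton]
    nlinarith [sq_nonneg (f 0), mul_nonneg hω (sq_nonneg (f 0))]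
  | succ n ih =>
    rw [Finset.sum_range_succ, Finset.sum_range_succ (fun k => f k ^ 2), add_div]
    have key : linRec ω f (n + 1) ^ 2 ≤ ω * linRec ω f n ^ 2 + f (n + 1) ^ 2 / (1 - ω) := by
      rw [← sub_le_iff_le_add', le_div_iff₀ h1]
      simp only [linRec]
      -- After multiplication by 1 − ω, the gap between the two sides is exactly ω((1 − ω)s − f)².
      nlinarith [mul_nonneg hω (sq_nonneg (linRec ω f n * (1 - ω) - f (n + 1)))]
    linarith

lemma sum_sq_linRec_le {ω : ℝ} (hω : 0 ≤ ω) (hω1 : ω < 1) (f : ℕ → ℝ) (T : ℕ) :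
    ∑ k ∈ Finset.range T, linRec ω f k ^ 2
      ≤ (∑ k ∈ Finset.range T, f k ^ 2) / (1 - ω) ^ 2 := by
  have h1 : 0 < 1 - ω := by linarith
  cases T with
  | zero => simp
  | succ n =>
    have h := sum_sq_linRec_aux hω hω1 f n
    have h2 := mul_nonneg hω (sq_nonneg (linRec ω f n))
    rw [le_div_iff₀ h1] at h
    rw [le_div_iff₀ (by positivity)]
    nlinarith

lemma le_ofReal_linRec {ω : ℝ} (hω : 0 ≤ ω) {f : ℕ → ℝ} (hf : ∀ n, 0 ≤ f n) {a : ℕ → ENNReal}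
    {T : ℕ} (h0 : 0 < T → a 0 ≤ ENNReal.ofReal (f 0))
    (hs : ∀ n, n + 1 < T → a (n + 1) ≤ ENNReal.ofReal ω * a n + ENNReal.ofReal (f (n + 1)))
    (n : ℕ) (hn : n < T) : a n ≤ ENNReal.ofReal (linRec ω f n) := by
  induction n with
  | zero => exact h0 hn
  | succ n ih =>
    refine (hs n hn).trans ?_
    simp only [linRec]
    rw [ENNReal.ofReal_add (mul_nonneg hω (linRec_nonneg hω hf n)) (hf _),
      ENNReal.ofReal_mul hω]
    gcongr
    exact ih (by omega)

lemma sum_add_sq_le {T : ℕ} {p q : ℕ → ℝ} {a b : ℝ} (ha : 0 ≤ a) (hb : 0 ≤ b)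
    (hp : ∑ n ∈ Finset.range T, p n ^ 2 ≤ a ^ 2) (hq : ∑ n ∈ Finset.range T, q n ^ 2 ≤ b ^ 2) :
    ∑ n ∈ Finset.range T, (p n + q n) ^ 2 ≤ (a + b) ^ 2 := by
  have h := Finset.sum_mul_sq_le_sq_mul_sq (Finset.range T) p q
  have h2 : (∑ n ∈ Finset.range T, p n * q n) ^ 2 ≤ (a * b) ^ 2 := by
    rw [mul_pow]
    exact h.trans (mul_le_mul hp hq (Finset.sum_nonneg fun _ _ => sq_nonneg _) (sq_nonneg _))
  have h3 := abs_le_of_sq_le_sq h2 (by positivity)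
  have h4 : ∑ n ∈ Finset.range T, (p n + q n) ^ 2 = ∑ n ∈ Finset.range T, p n ^ 2
      + 2 * ∑ n ∈ Finset.range T, p n * q n + ∑ n ∈ Finset.range T, q n ^ 2 := by
    rw [Finset.mul_sum, ← Finset.sum_add_distrib, ← Finset.sum_add_distrib]
    exact Finset.sum_congr rfl fun _ _ => by ring
  nlinarith [(abs_le.1 h3).2]

/-- The first `T` terms of `a` are bounded by the sum of a sequence with `ℓ²` norm at most `α U`
and of a sequence with `ℓ¹` norm at most `α V`. -/
def Ctrl (T : ℕ) (U V α : ℝ) (a : ℕ → ENNReal) : Prop :=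
  ∃ p q : ℕ → ℝ, (∀ n, 0 ≤ p n) ∧ (∀ n, 0 ≤ q n) ∧
    (∀ n < T, a n ≤ ENNReal.ofReal (p n + q n)) ∧
    ∑ n ∈ Finset.range T, p n ^ 2 ≤ (α * U) ^ 2 ∧ ∑ n ∈ Finset.range T, q n ≤ α * V

namespace Ctrl

variable {T : ℕ} {U V α α' : ℝ} {a b f : ℕ → ENNReal}

lemma mono (h : Ctrl T U V α a) (hb : ∀ n < T, b n ≤ a n) : Ctrl T U V α b := by
  obtain ⟨p, q, hp, hq, hpq, h1, h2⟩ := h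
  exact ⟨p, q, hp, hq, fun n hn => (hb n hn).trans (hpq n hn), h1, h2⟩

lemma mono_const (h : Ctrl T U V α a) (hU : 0 ≤ U) (hV : 0 ≤ V) (hα : 0 ≤ α) (hα' : α ≤ α') :
    Ctrl T U V α' a := by
  obtain ⟨p, q, hp, hq, hpq, h1, h2⟩ := h
  exact ⟨p, q, hp, hq, hpq, h1.trans (by gcongr), h2.trans (by gcongr)⟩

lemma zero (hα : 0 ≤ α) (hV : 0 ≤ V) : Ctrl T U V α (fun _ => 0) :=
  ⟨0, 0, by simp, by simp, by simp, by simpa using sq_nonneg _, by simpa using mul_nonneg hα hV⟩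

lemma add (h : Ctrl T U V α a) (h' : Ctrl T U V α' b) (hU : 0 ≤ U) (hα : 0 ≤ α) (hα' : 0 ≤ α') :
    Ctrl T U V (α + α') (fun n => a n + b n) := by
  obtain ⟨p, q, hp, hq, hpq, h1, h2⟩ := h
  obtain ⟨p', q', hp', hq', hpq', h1', h2'⟩ := h'
  refine ⟨fun n => p n + p' n, fun n => q n + q' n, fun n => add_nonneg (hp n) (hp' n),
    fun n => add_nonneg (hq n) (hq' n), fun n hn => ?_, ?_, ?_⟩
  · refine (add_le_add (hpq n hn) (hpq' n hn)).trans_eq ?_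
    rw [← ENNReal.ofReal_add (add_nonneg (hp n) (hq n)) (add_nonneg (hp' n) (hq' n))]
    congr 1; ring
  · rw [add_mul]
    exact sum_add_sq_le (by positivity) (by positivity) h1 h1'
  · rw [Finset.sum_add_distrib, add_mul]
    exact add_le_add h2 h2'

lemma smul {c : ℝ} (hc : 0 ≤ c) (h : Ctrl T U V α a) :
    Ctrl T U V (c * α) (fun n => ENNReal.ofReal c * a n) := by
  obtain ⟨p, q, hp, hq, hpq, h1, h2⟩ := h
  refine ⟨fun n => c * p n, fun n => c * q n, fun n => mul_nonneg hc (hp n),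
    fun n => mul_nonneg hc (hq n), fun n hn => ?_, ?_, ?_⟩
  · dsimp only
    rw [← mul_add, ENNReal.ofReal_mul hc]
    exact mul_le_mul_right (hpq n hn) _
  · simp_rw [mul_pow]
    rw [← Finset.mul_sum]
    calc c ^ 2 * _ ≤ c ^ 2 * (α * U) ^ 2 := by gcongr
      _ = _ := by ring
  · rw [← Finset.mul_sum, mul_assoc]
    gcongr

lemma sum {ι : Type*} (s : Finset ι) {g : ι → ℕ → ENNReal} (hU : 0 ≤ U) (hV : 0 ≤ V) (hα : 0 ≤ α)
    (h : ∀ i ∈ s, Ctrl T U V α (g i)) :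
    Ctrl T U V (s.card * α) (fun n => ∑ i ∈ s, g i n) := by
  classical
  induction s using Finset.induction_on with
  | empty => simpa using zero (T := T) (U := U) (le_refl (0 : ℝ)) hV
  | insert i s hi ih =>
    have := add (h i (Finset.mem_insert_self _ _))
      (ih fun j hj => h j (Finset.mem_insert_of_mem hj)) hU hα (by positivity)
    simp only [Finset.sum_insert hi, Finset.card_insert_of_notMem hi]
    convert this using 1
    push_cast; ring

/-- Needed because the backward recursion is also forced by the error of the preceding round. -/
lemma shift (h : Ctrl T U V α a) :
    Ctrl T U V α (fun n => match n with | 0 => 0 | n + 1 => a n) := by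
  obtain ⟨p, q, hp, hq, hpq, h1, h2⟩ := h
  refine ⟨fun n => match n with | 0 => 0 | n + 1 => p n,
    fun n => match n with | 0 => 0 | n + 1 => q n, ?_, ?_, ?_, ?_, ?_⟩
  · rintro (_ | n)
    · exact le_rfl
    · exact hp n
  · rintro (_ | n)
    · exact le_rfl
    · exact hq n
  · rintro (_ | n) hn
    · simp
    · exact hpq n (by omega)
  · refine le_trans ?_ h1
    cases T with
    | zero => simp
    | succ T =>
      rw [Finset.sum_range_succ', Finset.sum_range_succ]
      simp only [ne_eq, OfNat.ofNat_ne_zero, not_false_eq_true, zero_pow, add_zero]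
      linarith [sq_nonneg (p T)]
  · refine le_trans ?_ h2
    cases T with
    | zero => simp
    | succ T =>
      rw [Finset.sum_range_succ', Finset.sum_range_succ]
      simp only [add_zero]
      linarith [hq T]

/-- A one-time transient goes entirely into the ℓ¹ part, where it is not multiplied by the number of
rounds. -/
lemma single {c : ℝ} (hα : 0 ≤ α) (hV : 0 ≤ V) (hc : c ≤ α * V) :
    Ctrl T U V α (fun n => if n = 0 then ENNReal.ofReal c else 0) := by
  refine ⟨0, fun n => if n = 0 then max c 0 else 0, by simp, ?_, ?_, by simpa using sq_nonneg _, ?_⟩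
  · intro n; dsimp only; split_ifs <;> simp
  · intro n _
    dsimp only
    split_ifs <;> simp
  · refine (Finset.sum_le_sum_of_subset_of_nonneg (Finset.subset_insert 0 _) ?_).trans
      (b := ∑ n ∈ insert 0 (Finset.range T), if n = 0 then max c 0 else 0) ?_
    · intro i _ _; split_ifs <;> simp
    · simp only [Finset.sum_ite_eq', Finset.mem_insert_self, if_true]
      exact max_le hc (by positivity)

/-- The recursion is linear, so the two parts evolve separately, and convolution with the geometric
kernel has norm at most 1/(1 − ω) on ℓ² and on ℓ¹ alike. Error feedback therefore costs one such
factor per link and preserves the split. -/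
lemma recursion {ω : ℝ} (hω : 0 ≤ ω) (hω1 : ω < 1) (hf : Ctrl T U V α f)
    (h0 : 0 < T → a 0 ≤ f 0)
    (hs : ∀ n, n + 1 < T → a (n + 1) ≤ ENNReal.ofReal ω * a n + f (n + 1)) :
    Ctrl T U V (α / (1 - ω)) a := by
  obtain ⟨p, q, hp, hq, hpq, h1, h2⟩ := hf
  have h1ω : 0 < 1 - ω := by linarith
  have hlin : ∀ n, linRec ω (fun n => p n + q n) n = linRec ω p n + linRec ω q n := by
    intro n
    induction n with
    | zero => rfl
    | succ n ih => simp only [linRec, ih]; ring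
  refine ⟨linRec ω p, linRec ω q, linRec_nonneg hω hp, linRec_nonneg hω hq, fun n hn => ?_, ?_, ?_⟩
  · rw [← hlin]
    refine le_ofReal_linRec hω (fun n => add_nonneg (hp n) (hq n))
      (fun h => (h0 h).trans (hpq 0 h)) (fun n hn => (hs n hn).trans ?_) n hn
    gcongr
    exact hpq _ hn
  · refine (sum_sq_linRec_le hω hω1 p T).trans ?_
    rw [div_mul_eq_mul_div, div_pow]
    gcongr
  · rw [div_mul_eq_mul_div, le_div_iff₀ h1ω, mul_comm]
    exact (sum_linRec_le hω hq T).trans h2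

end Ctrl

/-- Exponential averaging with rate `β` keeps the `ℓ²` norm, and sends a sequence of `ℓ¹` norm `V`
to a sequence of `ℓ²` norm at most `√β V`. -/
lemma sum_sq_averaging_le {β : ℝ} (hβ : 0 < β) (hβ1 : β ≤ 1) {p q : ℕ → ℝ} (hp : ∀ n, 0 ≤ p n)
    (hq : ∀ n, 0 ≤ q n) {a : ℕ → ENNReal} {T : ℕ}
    (h0 : 0 < T → a 0 ≤ ENNReal.ofReal (β * (p 0 + q 0)))
    (hs : ∀ n, n + 1 < T → a (n + 1) ≤ ENNReal.ofReal (1 - β) * a n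
      + ENNReal.ofReal (β * (p (n + 1) + q (n + 1)))) :
    ∑ n ∈ Finset.range T, a n ^ 2 ≤ ENNReal.ofReal
      (2 * (∑ n ∈ Finset.range T, p n ^ 2 + β * (∑ n ∈ Finset.range T, q n) ^ 2)) := by
  have hω : 0 ≤ 1 - β := by linarith
  set p' := linRec (1 - β) fun n => β * p n with hp'
  set q' := linRec (1 - β) fun n => β * q n with hq'
  have hlin : ∀ n, linRec (1 - β) (fun n => β * (p n + q n)) n = p' n + q' n := by
    intro n
    induction n with
    | zero => simp only [linRec, hp', hq']; ring
    | succ n ih => simp only [linRec, ih, hp', hq']; ring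
  have hp0 : ∀ n, 0 ≤ p' n := linRec_nonneg hω fun n => mul_nonneg hβ.le (hp n)
  have hq0 : ∀ n, 0 ≤ q' n := linRec_nonneg hω fun n => mul_nonneg hβ.le (hq n)
  have ha : ∀ n < T, a n ≤ ENNReal.ofReal (p' n + q' n) := by
    intro n hn
    rw [← hlin]
    exact le_ofReal_linRec hω (fun n => mul_nonneg hβ.le (add_nonneg (hp n) (hq n))) h0 hs n hn
  have hP : ∑ n ∈ Finset.range T, p' n ^ 2 ≤ ∑ n ∈ Finset.range T, p n ^ 2 := by
    refine (sum_sq_linRec_le hω (by linarith) _ T).trans_eq ?_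
    simp_rw [mul_pow]
    rw [← Finset.mul_sum, sub_sub_cancel, mul_div_cancel_left₀ _ (by positivity)]
  set Q := ∑ n ∈ Finset.range T, q n with hQ
  have hQ1 : ∑ n ∈ Finset.range T, q' n ≤ Q := by
    have := sum_linRec_le hω (fun n => mul_nonneg hβ.le (hq n)) T
    rw [← Finset.mul_sum, sub_sub_cancel] at this
    exact le_of_mul_le_mul_left this hβ
  -- The kernel of the averaging is at most β, so the averaged ℓ¹ part is uniformly at most βQ. With
  -- its sum at most Q, interpolation between sup and ℓ¹ gives the energy βQ².
  have hQ2 : ∀ n < T, q' n ≤ β * Q := by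
    intro n hn
    refine (linRec_le_sum hω (by linarith) (fun n => mul_nonneg hβ.le (hq n)) n).trans ?_
    rw [← Finset.mul_sum]
    refine mul_le_mul_of_nonneg_left ?_ hβ.le
    exact Finset.sum_le_sum_of_subset_of_nonneg
      (Finset.range_subset_range.2 hn) fun i _ _ => hq i
  have hQ0 : 0 ≤ Q := Finset.sum_nonneg fun n _ => hq n
  have hQ3 : ∑ n ∈ Finset.range T, q' n ^ 2 ≤ β * Q ^ 2 := by
    calc ∑ n ∈ Finset.range T, q' n ^ 2 ≤ ∑ n ∈ Finset.range T, β * Q * q' n := by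
          refine Finset.sum_le_sum fun n hn => ?_
          rw [sq]
          exact mul_le_mul_of_nonneg_right (hQ2 n (Finset.mem_range.1 hn)) (hq0 n)
      _ = β * Q * ∑ n ∈ Finset.range T, q' n := (Finset.mul_sum _ _ _).symm
      _ ≤ β * Q * Q := by gcongr
      _ = _ := by ring
  calc ∑ n ∈ Finset.range T, a n ^ 2
      ≤ ∑ n ∈ Finset.range T, ENNReal.ofReal ((p' n + q' n) ^ 2) := by
        refine Finset.sum_le_sum fun n hn => ?_
        rw [ENNReal.ofReal_pow (add_nonneg (hp0 n) (hq0 n))]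
        gcongr
        exact ha n (Finset.mem_range.1 hn)
    _ = ENNReal.ofReal (∑ n ∈ Finset.range T, (p' n + q' n) ^ 2) :=
        (ENNReal.ofReal_sum_of_nonneg fun n _ => sq_nonneg _).symm
    _ ≤ _ := by
        refine ENNReal.ofReal_le_ofReal ?_
        calc ∑ n ∈ Finset.range T, (p' n + q' n) ^ 2
            ≤ ∑ n ∈ Finset.range T, (2 * p' n ^ 2 + 2 * q' n ^ 2) :=
              Finset.sum_le_sum fun n _ => by nlinarith [sq_nonneg (p' n - q' n)]
          _ = 2 * (∑ n ∈ Finset.range T, p' n ^ 2 + ∑ n ∈ Finset.range T, q' n ^ 2) := by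
              rw [Finset.sum_add_distrib, ← Finset.mul_sum, ← Finset.mul_sum]; ring
          _ ≤ _ := by gcongr

/-! ### Propagation of bounds along the pipeline, and the constants -/

/-- Since 2c ≥ 1, the additive X is dominated by the bound already reached at the preceding
position, so each step merely multiplies by 2c. -/
lemma forward_chain_le {a : Fin (E + 1) → ℝ} {c X : ℝ} (hc : 1 ≤ c) (hX : 0 ≤ X) (h0 : a 0 ≤ X)
    (hs : ∀ e : Fin E, e.succ ≠ Fin.last E → a e.succ ≤ c * (a e.castSucc + X))
    (i : Fin (E + 1)) (hi : i ≠ Fin.last E) : a i ≤ (2 * c) ^ E * X := by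
  have key : ∀ i : Fin (E + 1), i ≠ Fin.last E → a i ≤ (2 * c) ^ (i : ℕ) * X := by
    intro i
    induction i using Fin.induction with
    | zero => intro _; simpa using h0
    | succ e ih =>
      intro hne
      refine (hs e hne).trans ?_
      have h1 := ih (Fin.castSucc_lt_last e).ne
      have h2 : X ≤ (2 * c) ^ (e : ℕ) * X :=
        le_mul_of_one_le_left hX (one_le_pow₀ (by linarith))
      simp only [Fin.val_castSucc] at h1
      calc c * (a e.castSucc + X) ≤ c * ((2 * c) ^ (e : ℕ) * X + (2 * c) ^ (e : ℕ) * X) := by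
            gcongr
        _ = _ := by rw [Fin.val_succ, pow_succ]; ring
  refine (key i hi).trans ?_
  gcongr
  · linarith
  · exact Nat.lt_succ_iff.1 i.2

lemma backward_chain_le {a : Fin (E + 1) → ℝ} {c X : ℝ} (hc : 1 ≤ c) (hX : 0 ≤ X)
    (h0 : a (Fin.last E) ≤ X)
    (hs : ∀ e : Fin E, (e : ℕ) ≠ 0 → a e.castSucc ≤ c * (a e.succ + X))
    (i : Fin (E + 1)) (hi : i ≠ 0) : a i ≤ (2 * c) ^ E * X := by
  have key : ∀ i : Fin (E + 1), i ≠ 0 → a i ≤ (2 * c) ^ (E - (i : ℕ)) * X := by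
    intro i
    induction i using Fin.reverseInduction with
    | last => intro _; simpa using h0
    | cast e ih =>
      intro hne
      have he : (e : ℕ) ≠ 0 := fun h => hne (Fin.ext h)
      refine (hs e he).trans ?_
      have h1 := ih (Fin.succ_ne_zero e)
      have h2 : X ≤ (2 * c) ^ (E - (e.succ : ℕ)) * X :=
        le_mul_of_one_le_left hX (one_le_pow₀ (by linarith))
      calc c * (a e.succ + X)
          ≤ c * ((2 * c) ^ (E - (e.succ : ℕ)) * X + (2 * c) ^ (E - (e.succ : ℕ)) * X) := by
            gcongr
        _ = (2 * c) ^ (E - (e.succ : ℕ) + 1) * X := by rw [pow_succ]; ring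
        _ = _ := by
          congr 2
          have := e.2
          simp only [Fin.val_succ, Fin.val_castSucc]; omega
  refine (key i hi).trans ?_
  gcongr
  · linarith
  · omega

namespace Constants

variable (K : Constants)

/-- A common bound of the constants. -/
def c₀ : ℝ := 1 + K.Lℓ + K.Ca + K.La + K.LG + K.B

/-- A bound of the exact activation gradients. -/
def c₁ (E : ℕ) : ℝ := (2 * K.c₀) ^ E

/-- A Lipschitz constant of the exact backward pass. -/
def c₂ (E : ℕ) : ℝ := (2 * (K.c₀ * K.c₁ E)) ^ E

/-- A Lipschitz constant of the exact gradient, in the activations and their gradients. -/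
def c₃ (E : ℕ) : ℝ := 1 + E * (K.c₀ * (K.c₂ E + K.c₁ E))

/-- A Lipschitz constant of the gradient of the loss. -/
def c₄ (E : ℕ) : ℝ := K.c₃ E * (E * K.c₁ E + 1)

lemma le_c₀ : 1 ≤ K.c₀ ∧ K.Lℓ ≤ K.c₀ ∧ K.Ca ≤ K.c₀ ∧ K.La ≤ K.c₀ ∧ K.LG ≤ K.c₀ ∧ K.B ≤ K.c₀ := by
  have h1 := K.Lℓ_nonneg
  have h2 := K.Ca_nonneg
  have h3 := K.La_nonneg
  have h4 := K.LG_nonneg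
  have h5 := K.B_nonneg
  unfold c₀
  refine ⟨?_, ?_, ?_, ?_, ?_, ?_⟩ <;> linarith

lemma one_le_c₀ : 1 ≤ K.c₀ := K.le_c₀.1

lemma one_le_c₁ (E : ℕ) : 1 ≤ K.c₁ E := one_le_pow₀ (by linarith [K.one_le_c₀])

lemma one_le_c₂ (E : ℕ) : 1 ≤ K.c₂ E := by
  refine one_le_pow₀ ?_
  have := one_le_mul_of_one_le_of_one_le K.one_le_c₀ (K.one_le_c₁ E)
  linarith

lemma one_le_c₃ (E : ℕ) : 1 ≤ K.c₃ E := by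
  have h0 := K.one_le_c₀
  have h1 := K.one_le_c₁ E
  have h2 := K.one_le_c₂ E
  unfold c₃
  have : 0 ≤ E * (K.c₀ * (K.c₂ E + K.c₁ E)) := by positivity
  linarith

lemma one_le_c₄ (E : ℕ) : 1 ≤ K.c₄ E := by
  have h1 := K.one_le_c₁ E
  refine one_le_mul_of_one_le_of_one_le (K.one_le_c₃ E) ?_
  have : 0 ≤ E * K.c₁ E := by positivity
  linarith

end Constants

/-! ### Exact backpropagation and its Lipschitz bounds -/

namespace Pipeline

variable (P : Pipeline E)

/-- Exact backward pass along given activations. -/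
def bp (y : P.Layers) (w : P.Params) : P.Layers :=
  Fin.reverseInduction (motive := fun i => Vec (P.d i)) (WithLp.toLp 2 fun _ => 1) fun e v =>
    ContinuousLinearMap.adjoint (P.jac₁ e (y e.castSucc) (w e)) v

/-- The gradient in the weights for given activations and activation gradients. -/
def gradAt (y v : P.Layers) (w : P.Params) : P.Params :=
  WithLp.toLp 2 fun e => ContinuousLinearMap.adjoint (P.jac₂ e (y e.castSucc) (w e)) (v e.succ)

/-- The gradient of the loss of one sample. -/
def lossGrad (x : Vec (P.d 0)) (w : P.Params) : P.Params :=
  P.gradAt (P.act x w) (P.bp (P.act x w) w) w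

/-- Distance of two families of activations, of the workers after the first. -/
def layerDist (y y' : P.Layers) : ℝ :=
  ∑ e ∈ Finset.univ.filter (fun e : Fin E => (e : ℕ) ≠ 0), ‖y e.castSucc - y' e.castSucc‖

variable {P}

lemma layerDist_nonneg (y y' : P.Layers) : 0 ≤ P.layerDist y y' :=
  Finset.sum_nonneg fun _ _ => norm_nonneg _

lemma le_layerDist (y y' : P.Layers) {e : Fin E} (he : (e : ℕ) ≠ 0) :
    ‖y e.castSucc - y' e.castSucc‖ ≤ P.layerDist y y' :=
  Finset.single_le_sum (f := fun e : Fin E => ‖y e.castSucc - y' e.castSucc‖)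
    (fun _ _ => norm_nonneg _) (by simpa using he)

@[simp] lemma act_zero (x : Vec (P.d 0)) (w : P.Params) : P.act x w 0 = x := rfl

@[simp] lemma act_succ (x : Vec (P.d 0)) (w : P.Params) (e : Fin E) :
    P.act x w e.succ = P.a e (P.act x w e.castSucc) (w e) := by
  simp [act]

@[simp] lemma bp_last (y : P.Layers) (w : P.Params) :
    P.bp y w (Fin.last E) = WithLp.toLp 2 fun _ => 1 := by
  simp [bp]

@[simp] lemma bp_castSucc (y : P.Layers) (w : P.Params) (e : Fin E) :
    P.bp y w e.castSucc
      = ContinuousLinearMap.adjoint (P.jac₁ e (y e.castSucc) (w e)) (P.bp y w e.succ) := by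
  simp [bp]

lemma norm_bp_last (y : P.Layers) (w : P.Params) : ‖P.bp y w (Fin.last E)‖ = 1 := by
  simp [EuclideanSpace.norm_eq, P.d_last]

lemma norm_params_le (w : P.Params) (e : Fin E) : ‖w e‖ ≤ ‖w‖ := PiLp.norm_apply_le w e

lemma norm_params_le_sum (w : P.Params) : ‖w‖ ≤ ∑ e, ‖w e‖ := by
  rw [PiLp.norm_eq_of_L2]
  refine Real.sqrt_le_iff.2 ⟨Finset.sum_nonneg fun _ _ => norm_nonneg _, ?_⟩
  exact Finset.sum_sq_le_sq_sum_of_nonneg fun _ _ => norm_nonneg _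

lemma norm_adjoint_apply_le {m n : ℕ} (A : Vec m →L[ℝ] Vec n) (v : Vec n) :
    ‖ContinuousLinearMap.adjoint A v‖ ≤ ‖A‖ * ‖v‖ := by
  simpa using (ContinuousLinearMap.adjoint A).le_opNorm v

lemma norm_adjoint_sub_le {m n : ℕ} (A A' : Vec m →L[ℝ] Vec n) (v v' : Vec n) :
    ‖ContinuousLinearMap.adjoint A v - ContinuousLinearMap.adjoint A' v'‖
      ≤ ‖A‖ * ‖v - v'‖ + ‖A - A'‖ * ‖v'‖ := by
  have : ContinuousLinearMap.adjoint A v - ContinuousLinearMap.adjoint A' v'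
      = ContinuousLinearMap.adjoint A (v - v') + ContinuousLinearMap.adjoint (A - A') v' := by
    simp [map_sub]
  rw [this]
  exact (norm_add_le _ _).trans (add_le_add (norm_adjoint_apply_le _ _) (norm_adjoint_apply_le _ _))

section Bounds

variable {K : Constants}

lemma norm_bp_le (hP : Smoothness K P) (y : P.Layers) (w : P.Params) (i : Fin (E + 1))
    (hi : i ≠ 0) : ‖P.bp y w i‖ ≤ K.c₁ E := by
  have := backward_chain_le (a := fun i => ‖P.bp y w i‖) K.one_le_c₀ zero_le_one
    (norm_bp_last y w).le (fun e _ => ?_) i hi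
  · simpa [Constants.c₁] using this
  · rw [bp_castSucc]
    refine (norm_adjoint_apply_le _ _).trans ?_
    have h1 : ‖P.jac₁ e (y e.castSucc) (w e)‖ ≤ K.c₀ := (hP.jac₁_bound e _ _).trans K.le_c₀.2.2.1
    have := K.one_le_c₀
    gcongr
    linarith

/-- The values at positions i ≠ 0 never use ∇₁ of the first worker. Lipschitz Jacobians of the later
workers are therefore enough, and the first activation is absent from `layerDist`. The variation of
a Jacobian is multiplied by an exact activation gradient, which is bounded by `c₁`. -/
lemma norm_bp_sub_le (hP : Smoothness K P) (y y' : P.Layers) (w w' : P.Params) (i : Fin (E + 1))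
    (hi : i ≠ 0) : ‖P.bp y w i - P.bp y' w' i‖ ≤ K.c₂ E * (P.layerDist y y' + ‖w - w'‖) := by
  have hX : 0 ≤ P.layerDist y y' + ‖w - w'‖ := add_nonneg (layerDist_nonneg _ _) (norm_nonneg _)
  have h0 := K.one_le_c₀
  have h1 := K.one_le_c₁ E
  refine backward_chain_le (a := fun i => ‖P.bp y w i - P.bp y' w' i‖)
    (one_le_mul_of_one_le_of_one_le h0 h1) hX (by simpa using hX) (fun e he => ?_) i hi
  rw [bp_castSucc, bp_castSucc]
  refine (norm_adjoint_sub_le _ _ _ _).trans ?_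
  have h2 : ‖P.jac₁ e (y e.castSucc) (w e)‖ ≤ K.c₀ := (hP.jac₁_bound e _ _).trans K.le_c₀.2.2.1
  have h3 : ‖P.jac₁ e (y e.castSucc) (w e) - P.jac₁ e (y' e.castSucc) (w' e)‖
      ≤ K.c₀ * (P.layerDist y y' + ‖w - w'‖) := by
    refine (hP.jac₁_lip e he _ _ _ _).trans ?_
    refine mul_le_mul K.le_c₀.2.2.2.2.1 ?_ (by positivity) (by linarith)
    exact add_le_add (le_layerDist y y' he) (norm_params_le (w - w') e)
  have h4 := norm_bp_le hP y' w' e.succ (Fin.succ_ne_zero e)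
  have h5 : K.c₀ * ‖P.bp y w e.succ - P.bp y' w' e.succ‖
      ≤ K.c₀ * K.c₁ E * ‖P.bp y w e.succ - P.bp y' w' e.succ‖ := by
    refine mul_le_mul_of_nonneg_right ?_ (norm_nonneg _)
    exact le_mul_of_one_le_right (by linarith) h1
  calc _ ≤ K.c₀ * ‖P.bp y w e.succ - P.bp y' w' e.succ‖
        + K.c₀ * (P.layerDist y y' + ‖w - w'‖) * K.c₁ E := by gcongr
    _ ≤ _ := by linarith

/-- Both families share the input of the first worker, where only regularity in the weights is
available. -/
lemma norm_jac₂_sub_le (hP : Smoothness K P) (y y' : P.Layers) (w w' : P.Params)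
    (h : y 0 = y' 0) (e : Fin E) :
    ‖P.jac₂ e (y e.castSucc) (w e) - P.jac₂ e (y' e.castSucc) (w' e)‖
      ≤ K.c₀ * (P.layerDist y y' + ‖w - w'‖) := by
  have h0 := K.one_le_c₀
  have h1 := layerDist_nonneg y y'
  by_cases he : (e : ℕ) = 0
  · have hc : e.castSucc = 0 := Fin.ext he
    have hy : y e.castSucc = y' e.castSucc := by rw [hc]; exact h
    rw [hy]
    refine (hP.jac₂_first_lip e he _ _ _).trans ?_
    refine mul_le_mul K.le_c₀.2.2.2.2.1 ?_ (by positivity) (by linarith)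
    exact (norm_params_le (w - w') e).trans (by linarith)
  · refine (hP.jac₂_lip e he _ _ _ _).trans ?_
    refine mul_le_mul K.le_c₀.2.2.2.2.1 ?_ (by positivity) (by linarith)
    exact add_le_add (le_layerDist y y' he) (norm_params_le (w - w') e)

/-- The activation gradients v are compared with the exact backward pass along the same activations
y, and only then is y exchanged for y'. Forward and backward errors thus enter additively, and no
bound on v is required. -/
lemma norm_gradAt_sub_le (hP : Smoothness K P) (y y' v : P.Layers) (w w' : P.Params)
    (h : y 0 = y' 0) :
    ‖P.gradAt y v w - P.gradAt y' (P.bp y' w') w'‖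
      ≤ K.c₃ E * (∑ e : Fin E, ‖v e.succ - P.bp y w e.succ‖ + P.layerDist y y' + ‖w - w'‖) := by
  have h0 := K.one_le_c₀
  have h1 := K.one_le_c₁ E
  have h2 := K.one_le_c₂ E
  set X := P.layerDist y y' + ‖w - w'‖ with hX
  have hX0 : 0 ≤ X := add_nonneg (layerDist_nonneg _ _) (norm_nonneg _)
  set S := ∑ e : Fin E, ‖v e.succ - P.bp y w e.succ‖ with hS
  have hS0 : 0 ≤ S := Finset.sum_nonneg fun _ _ => norm_nonneg _
  have key : ∀ e : Fin E, ‖(P.gradAt y v w - P.gradAt y' (P.bp y' w') w') e‖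
      ≤ K.c₀ * (K.c₂ E + K.c₁ E) * (S + X) := by
    intro e
    have h3 : ‖P.jac₂ e (y e.castSucc) (w e)‖ ≤ K.c₀ := (hP.jac₂_bound e _ _).trans K.le_c₀.2.2.1
    have h4 := norm_jac₂_sub_le hP y y' w w' h e
    have h5 := norm_bp_le hP y' w' e.succ (Fin.succ_ne_zero e)
    have h6 : ‖v e.succ - P.bp y' w' e.succ‖ ≤ S + K.c₂ E * X := by
      refine (norm_sub_le_norm_sub_add_norm_sub _ (P.bp y w e.succ) _).trans (add_le_add ?_ ?_)
      · exact Finset.single_le_sum (f := fun e : Fin E => ‖v e.succ - P.bp y w e.succ‖)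
          (fun _ _ => norm_nonneg _) (Finset.mem_univ e)
      · exact norm_bp_sub_le hP y y' w w' e.succ (Fin.succ_ne_zero e)
    refine (norm_adjoint_sub_le _ _ _ _).trans ?_
    calc _ ≤ K.c₀ * (S + K.c₂ E * X) + K.c₀ * X * K.c₁ E := by gcongr
      _ ≤ K.c₀ * ((K.c₂ E + K.c₁ E) * (S + X)) := by
        rw [mul_assoc, ← mul_add]
        refine mul_le_mul_of_nonneg_left ?_ (by linarith)
        nlinarith
      _ = _ := by ring
  refine (norm_params_le_sum _).trans ((Finset.sum_le_sum fun e _ => key e).trans ?_)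
  rw [Finset.sum_const, Finset.card_univ, Fintype.card_fin, nsmul_eq_mul, add_assoc, ← hX,
    ← mul_assoc]
  refine mul_le_mul_of_nonneg_right ?_ (by positivity)
  unfold Constants.c₃
  linarith

lemma norm_act_sub_le (hP : Smoothness K P) (x : Vec (P.d 0)) (w w' : P.Params) (i : Fin (E + 1))
    (hi : i ≠ Fin.last E) : ‖P.act x w i - P.act x w' i‖ ≤ K.c₁ E * ‖w - w'‖ := by
  refine forward_chain_le (a := fun i => ‖P.act x w i - P.act x w' i‖) K.one_le_c₀
    (norm_nonneg _) (by simp) (fun e he => ?_) i hi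
  rw [act_succ, act_succ]
  refine (hP.a_lip e he _ _ _ _).trans ?_
  refine mul_le_mul K.le_c₀.2.2.2.1 ?_ (by positivity) (by linarith [K.one_le_c₀])
  gcongr
  exact norm_params_le (w - w') e

lemma norm_lossGrad_sub_le (hP : Smoothness K P) (x : Vec (P.d 0)) (w w' : P.Params) :
    ‖P.lossGrad x w - P.lossGrad x w'‖ ≤ K.c₄ E * ‖w - w'‖ := by
  refine (norm_gradAt_sub_le hP _ _ _ _ _ (by simp)).trans ?_
  have h1 := K.one_le_c₁ E
  have h3 := K.one_le_c₃ E
  have : P.layerDist (P.act x w) (P.act x w') ≤ E * K.c₁ E * ‖w - w'‖ := by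
    refine (Finset.sum_le_sum fun e _ => norm_act_sub_le hP x w w' e.castSucc
      (Fin.castSucc_lt_last e).ne).trans ?_
    rw [Finset.sum_const, nsmul_eq_mul, mul_assoc]
    gcongr
    exact (Finset.card_le_univ _).trans_eq (Fintype.card_fin E)
  simp only [sub_self, norm_zero, Finset.sum_const_zero, zero_add]
  rw [Constants.c₄, mul_assoc, add_mul, one_mul]
  gcongr

lemma norm_lossGrad_le (hP : Smoothness K P) (x : Vec (P.d 0)) (w : P.Params) :
    ‖P.lossGrad x w‖ ≤ K.c₃ E := by
  have h0 := K.one_le_c₀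
  have h1 := K.one_le_c₁ E
  have h2 := K.one_le_c₂ E
  have key : ∀ e : Fin E, ‖P.lossGrad x w e‖ ≤ K.c₀ * K.c₁ E := fun e =>
    (norm_adjoint_apply_le _ _).trans (mul_le_mul ((hP.jac₂_bound e _ _).trans K.le_c₀.2.2.1)
      (norm_bp_le hP _ _ _ (Fin.succ_ne_zero e)) (norm_nonneg _) (by linarith))
  refine (norm_params_le_sum _).trans ((Finset.sum_le_sum fun e _ => key e).trans ?_)
  rw [Finset.sum_const, Finset.card_univ, Fintype.card_fin, nsmul_eq_mul]
  have : 0 ≤ (E : ℝ) * (K.c₀ * K.c₂ E) := by positivity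
  unfold Constants.c₃
  linarith

end Bounds

/-! ### The chain rule, and smoothness of the objective -/

section Gradient

variable {K : Constants}

/-- `jac₁` and `jac₂` are the restrictions of the joint derivative to the two factors, so joint
differentiability yields the chain rule without continuity of the Jacobians. -/
lemma hasFDerivAt_act_succ (hP : Smoothness K P) (x : Vec (P.d 0)) (w : P.Params) (e : Fin E)
    {A : P.Params →L[ℝ] Vec (P.d e.castSucc)}
    (hA : HasFDerivAt (fun w => P.act x w e.castSucc) A w) :
    HasFDerivAt (fun w => P.act x w e.succ)
      ((P.jac₁ e (P.act x w e.castSucc) (w e)).comp A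
        + (P.jac₂ e (P.act x w e.castSucc) (w e)).comp (PiLp.proj 2 (fun e => Vec (P.dw e)) e)) w := by
  set y := P.act x w e.castSucc with hy
  set F := fderiv ℝ (fun q : Vec (P.d e.castSucc) × Vec (P.dw e) => P.a e q.1 q.2) (y, w e)
  have hF : HasFDerivAt (fun q : Vec (P.d e.castSucc) × Vec (P.dw e) => P.a e q.1 q.2) F (y, w e) :=
    (hP.a_diff e _).hasFDerivAt
  have h1 : P.jac₁ e y (w e) = F.comp (ContinuousLinearMap.inl ℝ _ _) :=
    (hF.comp (f := fun y' => (y', w e)) y (hasFDerivAt_prodMk_left y (w e))).fderiv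
  have h2 : P.jac₂ e y (w e) = F.comp (ContinuousLinearMap.inr ℝ _ _) :=
    (hF.comp (f := fun w' => (y, w')) (w e) (hasFDerivAt_prodMk_right y (w e))).fderiv
  have h3 : HasFDerivAt (fun w : P.Params => w e) (PiLp.proj 2 (fun e => Vec (P.dw e)) e) w :=
    (PiLp.proj (𝕜 := ℝ) 2 (fun e => Vec (P.dw e)) e).hasFDerivAt
  have h4 := hF.comp (f := fun w => (P.act x w e.castSucc, w e)) w (hA.prodMk h3)
  simp only [act_succ]
  refine h4.congr_fderiv ?_
  rw [h1, h2]
  ext1 h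
  simp [← map_add]

-- The invariant behind reverse-mode differentiation: pairing the derivative of an activation with
-- the backpropagated vector at the same position collects the gradient blocks of all earlier
-- workers. Moving the adjoints across the inner product adds one block per step; at the last
-- position all blocks are present.
open scoped InnerProductSpace in
lemma exists_hasFDerivAt_act (hP : Smoothness K P) (x : Vec (P.d 0)) (w : P.Params)
    (i : Fin (E + 1)) : ∃ A : P.Params →L[ℝ] Vec (P.d i),
      HasFDerivAt (fun w => P.act x w i) A w ∧ ∀ h, ⟪P.bp (P.act x w) w i, A h⟫_ℝ
        = ∑ e : Fin E, if e.castSucc < i then ⟪P.lossGrad x w e, h e⟫_ℝ else 0 := by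
  induction i using Fin.induction with
  | zero => exact ⟨0, hasFDerivAt_const x w, fun h => by simp⟩
  | succ e ih =>
    obtain ⟨A, hA, hh⟩ := ih
    refine ⟨_, hasFDerivAt_act_succ hP x w e hA, fun h => ?_⟩
    have hg : P.lossGrad x w e = ContinuousLinearMap.adjoint
        (P.jac₂ e (P.act x w e.castSucc) (w e)) (P.bp (P.act x w) w e.succ) := rfl
    have hsum : (∑ e' : Fin E, if e'.castSucc < e.succ then ⟪P.lossGrad x w e', h e'⟫_ℝ else 0)
        = (∑ e' : Fin E, if e'.castSucc < e.castSucc then ⟪P.lossGrad x w e', h e'⟫_ℝ else 0)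
          + ⟪P.lossGrad x w e, h e⟫_ℝ := by
      have h1 : ∀ e' : Fin E, (if e'.castSucc < e.succ then ⟪P.lossGrad x w e', h e'⟫_ℝ else 0)
          = (if e'.castSucc < e.castSucc then ⟪P.lossGrad x w e', h e'⟫_ℝ else 0)
            + if e' = e then ⟪P.lossGrad x w e', h e'⟫_ℝ else 0 := by
        intro e'
        simp only [Fin.castSucc_lt_succ_iff, Fin.castSucc_lt_castSucc_iff]
        rcases lt_trichotomy e' e with h | h | h
        · simp [h, h.le, h.ne]
        · simp [h]
        · simp [h.not_ge, h.not_gt, h.ne']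
      simp_rw [h1]
      rw [Finset.sum_add_distrib, Finset.sum_ite_eq' Finset.univ e]
      simp
    rw [hsum, ← hh, bp_castSucc, hg, ContinuousLinearMap.adjoint_inner_left,
      ContinuousLinearMap.adjoint_inner_left, ← inner_add_right]
    rfl

open scoped InnerProductSpace in
lemma hasGradientAt_loss (hP : Smoothness K P) (x : Vec (P.d 0)) (w : P.Params) :
    HasGradientAt (P.loss x) (P.lossGrad x w) w := by
  obtain ⟨A, hA, hh⟩ := exists_hasFDerivAt_act hP x w (Fin.last E)
  rw [hasGradientAt_iff_hasFDerivAt]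
  have h1 : P.loss x = fun w => innerSL ℝ (WithLp.toLp 2 fun _ => 1 : Vec (P.d (Fin.last E)))
      (P.act x w (Fin.last E)) := by
    funext w
    simp [loss, PiLp.inner_apply]
  rw [h1]
  refine ((innerSL ℝ (WithLp.toLp 2 fun _ => 1 : Vec (P.d (Fin.last E)))).hasFDerivAt.comp w
    hA).congr_fderiv ?_
  ext1 h
  have h2 := hh h
  rw [bp_last] at h2
  simp only [InnerProductSpace.toDual_apply_apply, ContinuousLinearMap.comp_apply,
    innerSL_apply_apply, h2, Fin.castSucc_lt_last, if_true, PiLp.inner_apply]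

lemma gradient_loss (hP : Smoothness K P) (x : Vec (P.d 0)) (w : P.Params) :
    ∇ (P.loss x) w = P.lossGrad x w := (hasGradientAt_loss hP x w).gradient

lemma norm_gradient_risk_le (hP : Smoothness K P) {σ : ℝ} (hU : UnbiasedGradient σ P)
    (w : P.Params) : ‖∇ P.risk w‖ ≤ K.c₃ E := by
  rw [← hU.unbiased w]
  have := norm_integral_le_of_norm_le_const (μ := P.D) (f := fun x => ∇ (P.loss x) w)
    (C := K.c₃ E) (Filter.Eventually.of_forall fun x => by
      rw [gradient_loss hP]; exact norm_lossGrad_le hP x w)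
  simpa using this

/-- A smooth function deviates quadratically from its first-order expansion. -/
lemma risk_descent (hP : Smoothness K P) (w w' : P.Params) :
    P.risk w' ≤ P.risk w + inner ℝ (∇ P.risk w) (w' - w) + K.Lℓ * ‖w' - w‖ ^ 2 := by
  -- The mean value inequality on the ball of radius ‖w' − w‖ gives the constant Lℓ instead of Lℓ/2,
  -- which suffices here.
  have h1 := (convex_closedBall w ‖w' - w‖).norm_image_sub_le_of_norm_hasFDerivWithin_le'
    (f := P.risk) (f' := fun v => fderiv ℝ P.risk v) (φ := fderiv ℝ P.risk w)
    (C := K.Lℓ * ‖w' - w‖) (x := w) (y := w')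
    (fun v _ => (hP.risk_diff v).hasFDerivAt.hasFDerivWithinAt) (fun v hv => ?_)
    (by simp) (by simp [dist_eq_norm])
  · have h2 : fderiv ℝ P.risk w (w' - w) = inner ℝ (∇ P.risk w) (w' - w) :=
      inner_gradient_left.symm
    rw [h2] at h1
    have := (abs_le.1 h1).2
    nlinarith
  · have h3 : ‖fderiv ℝ P.risk v - fderiv ℝ P.risk w‖ = ‖∇ P.risk v - ∇ P.risk w‖ := by
      rw [← toDual_gradient, ← toDual_gradient, ← map_sub]
      exact LinearIsometryEquiv.norm_map _ _
    rw [h3]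
    refine (hP.risk_grad_lip v w).trans ?_
    have : ‖v - w‖ ≤ ‖w' - w‖ := by simpa [dist_eq_norm] using hv
    exact mul_le_mul_of_nonneg_left this K.Lℓ_nonneg

end Gradient

end Pipeline

/-! ### Redrawing one independent component preserves the law -/

section Resampling

variable {α β γ : Type*} [MeasurableSpace α] [MeasurableSpace β] [MeasurableSpace γ]

/-- These maps replace conditional expectations: an integral is unchanged when one component is
redrawn, and the inner integral over the new value is the expectation given everything else. -/
lemma measurePreserving_replace_fst (μ : Measure α) (ν : Measure β) [IsProbabilityMeasure μ]
    [IsProbabilityMeasure ν] :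
    MeasurePreserving (fun q : (α × β) × α => (q.2, q.1.2)) ((μ.prod ν).prod μ) (μ.prod ν) := by
  have hm : Measurable (fun q : (α × β) × α => (q.2, q.1.2)) := by fun_prop
  refine ⟨hm, (Measure.prod_eq fun s t hs ht => ?_).symm⟩
  rw [Measure.map_apply hm (hs.prod ht)]
  have : (fun q : (α × β) × α => (q.2, q.1.2)) ⁻¹' s ×ˢ t = (Set.univ ×ˢ t) ×ˢ s := by
    ext q; simp [and_comm]
  rw [this, Measure.prod_prod, Measure.prod_prod, measure_univ, one_mul, mul_comm]

lemma measurePreserving_lift_snd (μ : Measure α) {ν : Measure β} {ρ : Measure γ}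
    [IsProbabilityMeasure μ] [IsProbabilityMeasure ν] [IsProbabilityMeasure ρ] {φ : β → γ → β}
    (h : MeasurePreserving (fun q : β × γ => φ q.1 q.2) (ν.prod ρ) ν) :
    MeasurePreserving (fun q : (α × β) × γ => (q.1.1, φ q.1.2 q.2)) ((μ.prod ν).prod ρ)
      (μ.prod ν) :=
  ((MeasurePreserving.id μ).prod h).comp (measurePreserving_prodAssoc μ ν ρ)

lemma measurePreserving_lift_fst {μ : Measure α} (ν : Measure β) {ρ : Measure γ}
    [IsProbabilityMeasure μ] [IsProbabilityMeasure ν] [IsProbabilityMeasure ρ] {φ : α → γ → α}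
    (h : MeasurePreserving (fun q : α × γ => φ q.1 q.2) (μ.prod ρ) μ) :
    MeasurePreserving (fun q : (α × β) × γ => (φ q.1.1 q.2, q.1.2)) ((μ.prod ν).prod ρ)
      (μ.prod ν) := by
  have h1 := measurePreserving_lift_snd ν h
  have h2 := (Measure.measurePreserving_swap (μ := μ) (ν := ν)).prod (MeasurePreserving.id ρ)
  exact (Measure.measurePreserving_swap (μ := ν) (ν := μ)).comp (h1.comp h2)

lemma measurePreserving_update_pi {ι : Type*} [Fintype ι] [DecidableEq ι] (ν : Measure α)
    [IsProbabilityMeasure ν] (i : ι) :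
    MeasurePreserving (fun q : (ι → α) × α => Function.update q.1 i q.2)
      ((Measure.pi fun _ => ν).prod ν) (Measure.pi fun _ => ν) := by
  have hm : Measurable (fun q : (ι → α) × α => Function.update q.1 i q.2) := by
    refine measurable_pi_iff.2 fun j => ?_
    by_cases h : j = i
    · subst h; simpa using measurable_snd
    · simp only [Function.update_of_ne h]; fun_prop
  refine ⟨hm, (Measure.pi_eq fun s hs => ?_).symm⟩
  rw [Measure.map_apply hm (MeasurableSet.univ_pi hs)]
  have : (fun q : (ι → α) × α => Function.update q.1 i q.2) ⁻¹' Set.univ.pi s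
      = (Set.univ.pi (Function.update s i Set.univ)) ×ˢ s i := by
    ext q
    simp only [Set.mem_preimage, Set.mem_pi, Set.mem_univ, true_imp_iff, Set.mem_prod]
    constructor
    · intro h
      refine ⟨fun j => ?_, by simpa using h i⟩
      by_cases hj : j = i
      · subst hj; simp
      · simpa [hj] using h j
    · rintro ⟨h1, h2⟩ j
      by_cases hj : j = i
      · subst hj; simpa using h2
      · simpa [hj] using h1 j
  rw [this, Measure.prod_prod, Measure.pi_pi, ← Finset.prod_erase_mul Finset.univ _
    (Finset.mem_univ i), ← Finset.prod_erase_mul Finset.univ _ (Finset.mem_univ i)]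
  simp only [Function.update_self, measure_univ, mul_one]
  congr 1
  exact Finset.prod_congr rfl fun j hj => by rw [Function.update_of_ne (Finset.ne_of_mem_erase hj)]

lemma measurable_update_pair (n : ℕ) :
    Measurable (fun q : (ℕ → α) × α => Function.update q.1 n q.2) := by
  refine measurable_pi_iff.2 fun j => ?_
  by_cases h : j = n
  · subst h; simpa using measurable_snd
  · simp only [Function.update_of_ne h]; fun_prop

lemma measurePreserving_update_infinitePi (ν : Measure α) [IsProbabilityMeasure ν] (n : ℕ) :
    MeasurePreserving (fun q : (ℕ → α) × α => Function.update q.1 n q.2)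
      ((Measure.infinitePi fun _ : ℕ => ν).prod ν) (Measure.infinitePi fun _ : ℕ => ν) := by
  have hm := measurable_update_pair (α := α) n
  refine ⟨hm, Measure.eq_infinitePi _ fun s t ht => ?_⟩
  rw [Measure.map_apply hm (MeasurableSet.pi s.countable_toSet fun i _ => ht i)]
  have : (fun q : (ℕ → α) × α => Function.update q.1 n q.2) ⁻¹' (s : Set ℕ).pi t
      = ((s.erase n : Finset ℕ) : Set ℕ).pi t ×ˢ (if n ∈ s then t n else Set.univ) := by
    ext q
    simp only [Set.mem_preimage, Set.mem_pi, Finset.mem_coe, Set.mem_prod, Finset.mem_erase]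
    constructor
    · intro h
      refine ⟨fun j hj => by simpa [hj.1] using h j hj.2, ?_⟩
      split_ifs with hn
      · simpa using h n hn
      · trivial
    · rintro ⟨h1, h2⟩ j hj
      by_cases hjn : j = n
      · subst hjn; simpa [hj] using h2
      · simpa [hjn] using h1 j ⟨hjn, hj⟩
  rw [this, Measure.prod_prod, Measure.infinitePi_pi _ (fun i _ => ht i)]
  split_ifs with hn
  · exact Finset.prod_erase_mul s _ hn
  · rw [Finset.erase_eq_of_notMem hn, measure_univ, mul_one]

/-- Redrawing a part of one coordinate of an infinite product preserves the law. -/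
lemma measurePreserving_update_map (ν : Measure α) [IsProbabilityMeasure ν] {ρ : Measure β}
    [IsProbabilityMeasure ρ] (n : ℕ) {φ : α → β → α}
    (h : MeasurePreserving (fun q : α × β => φ q.1 q.2) (ν.prod ρ) ν) :
    MeasurePreserving (fun q : (ℕ → α) × β => Function.update q.1 n (φ (q.1 n) q.2))
      ((Measure.infinitePi fun _ : ℕ => ν).prod ρ) (Measure.infinitePi fun _ : ℕ => ν) := by
  set μ := Measure.infinitePi fun _ : ℕ => ν with hμ
  have hu := measurePreserving_update_infinitePi ν n
  rw [← hμ] at hu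
  have hm : Measurable (fun q : (ℕ → α) × β => Function.update q.1 n (φ (q.1 n) q.2)) :=
    (measurable_update_pair n).comp (measurable_fst.prodMk
      (h.measurable.comp (((measurable_pi_apply n).comp measurable_fst).prodMk measurable_snd)))
  refine ⟨hm, Measure.ext_of_lintegral _ fun f hf => ?_⟩
  have hg : Measurable fun q : (ℕ → α) × β => f (Function.update q.1 n (φ (q.1 n) q.2)) :=
    hf.comp hm
  have hg' : Measurable fun z : ℕ → α => ∫⁻ s, f (Function.update z n (φ (z n) s)) ∂ρ :=
    hg.lintegral_prod_right'
  -- The whole coordinate n is redrawn first on both sides. The value read by φ is then independent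
  -- of the other coordinates, and the hypothesis on one coordinate applies for each fixed z.
  rw [lintegral_map hf hm, lintegral_prod _ hg.aemeasurable, ← hu.lintegral_comp hg',
    ← hu.lintegral_comp hf]
  have h1 : Measurable fun q : (ℕ → α) × α =>
      ∫⁻ s, f (Function.update (Function.update q.1 n q.2) n
        (φ (Function.update q.1 n q.2 n) s)) ∂ρ := hg'.comp hu.measurable
  have h2 : Measurable fun q : (ℕ → α) × α => f (Function.update q.1 n q.2) :=
    hf.comp hu.measurable
  rw [lintegral_prod _ h1.aemeasurable, lintegral_prod _ h2.aemeasurable]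
  refine lintegral_congr fun z => ?_
  have hz : Measurable fun r => f (Function.update z n r) :=
    hf.comp (hu.measurable.comp measurable_prodMk_left)
  have hz' : Measurable fun q : α × β => f (Function.update z n (φ q.1 q.2)) :=
    hz.comp h.measurable
  rw [← h.lintegral_comp hz, lintegral_prod _ hz'.aemeasurable]
  simp

end Resampling

/-! ### Redrawing the sample, the coin or one seed of a round -/

section RoundResampling

variable (P : Pipeline E) (CF CB : Compressor.{u} P.d)

/-- A change of one round preserves the law of the run if it preserves the law of the round. -/
lemma measurePreserving_law {β : Type*} [MeasurableSpace β] {ρ : Measure β}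
    [IsProbabilityMeasure ρ] (n : ℕ) {φ : Round P CF CB → β → Round P CF CB}
    (h : MeasurePreserving (fun q : Round P CF CB × β => φ q.1 q.2)
      ((roundLaw P CF CB).prod ρ) (roundLaw P CF CB)) :
    MeasurePreserving (fun q : (ℕ → Round P CF CB) × β =>
      Function.update q.1 n (φ (q.1 n) q.2)) ((law P CF CB).prod ρ) (law P CF CB) :=
  measurePreserving_update_map _ n h

instance : IsProbabilityMeasure (law P CF CB) := by
  unfold law; infer_instance

/-- Replace the sample. -/
def setSample (r : Round P CF CB) (x : Vec (P.d 0)) : Round P CF CB := (x, r.2)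

/-- Replace the coin. -/
def setCoin (r : Round P CF CB) (c : unitInterval) : Round P CF CB := (r.1, c, r.2.2)

/-- Replace one seed of the forward pass. -/
def setSeedF (i : Fin (E + 1)) (r : Round P CF CB) (s : CF.S) : Round P CF CB :=
  (r.1, r.2.1, Function.update r.2.2.1 i s, r.2.2.2)

/-- Replace one seed of the backward pass. -/
def setSeedB (i : Fin (E + 1)) (r : Round P CF CB) (s : CB.S) : Round P CF CB :=
  (r.1, r.2.1, r.2.2.1, Function.update r.2.2.2 i s)

lemma measurePreserving_setSample :
    MeasurePreserving (fun q : Round P CF CB × Vec (P.d 0) => setSample P CF CB q.1 q.2)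
      ((roundLaw P CF CB).prod P.D) (roundLaw P CF CB) :=
  measurePreserving_replace_fst _ _

lemma measurePreserving_setCoin :
    MeasurePreserving (fun q : Round P CF CB × unitInterval => setCoin P CF CB q.1 q.2)
      ((roundLaw P CF CB).prod volume) (roundLaw P CF CB) :=
  measurePreserving_lift_snd _ (φ := fun b c => (c, b.2)) (measurePreserving_replace_fst _ _)

lemma measurePreserving_setSeedF (i : Fin (E + 1)) :
    MeasurePreserving (fun q : Round P CF CB × CF.S => setSeedF P CF CB i q.1 q.2)
      ((roundLaw P CF CB).prod CF.ν) (roundLaw P CF CB) :=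
  measurePreserving_lift_snd _ (φ := fun b s => (b.1, Function.update b.2.1 i s, b.2.2))
    (measurePreserving_lift_snd _ (φ := fun b s => (Function.update b.1 i s, b.2))
      (measurePreserving_lift_fst _ (φ := fun b s => Function.update b i s)
        (measurePreserving_update_pi CF.ν i)))

lemma measurePreserving_setSeedB (i : Fin (E + 1)) :
    MeasurePreserving (fun q : Round P CF CB × CB.S => setSeedB P CF CB i q.1 q.2)
      ((roundLaw P CF CB).prod CB.ν) (roundLaw P CF CB) :=
  measurePreserving_lift_snd _ (φ := fun b s => (b.1, b.2.1, Function.update b.2.2 i s))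
    (measurePreserving_lift_snd _ (φ := fun b s => (b.1, Function.update b.2 i s))
      (measurePreserving_lift_snd _ (φ := fun b s => Function.update b i s)
        (measurePreserving_update_pi CB.ν i)))

end RoundResampling

/-! ### Measurability of the states -/

section Measurability

variable {P : Pipeline E} {Ω : Type*} [MeasurableSpace Ω]

lemma measurable_params {f : Ω → P.Params} (h : ∀ e, Measurable fun z => f z e) : Measurable f :=
  (WithLp.measurable_toLp 2 _).comp (measurable_pi_iff.2 h)

lemma measurable_vec {n : ℕ} {f : Ω → Vec n} (h : ∀ j, Measurable fun z => f z j) : Measurable f :=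
  (WithLp.measurable_toLp 2 _).comp (measurable_pi_iff.2 h)

lemma Measurable.params_apply {f : Ω → P.Params} (h : Measurable f) (e : Fin E) :
    Measurable fun z => f z e :=
  (measurable_pi_apply e).comp ((WithLp.measurable_ofLp 2 _).comp h)

lemma Measurable.vec_apply {n : ℕ} {f : Ω → Vec n} (h : Measurable f) (j : Fin n) :
    Measurable fun z => f z j :=
  (measurable_pi_apply j).comp ((WithLp.measurable_ofLp 2 _).comp h)

variable {K : Constants}

lemma measurable_a (hP : Smoothness K P) (e : Fin E) {y : Ω → Vec (P.d e.castSucc)}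
    {w : Ω → Vec (P.dw e)} (hy : Measurable y) (hw : Measurable w) :
    Measurable fun z => P.a e (y z) (w z) :=
  (hP.a_diff e).continuous.measurable.comp (hy.prodMk hw)

/-- The Jacobians need not be jointly continuous at the first worker; measurability comes from that
of the derivative of a continuous function with a parameter. -/
lemma measurable_adjoint_jac₁ (hP : Smoothness K P) (e : Fin E) {y : Ω → Vec (P.d e.castSucc)}
    {w : Ω → Vec (P.dw e)} {v : Ω → Vec (P.d e.succ)} (hy : Measurable y) (hw : Measurable w)
    (hv : Measurable v) :
    Measurable fun z => ContinuousLinearMap.adjoint (P.jac₁ e (y z) (w z)) (v z) := by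
  have h1 : Continuous (Function.uncurry fun (w : Vec (P.dw e)) (y : Vec (P.d e.castSucc)) =>
      P.a e y w) := (hP.a_diff e).continuous.comp continuous_swap
  have h2 := (measurable_fderiv_with_param ℝ h1).comp (hw.prodMk hy)
  exact ContinuousLinearMap.measurable_apply₂.comp
    (((ContinuousLinearMap.adjoint).continuous.measurable.comp h2).prodMk hv)

lemma measurable_adjoint_jac₂ (hP : Smoothness K P) (e : Fin E) {y : Ω → Vec (P.d e.castSucc)}
    {w : Ω → Vec (P.dw e)} {v : Ω → Vec (P.d e.succ)} (hy : Measurable y) (hw : Measurable w)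
    (hv : Measurable v) :
    Measurable fun z => ContinuousLinearMap.adjoint (P.jac₂ e (y z) (w z)) (v z) := by
  have h1 : Continuous (Function.uncurry (P.a e)) := (hP.a_diff e).continuous
  have h2 := (measurable_fderiv_with_param ℝ h1).comp (hy.prodMk hw)
  exact ContinuousLinearMap.measurable_apply₂.comp
    (((ContinuousLinearMap.adjoint).continuous.measurable.comp h2).prodMk hv)

lemma measurable_act (hP : Smoothness K P) {x : Ω → Vec (P.d 0)} {w : Ω → P.Params}
    (hx : Measurable x) (hw : Measurable w) (i : Fin (E + 1)) :
    Measurable fun z => P.act (x z) (w z) i := by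
  induction i using Fin.induction with
  | zero => exact hx
  | succ e ih =>
    simp only [Pipeline.act_succ]
    exact measurable_a hP e ih (Measurable.params_apply hw e)

lemma measurable_bp (hP : Smoothness K P) {y : Ω → P.Layers} {w : Ω → P.Params}
    (hy : ∀ i, Measurable fun z => y z i) (hw : Measurable w) (i : Fin (E + 1)) :
    Measurable fun z => P.bp (y z) (w z) i := by
  induction i using Fin.reverseInduction with
  | last => simp only [Pipeline.bp_last]; exact measurable_const
  | cast e ih =>
    simp only [Pipeline.bp_castSucc]
    exact measurable_adjoint_jac₁ hP e (hy _) (Measurable.params_apply hw e) ih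

lemma measurable_gradAt (hP : Smoothness K P) {y v : Ω → P.Layers} {w : Ω → P.Params}
    (hy : ∀ i, Measurable fun z => y z i) (hv : ∀ e : Fin E, Measurable fun z => v z e.succ)
    (hw : Measurable w) : Measurable fun z => P.gradAt (y z) (v z) (w z) :=
  measurable_params fun e =>
    measurable_adjoint_jac₂ hP e (hy _) (Measurable.params_apply hw e) (hv e)

lemma measurable_lossGrad (hP : Smoothness K P) {x : Ω → Vec (P.d 0)} {w : Ω → P.Params}
    (hx : Measurable x) (hw : Measurable w) : Measurable fun z => P.lossGrad (x z) (w z) :=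
  measurable_gradAt hP (measurable_act hP hx hw)
    (fun e => measurable_bp hP (measurable_act hP hx hw) hw e.succ) hw

variable (CF CB : Compressor.{u} P.d)

open Classical in
lemma forward_succ (exact : Prop) (seed : Fin (E + 1) → CF.S) (yold : P.Layers)
    (x : Vec (P.d 0)) (w : P.Params) (e : Fin E) :
    forward CF exact seed yold x w e.succ
      = if exact then P.a e (forward CF exact seed yold x w e.castSucc) (w e)
        else yold e.succ + CF.map e.succ (seed e.succ)
          (P.a e (forward CF exact seed yold x w e.castSucc) (w e) - yold e.succ) := by
  simp [forward]

@[simp] lemma backward_last (exact : Prop) (seed : Fin (E + 1) → CB.S) (vold y : P.Layers)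
    (w : P.Params) : backward CB exact seed vold y w (Fin.last E) = WithLp.toLp 2 fun _ => 1 := by
  simp [backward]

open Classical in
lemma backward_castSucc (exact : Prop) (seed : Fin (E + 1) → CB.S) (vold y : P.Layers)
    (w : P.Params) (e : Fin E) :
    backward CB exact seed vold y w e.castSucc
      = if exact then ContinuousLinearMap.adjoint (P.jac₁ e (y e.castSucc) (w e))
          (backward CB exact seed vold y w e.succ)
        else vold e.castSucc + CB.map e.castSucc (seed e.castSucc)
          (ContinuousLinearMap.adjoint (P.jac₁ e (y e.castSucc) (w e))
            (backward CB exact seed vold y w e.succ) - vold e.castSucc) := by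
  simp [backward]

lemma measurable_forward (hP : Smoothness K P) {ex : Ω → Prop} (hex : MeasurableSet {z | ex z})
    {seed : Ω → Fin (E + 1) → CF.S} (hs : Measurable seed) {yold : Ω → P.Layers}
    (hy : ∀ i, Measurable fun z => yold z i) {x : Ω → Vec (P.d 0)} (hx : Measurable x)
    {w : Ω → P.Params} (hw : Measurable w) (i : Fin (E + 1)) :
    Measurable fun z => forward CF (ex z) (seed z) (yold z) (x z) (w z) i := by
  classical
  induction i using Fin.induction with
  | zero => exact hx
  | succ e ih =>
    simp only [forward_succ]
    have ha := measurable_a hP e ih (Measurable.params_apply hw e)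
    exact Measurable.ite hex ha ((hy _).add ((CF.measurable_map e.succ).comp
      (((measurable_pi_apply _).comp hs).prodMk (ha.sub (hy _)))))

lemma measurable_backward (hP : Smoothness K P) {ex : Ω → Prop} (hex : MeasurableSet {z | ex z})
    {seed : Ω → Fin (E + 1) → CB.S} (hs : Measurable seed) {vold y : Ω → P.Layers}
    (hv : ∀ i, Measurable fun z => vold z i) (hy : ∀ i, Measurable fun z => y z i)
    {w : Ω → P.Params} (hw : Measurable w) (i : Fin (E + 1)) :
    Measurable fun z => backward CB (ex z) (seed z) (vold z) (y z) (w z) i := by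
  classical
  induction i using Fin.reverseInduction with
  | last => simp only [backward_last]; exact measurable_const
  | cast e ih =>
    simp only [backward_castSucc]
    have ha := measurable_adjoint_jac₁ hP e (hy _) (Measurable.params_apply hw e) ih
    exact Measurable.ite hex ha ((hv _).add ((CB.measurable_map e.castSucc).comp
      (((measurable_pi_apply _).comp hs).prodMk (ha.sub (hv _)))))

lemma measurableSet_fresh (p : ℝ) (n : ℕ) {c : Ω → unitInterval} (hc : Measurable c) :
    MeasurableSet {z | Fresh p n (c z)} := by
  have : MeasurableSet {c : unitInterval | Fresh p n c} :=
    (MeasurableSet.const _).union (measurableSet_le measurable_subtype_coe measurable_const)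
  exact hc this

/-- All components of a random state are measurable. -/
structure MeasurableState (st : Ω → State P) : Prop where
  x : Measurable fun z => (st z).x
  y : ∀ i, Measurable fun z => (st z).y i
  v : ∀ i, Measurable fun z => (st z).v i
  g : Measurable fun z => (st z).g
  m : Measurable fun z => (st z).m
  s : Measurable fun z => (st z).s
  w : Measurable fun z => (st z).w

lemma measurableState_run (hP : Smoothness K P) (vr : Variant) (h : Hyper) (w₁ : P.Params)
    (n : ℕ) : MeasurableState (fun z => run P CF CB vr h w₁ n z) := by
  classical
  induction n with
  | zero =>
    constructor <;> first | exact measurable_const | exact fun _ => measurable_const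
  | succ n ih =>
    have hz : Measurable fun z : ℕ → Round P CF CB => z n := measurable_pi_apply n
    have hfr : MeasurableSet {z : ℕ → Round P CF CB | Fresh h.p n (z n).2.1} :=
      measurableSet_fresh _ _ hz.snd.fst
    have hex : MeasurableSet {z : ℕ → Round P CF CB | vr = Variant.FU ∧ Fresh h.p n (z n).2.1} :=
      (MeasurableSet.const _).inter hfr
    have hx : Measurable fun z => (run P CF CB vr h w₁ (n + 1) z).x :=
      Measurable.ite hfr hz.fst ih.x
    have hy : ∀ i, Measurable fun z => (run P CF CB vr h w₁ (n + 1) z).y i :=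
      measurable_forward CF hP hex hz.snd.snd.fst ih.y hx ih.w
    have hv : ∀ i, Measurable fun z => (run P CF CB vr h w₁ (n + 1) z).v i :=
      measurable_backward CB hP hex hz.snd.snd.snd ih.v hy ih.w
    have hg : Measurable fun z => (run P CF CB vr h w₁ (n + 1) z).g :=
      measurable_gradAt hP hy (fun e => hv e.succ) ih.w
    have hm : Measurable fun z => (run P CF CB vr h w₁ (n + 1) z).m :=
      (ih.m.const_smul (1 - h.β₁)).add (hg.const_smul h.β₁)
    have hs : Measurable fun z => (run P CF CB vr h w₁ (n + 1) z).s := by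
      refine measurable_params fun e => measurable_vec fun j => ?_
      exact ((Measurable.vec_apply (Measurable.params_apply ih.s e) j).const_mul _).add
        (((Measurable.vec_apply (Measurable.params_apply hg e) j).pow_const 2).const_mul _)
    refine ⟨hx, hy, hv, hg, hm, hs, ?_⟩
    refine measurable_params fun e => measurable_vec fun j => ?_
    exact (Measurable.vec_apply (Measurable.params_apply ih.w e) j).sub
      (((Measurable.vec_apply (Measurable.params_apply hm e) j).div
        ((Measurable.vec_apply (Measurable.params_apply hs e) j).add_const _).sqrt).const_mul _)

end Measurability

/-! ### Which randomness a quantity depends on -/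

section Dependence

variable (P : Pipeline E) (CF CB : Compressor.{u} P.d)

/-- The state after `n` iterations depends on the first `n` rounds only. -/
lemma run_update (vr : Variant) (h : Hyper) (w₁ : P.Params) {k n : ℕ} (hkn : k ≤ n)
    (z : ℕ → Round P CF CB) (r : Round P CF CB) :
    run P CF CB vr h w₁ k (Function.update z n r) = run P CF CB vr h w₁ k z := by
  induction k with
  | zero => rfl
  | succ k ih =>
    simp only [run]
    rw [ih (by omega), Function.update_of_ne (by omega)]

variable {P}

/-- Positions before j are computed before seed j is used, so the vector compressed at j is
independent of that seed. -/
lemma forward_update (exact : Prop) (seed : Fin (E + 1) → CF.S) (yold : P.Layers)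
    (x : Vec (P.d 0)) (w : P.Params) (s : CF.S) {i j : Fin (E + 1)} (hij : i < j) :
    forward CF exact (Function.update seed j s) yold x w i = forward CF exact seed yold x w i := by
  induction i using Fin.induction with
  | zero => rfl
  | succ e ih =>
    rw [forward_succ, forward_succ, ih (lt_trans (Fin.castSucc_lt_succ) hij),
      Function.update_of_ne hij.ne]

lemma backward_update (exact : Prop) (seed : Fin (E + 1) → CB.S) (vold y : P.Layers)
    (w : P.Params) (s : CB.S) {i j : Fin (E + 1)} (hij : j < i) :
    backward CB exact (Function.update seed j s) vold y w i = backward CB exact seed vold y w i := by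
  induction i using Fin.reverseInduction with
  | last => rw [backward_last, backward_last]
  | cast e ih =>
    rw [backward_castSucc, backward_castSucc, ih (lt_trans hij Fin.castSucc_lt_succ),
      Function.update_of_ne hij.ne']

end Dependence

/-! ### Second moments and Minkowski inequalities -/

section L2

variable {Ω : Type*} [MeasurableSpace Ω] {μ : Measure Ω} {V V' V'' : Type*}
  [NormedAddCommGroup V] [NormedAddCommGroup V'] [NormedAddCommGroup V'']

lemma eLpNorm_two_sq (f : Ω → V) : eLpNorm f 2 μ ^ 2 = ∫⁻ z, ‖f z‖ₑ ^ 2 ∂μ := by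
  have := eLpNorm_nnreal_pow_eq_lintegral (μ := μ) (f := f) (p := 2) two_ne_zero
  simpa using this

lemma eLpNorm_two_le {f : Ω → V} {g : Ω → V'} {c : ℝ}
    (h : ∫⁻ z, ‖f z‖ₑ ^ 2 ∂μ ≤ ENNReal.ofReal c ^ 2 * ∫⁻ z, ‖g z‖ₑ ^ 2 ∂μ) :
    eLpNorm f 2 μ ≤ ENNReal.ofReal c * eLpNorm g 2 μ := by
  rw [← eLpNorm_two_sq, ← eLpNorm_two_sq, ← mul_pow] at h
  exact (ENNReal.pow_le_pow_left_iff two_ne_zero).1 h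

lemma eLpNorm_two_le_const [IsProbabilityMeasure μ] {f : Ω → V} {c : ℝ}
    (h : ∫⁻ z, ‖f z‖ₑ ^ 2 ∂μ ≤ ENNReal.ofReal c ^ 2) : eLpNorm f 2 μ ≤ ENNReal.ofReal c := by
  rw [← eLpNorm_two_sq] at h
  exact (ENNReal.pow_le_pow_left_iff two_ne_zero).1 h

lemma ofReal_norm_sq (v : V) : ENNReal.ofReal (‖v‖ ^ 2) = ‖v‖ₑ ^ 2 := by
  rw [ENNReal.ofReal_pow (norm_nonneg _), ofReal_norm]

lemma eLpNorm_const_mul_norm {c : ℝ} (hc : 0 ≤ c) (g : Ω → V) :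
    eLpNorm (fun z => c * ‖g z‖) 2 μ = ENNReal.ofReal c * eLpNorm g 2 μ := by
  have := eLpNorm_const_smul (μ := μ) (p := 2) c (fun z => ‖g z‖)
  rw [eLpNorm_norm] at this
  rw [← Real.enorm_of_nonneg hc, ← this]
  rfl

lemma eLpNorm_le_add {f : Ω → V} {g : Ω → V'} {g' : Ω → V''} (hg : AEStronglyMeasurable g μ)
    (hg' : AEStronglyMeasurable g' μ) {c c' : ℝ} (hc : 0 ≤ c) (hc' : 0 ≤ c')
    (h : ∀ z, ‖f z‖ ≤ c * ‖g z‖ + c' * ‖g' z‖) :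
    eLpNorm f 2 μ ≤ ENNReal.ofReal c * eLpNorm g 2 μ + ENNReal.ofReal c' * eLpNorm g' 2 μ := by
  rw [← eLpNorm_const_mul_norm hc, ← eLpNorm_const_mul_norm hc']
  exact (eLpNorm_mono_real h).trans (eLpNorm_add_le (hg.norm.const_mul c) (hg'.norm.const_mul c')
    one_le_two)

lemma eLpNorm_le_sum {ι : Type*} (s : Finset ι) {f : Ω → V} {W : ι → Type*}
    [∀ i, NormedAddCommGroup (W i)] {g : (i : ι) → Ω → W i}
    (hg : ∀ i, AEStronglyMeasurable (g i) μ) (h : ∀ z, ‖f z‖ ≤ ∑ i ∈ s, ‖g i z‖) :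
    eLpNorm f 2 μ ≤ ∑ i ∈ s, eLpNorm (g i) 2 μ := by
  refine (eLpNorm_mono_real h).trans ?_
  have := eLpNorm_sum_le (μ := μ) (s := s) (p := 2) (f := fun i z => ‖g i z‖)
    (fun i _ => (hg i).norm) one_le_two
  simp only [eLpNorm_norm] at this
  rwa [Finset.sum_fn] at this

end L2

/-- The tower property in the form used below: the outer variable is the past, the inner one the
redrawn component. -/
lemma lintegral_resample {α β : Type*} [MeasurableSpace α] [MeasurableSpace β] {μ : Measure α}
    {ρ : Measure β} [SFinite μ] [SFinite ρ] {ψ : α × β → α}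
    (h : MeasurePreserving ψ (μ.prod ρ) μ) {f : α → ENNReal} (hf : Measurable f) :
    ∫⁻ z, f z ∂μ = ∫⁻ z, ∫⁻ s, f (ψ (z, s)) ∂ρ ∂μ := by
  rw [← h.lintegral_comp hf]
  exact lintegral_prod _ (hf.comp h.measurable).aemeasurable

/-! ### Runs under the assumptions, and errors of single compressions -/

/-- A run of the algorithm under the assumptions of the theorem, except for the bound of the
gradient estimates. -/
structure Setting (E : ℕ) (K : Constants) where
  P : Pipeline E
  CF : Compressor.{u} P.d
  CB : Compressor.{u} P.d
  vr : Variant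
  h : Hyper
  w₁ : P.Params
  σ : ℝ
  φ : ℝ
  ωF : ℝ
  ωB : ℝ
  smooth : Smoothness K P
  unbiased : UnbiasedGradient σ P
  contrF : CF.Contractive ωF
  contrB : CB.Contractive ωB
  spread : BoundedSpread φ P
  init : InitialPoint K P w₁
  φ_nonneg : 0 ≤ φ
  ωF_mem : ωF ∈ Set.Ico (0 : ℝ) 1
  ωB_mem : ωB ∈ Set.Ico (0 : ℝ) 1
  γ_pos : 0 < h.γ
  β₁_mem : h.β₁ ∈ Set.Ioo (0 : ℝ) 1
  β₂_mem : h.β₂ ∈ Set.Ioo (0 : ℝ) 1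
  p_mem : h.p ∈ Set.Ioc (0 : ℝ) 1
  ε_eq : h.ε = K.ε

namespace Setting

variable {K : Constants} (X : Setting.{u} E K)

/-- Sample space of the run. -/
abbrev Ω : Type u := ℕ → Round X.P X.CF X.CB

/-- Law of the run. -/
abbrev μ : Measure X.Ω := law X.P X.CF X.CB

/-- State after `n` iterations. -/
abbrev st (n : ℕ) (z : X.Ω) : State X.P := run X.P X.CF X.CB X.vr X.h X.w₁ n z

/-- A new sample is drawn in the round `n`. -/
def fresh (n : ℕ) (z : X.Ω) : Prop := Fresh X.h.p n (z n).2.1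

/-- The communication of the round `n` is exact. -/
def exact (n : ℕ) (z : X.Ω) : Prop := X.vr = Variant.FU ∧ X.fresh n z

open Classical in
/-- Restriction to the rounds with compressed communication. -/
def mask {V : Type*} [Zero V] (n : ℕ) (f : X.Ω → V) (z : X.Ω) : V :=
  if X.exact n z then 0 else f z

/-- Activation of the worker `e` in the round `n`, before compression. -/
def preY (n : ℕ) (e : Fin E) (z : X.Ω) : Vec (X.P.d e.succ) :=
  X.P.a e ((X.st (n + 1) z).y e.castSucc) ((X.st n z).w e)

/-- Activation gradient of the worker `e` in the round `n`, before compression. -/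
def preV (n : ℕ) (e : Fin E) (z : X.Ω) : Vec (X.P.d e.castSucc) :=
  ContinuousLinearMap.adjoint (X.P.jac₁ e ((X.st (n + 1) z).y e.castSucc) ((X.st n z).w e))
    ((X.st (n + 1) z).v e.succ)

/-- Exact activations for the sample and the weights of the round `n`. -/
def trueY (n : ℕ) (z : X.Ω) : X.P.Layers := X.P.act (X.st (n + 1) z).x (X.st n z).w

/-- Exact backward pass along the transmitted activations of the round `n`. -/
def trueV (n : ℕ) (z : X.Ω) : X.P.Layers := X.P.bp (X.st (n + 1) z).y (X.st n z).w

lemma meas (n : ℕ) : MeasurableState (X.st n) :=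
  measurableState_run X.CF X.CB X.smooth X.vr X.h X.w₁ n

lemma measurableSet_fresh' (n : ℕ) : MeasurableSet {z | X.fresh n z} :=
  measurableSet_fresh _ _ (measurable_pi_apply n).snd.fst

lemma measurableSet_exact (n : ℕ) : MeasurableSet {z | X.exact n z} :=
  (MeasurableSet.const _).inter (X.measurableSet_fresh' n)

lemma measurable_mask {V : Type*} [Zero V] [MeasurableSpace V] (n : ℕ) {f : X.Ω → V}
    (hf : Measurable f) : Measurable (X.mask n f) := by
  classical
  exact Measurable.ite (X.measurableSet_exact n) measurable_const hf

lemma norm_mask_le {V : Type*} [NormedAddCommGroup V] (n : ℕ) (f : X.Ω → V) (z : X.Ω) :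
    ‖X.mask n f z‖ ≤ ‖f z‖ := by
  unfold mask; split_ifs <;> simp

lemma eLpNorm_mask_le {V : Type*} [NormedAddCommGroup V] (n : ℕ) (f : X.Ω → V) :
    eLpNorm (X.mask n f) 2 X.μ ≤ eLpNorm f 2 X.μ :=
  eLpNorm_mono (X.norm_mask_le n f)

lemma measurable_preY (n : ℕ) (e : Fin E) : Measurable (X.preY n e) :=
  measurable_a X.smooth e ((X.meas (n + 1)).y _) (Measurable.params_apply (X.meas n).w e)

lemma measurable_preV (n : ℕ) (e : Fin E) : Measurable (X.preV n e) :=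
  measurable_adjoint_jac₁ X.smooth e ((X.meas (n + 1)).y _)
    (Measurable.params_apply (X.meas n).w e) ((X.meas (n + 1)).v _)

lemma measurable_trueY (n : ℕ) (i : Fin (E + 1)) : Measurable fun z => X.trueY n z i :=
  measurable_act X.smooth (X.meas (n + 1)).x (X.meas n).w i

lemma measurable_trueV (n : ℕ) (i : Fin (E + 1)) : Measurable fun z => X.trueV n z i :=
  measurable_bp X.smooth (X.meas (n + 1)).y (X.meas n).w i

lemma y_zero (n : ℕ) (z : X.Ω) : (X.st (n + 1) z).y 0 = (X.st (n + 1) z).x := rfl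

open Classical in
lemma x_succ (n : ℕ) (z : X.Ω) :
    (X.st (n + 1) z).x = if X.fresh n z then (z n).1 else (X.st n z).x := rfl

lemma y_eq (n : ℕ) (z : X.Ω) : (X.st (n + 1) z).y = forward X.CF (X.exact n z) (z n).2.2.1
    (X.st n z).y (X.st (n + 1) z).x (X.st n z).w := rfl

lemma v_eq (n : ℕ) (z : X.Ω) : (X.st (n + 1) z).v = backward X.CB (X.exact n z) (z n).2.2.2
    (X.st n z).v (X.st (n + 1) z).y (X.st n z).w := rfl

open Classical in
lemma y_succ (n : ℕ) (z : X.Ω) (e : Fin E) :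
    (X.st (n + 1) z).y e.succ = if X.exact n z then X.preY n e z
      else (X.st n z).y e.succ
        + X.CF.map e.succ ((z n).2.2.1 e.succ) (X.preY n e z - (X.st n z).y e.succ) :=
  forward_succ _ _ _ _ _ _ _

lemma v_last (n : ℕ) (z : X.Ω) : (X.st (n + 1) z).v (Fin.last E) = WithLp.toLp 2 fun _ => 1 :=
  backward_last _ _ _ _ _ _

open Classical in
lemma v_castSucc (n : ℕ) (z : X.Ω) (e : Fin E) :
    (X.st (n + 1) z).v e.castSucc = if X.exact n z then X.preV n e z
      else (X.st n z).v e.castSucc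
        + X.CB.map e.castSucc ((z n).2.2.2 e.castSucc) (X.preV n e z - (X.st n z).v e.castSucc) :=
  backward_castSucc _ _ _ _ _ _ _

/-- Error of the forward compression in the round `n`. -/
lemma eLpNorm_y_sub_preY_le (n : ℕ) (e : Fin E) :
    eLpNorm (fun z => (X.st (n + 1) z).y e.succ - X.preY n e z) 2 X.μ
      ≤ ENNReal.ofReal X.ωF
        * eLpNorm (X.mask n fun z => X.preY n e z - (X.st n z).y e.succ) 2 X.μ := by
  classical
  refine eLpNorm_two_le ?_
  have hmp := measurePreserving_law X.P X.CF X.CB n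
    (measurePreserving_setSeedF X.P X.CF X.CB e.succ)
  have hm : Measurable fun z => ‖(X.st (n + 1) z).y e.succ - X.preY n e z‖ₑ ^ 2 :=
    ((((X.meas (n + 1)).y _).sub (X.measurable_preY n e)).enorm).pow_const 2
  refine (lintegral_resample hmp hm).trans_le ?_
  rw [← lintegral_const_mul]
  swap
  · exact (X.measurable_mask n ((X.measurable_preY n e).sub ((X.meas n).y _))).enorm.pow_const 2
  refine lintegral_mono fun z => ?_
  set D := X.preY n e z - (X.st n z).y e.succ with hD
  -- Redrawing seed e + 1 changes neither the exactness of the round nor the compressed vector D.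
  -- The inner integral is then the contraction inequality at the fixed vector D, and it is zero in
  -- an exact round.
  have key : ∀ s : X.CF.S,
      (fun z => ‖(X.st (n + 1) z).y e.succ - X.preY n e z‖ₑ ^ 2)
        (Function.update z n (setSeedF X.P X.CF X.CB e.succ (z n) s))
      = if X.exact n z then 0 else ‖D - X.CF.map e.succ s D‖ₑ ^ 2 := by
    intro s
    set z' := Function.update z n (setSeedF X.P X.CF X.CB e.succ (z n) s) with hz'
    have h1 : z' n = setSeedF X.P X.CF X.CB e.succ (z n) s := Function.update_self _ _ _
    have h2 : X.st n z' = X.st n z := run_update _ _ _ _ _ _ le_rfl _ _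
    have h3 : X.exact n z' ↔ X.exact n z := by
      simp only [exact, fresh, h1, setSeedF]
    have h3' : X.fresh n z' ↔ X.fresh n z := by simp only [fresh, h1, setSeedF]
    have h4 : (X.st (n + 1) z').y e.castSucc = (X.st (n + 1) z).y e.castSucc := by
      rw [X.y_eq, X.y_eq, X.x_succ, X.x_succ, h2]
      simp only [h3, h3']
      rw [h1]
      exact forward_update _ _ _ _ _ _ _ Fin.castSucc_lt_succ
    have h5 : X.preY n e z' = X.preY n e z := by
      simp only [preY, h4, h2]
    have h6 : (z' n).2.2.1 e.succ = s := by
      rw [h1]; exact Function.update_self _ _ _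
    dsimp only
    rw [X.y_succ, h5, h6, h2]
    simp only [h3]
    split_ifs with hex
    · simp
    · rw [← hD, ← enorm_neg]
      congr 2
      rw [hD]; abel
  rw [lintegral_congr key]
  unfold mask
  split_ifs with hex
  · simp
  · have := X.contrF e.succ D
    simp_rw [ofReal_norm_sq] at this
    refine this.trans_eq ?_
    rw [ENNReal.ofReal_mul (sq_nonneg _), ofReal_norm_sq, ENNReal.ofReal_pow X.ωF_mem.1]

/-- Error of the backward compression in the round `n`. -/
lemma eLpNorm_v_sub_preV_le (n : ℕ) (e : Fin E) :
    eLpNorm (fun z => (X.st (n + 1) z).v e.castSucc - X.preV n e z) 2 X.μ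
      ≤ ENNReal.ofReal X.ωB
        * eLpNorm (X.mask n fun z => X.preV n e z - (X.st n z).v e.castSucc) 2 X.μ := by
  classical
  refine eLpNorm_two_le ?_
  have hmp := measurePreserving_law X.P X.CF X.CB n
    (measurePreserving_setSeedB X.P X.CF X.CB e.castSucc)
  have hm : Measurable fun z => ‖(X.st (n + 1) z).v e.castSucc - X.preV n e z‖ₑ ^ 2 :=
    ((((X.meas (n + 1)).v _).sub (X.measurable_preV n e)).enorm).pow_const 2
  refine (lintegral_resample hmp hm).trans_le ?_
  rw [← lintegral_const_mul]
  swap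
  · exact (X.measurable_mask n ((X.measurable_preV n e).sub ((X.meas n).v _))).enorm.pow_const 2
  refine lintegral_mono fun z => ?_
  set D := X.preV n e z - (X.st n z).v e.castSucc with hD
  -- The same argument: the forward pass and the later backward positions do not see this seed.
  have key : ∀ s : X.CB.S,
      (fun z => ‖(X.st (n + 1) z).v e.castSucc - X.preV n e z‖ₑ ^ 2)
        (Function.update z n (setSeedB X.P X.CF X.CB e.castSucc (z n) s))
      = if X.exact n z then 0 else ‖D - X.CB.map e.castSucc s D‖ₑ ^ 2 := by
    intro s
    set z' := Function.update z n (setSeedB X.P X.CF X.CB e.castSucc (z n) s) with hz'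
    have h1 : z' n = setSeedB X.P X.CF X.CB e.castSucc (z n) s := Function.update_self _ _ _
    have h2 : X.st n z' = X.st n z := run_update _ _ _ _ _ _ le_rfl _ _
    have h3 : X.exact n z' ↔ X.exact n z := by
      simp only [exact, fresh, h1, setSeedB]
    have h3' : X.fresh n z' ↔ X.fresh n z := by simp only [fresh, h1, setSeedB]
    have h4 : (X.st (n + 1) z').y = (X.st (n + 1) z).y := by
      rw [X.y_eq, X.y_eq, X.x_succ, X.x_succ, h2]
      simp only [h3, h3']
      rw [h1]
      rfl
    have h4' : (X.st (n + 1) z').v e.succ = (X.st (n + 1) z).v e.succ := by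
      rw [X.v_eq, X.v_eq, h2, h4]
      simp only [h3]
      rw [h1]
      exact backward_update _ _ _ _ _ _ _ Fin.castSucc_lt_succ
    have h5 : X.preV n e z' = X.preV n e z := by
      simp only [preV, h4, h4', h2]
    have h6 : (z' n).2.2.2 e.castSucc = s := by
      rw [h1]; exact Function.update_self _ _ _
    dsimp only
    rw [X.v_castSucc, h5, h6, h2]
    simp only [h3]
    split_ifs with hex
    · simp
    · rw [← hD, ← enorm_neg]
      congr 2
      rw [hD]; abel
  rw [lintegral_congr key]
  unfold mask
  split_ifs with hex
  · simp
  · have := X.contrB e.castSucc D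
    simp_rw [ofReal_norm_sq] at this
    refine this.trans_eq ?_
    rw [ENNReal.ofReal_mul (sq_nonneg _), ofReal_norm_sq, ENNReal.ofReal_pow X.ωB_mem.1]

end Setting

section L2

variable {Ω : Type*} [MeasurableSpace Ω] {μ : Measure Ω} {V V₁ V₂ V₃ : Type*}
  [NormedAddCommGroup V] [NormedAddCommGroup V₁] [NormedAddCommGroup V₂] [NormedAddCommGroup V₃]

lemma eLpNorm_le_add_three {f : Ω → V} {g₁ : Ω → V₁} {g₂ : Ω → V₂} {g₃ : Ω → V₃}
    (h₁ : AEStronglyMeasurable g₁ μ) (h₂ : AEStronglyMeasurable g₂ μ)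
    (h₃ : AEStronglyMeasurable g₃ μ) {c₁ c₂ c₃ : ℝ} (hc₁ : 0 ≤ c₁) (hc₂ : 0 ≤ c₂) (hc₃ : 0 ≤ c₃)
    (h : ∀ z, ‖f z‖ ≤ c₁ * ‖g₁ z‖ + (c₂ * ‖g₂ z‖ + c₃ * ‖g₃ z‖)) :
    eLpNorm f 2 μ ≤ ENNReal.ofReal c₁ * eLpNorm g₁ 2 μ
      + (ENNReal.ofReal c₂ * eLpNorm g₂ 2 μ + ENNReal.ofReal c₃ * eLpNorm g₃ 2 μ) := by
  have hn : ∀ z, ‖c₂ * ‖g₂ z‖ + c₃ * ‖g₃ z‖‖ = c₂ * ‖g₂ z‖ + c₃ * ‖g₃ z‖ := fun z =>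
    Real.norm_of_nonneg (by positivity)
  have h1 := eLpNorm_le_add (f := f) (g' := fun z => c₂ * ‖g₂ z‖ + c₃ * ‖g₃ z‖) h₁
    ((h₂.norm.const_mul c₂).add (h₃.norm.const_mul c₃)) hc₁ zero_le_one
    (fun z => by rw [hn, one_mul]; exact h z)
  rw [ENNReal.ofReal_one, one_mul] at h1
  exact h1.trans (by gcongr; exact eLpNorm_le_add h₂ h₃ hc₂ hc₃ fun z => (hn z).le)

end L2

/-- The coin is uniform on [0, 1], so it is at most p with probability p. Round 0 is excluded
because it always draws. -/
lemma lintegral_coin {p : ℝ} (hp : p ∈ Set.Ioc (0 : ℝ) 1) {n : ℕ} (hn : n ≠ 0) (A B : ENNReal)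
    [DecidablePred fun c : unitInterval => Fresh p n c] :
    ∫⁻ c : unitInterval, (if Fresh p n c then A else B)
      = ENNReal.ofReal p * A + ENNReal.ofReal (1 - p) * B := by
  set S : Set unitInterval := Set.Iic ⟨p, hp.1.le, hp.2⟩ with hS
  have hmem : ∀ c : unitInterval, Fresh p n c ↔ c ∈ S := by
    intro c
    simp only [Fresh, hn, false_or]
    rfl
  have h1 : (volume : Measure unitInterval) S = ENNReal.ofReal p := unitInterval.volume_Iic _
  have h2 : (volume : Measure unitInterval) Sᶜ = ENNReal.ofReal (1 - p) := by
    rw [prob_compl_eq_one_sub measurableSet_Iic, h1, ENNReal.ofReal_sub _ hp.1.le,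
      ENNReal.ofReal_one]
  have hSm : MeasurableSet S := measurableSet_Iic
  rw [← lintegral_add_compl _ hSm, setLIntegral_congr_fun (g := fun _ => A) hSm
    (fun c hc => by simp [(hmem c).2 hc]), setLIntegral_congr_fun (g := fun _ => B) hSm.compl
    (fun c hc => if_neg fun h => hc ((hmem c).1 h)), setLIntegral_const, setLIntegral_const, h1,
    h2, mul_comm, mul_comm B]

/-! ### Errors of the forward pass -/

namespace Setting

variable {K : Constants} (X : Setting.{u} E K)

/-- The round `n` with another coin. -/
def recoin (n : ℕ) (z : X.Ω) (c : unitInterval) : X.Ω :=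
  Function.update z n (setCoin X.P X.CF X.CB (z n) c)

/-- The round `n` with another sample. -/
def resample (n : ℕ) (z : X.Ω) (x : Vec (X.P.d 0)) : X.Ω :=
  Function.update z n (setSample X.P X.CF X.CB (z n) x)

lemma measurePreserving_recoin (n : ℕ) :
    MeasurePreserving (fun q : X.Ω × unitInterval => X.recoin n q.1 q.2)
      (X.μ.prod volume) X.μ :=
  measurePreserving_law X.P X.CF X.CB n (measurePreserving_setCoin X.P X.CF X.CB)

lemma measurePreserving_resample (n : ℕ) :
    MeasurePreserving (fun q : X.Ω × Vec (X.P.d 0) => X.resample n q.1 q.2)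
      (X.μ.prod X.P.D) X.μ :=
  measurePreserving_law X.P X.CF X.CB n (measurePreserving_setSample X.P X.CF X.CB)

lemma st_recoin (n : ℕ) (z : X.Ω) (c : unitInterval) : X.st n (X.recoin n z c) = X.st n z :=
  run_update _ _ _ _ _ _ le_rfl _ _

lemma st_resample (n : ℕ) (z : X.Ω) (x : Vec (X.P.d 0)) : X.st n (X.resample n z x) = X.st n z :=
  run_update _ _ _ _ _ _ le_rfl _ _

lemma fresh_recoin (n : ℕ) (z : X.Ω) (c : unitInterval) :
    X.fresh n (X.recoin n z c) ↔ Fresh X.h.p n c := by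
  simp [fresh, recoin, setCoin]

lemma sample_recoin (n : ℕ) (z : X.Ω) (c : unitInterval) : (X.recoin n z c n).1 = (z n).1 := by
  simp [recoin, setCoin]

lemma sample_resample (n : ℕ) (z : X.Ω) (x : Vec (X.P.d 0)) : (X.resample n z x n).1 = x := by
  simp [resample, setSample]

-- The coin of round n is independent of everything that is invariant under `recoin`, so the
-- integral is a mixture with weights p and 1 − p.
open Classical in
lemma lintegral_ite_fresh {n : ℕ} (hn : n ≠ 0) {a b : X.Ω → ENNReal} (ha : Measurable a)
    (hb : Measurable b) (ha' : ∀ z c, a (X.recoin n z c) = a z)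
    (hb' : ∀ z c, b (X.recoin n z c) = b z) :
    ∫⁻ z, (if X.fresh n z then a z else b z) ∂X.μ
      = ENNReal.ofReal X.h.p * ∫⁻ z, a z ∂X.μ + ENNReal.ofReal (1 - X.h.p) * ∫⁻ z, b z ∂X.μ := by
  rw [lintegral_resample (X.measurePreserving_recoin n)
    (Measurable.ite (X.measurableSet_fresh' n) ha hb)]
  simp only [fresh_recoin, ha', hb', lintegral_coin X.p_mem hn]
  rw [lintegral_add_left (ha.const_mul _), lintegral_const_mul _ ha, lintegral_const_mul _ hb]

/-- Every sample in use has the law `D`. -/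
lemma lintegral_sample (n : ℕ) {H : Vec (X.P.d 0) → ENNReal} (hH : Measurable H) :
    ∫⁻ z, H (X.st (n + 1) z).x ∂X.μ = ∫⁻ x, H x ∂X.P.D := by
  classical
  have hS : ∀ n, Measurable fun z : X.Ω => H (z n).1 := fun n =>
    hH.comp (measurable_pi_apply n).fst
  have hx : ∀ n, Measurable fun z : X.Ω => H (X.st n z).x := fun n => hH.comp (X.meas n).x
  have key : ∀ n, ∫⁻ z, H (z n).1 ∂X.μ = ∫⁻ x, H x ∂X.P.D := by
    intro n
    rw [lintegral_resample (X.measurePreserving_resample n) (hS n)]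
    simp only [sample_resample]
    simp
  induction n with
  | zero =>
    rw [← key 0]
    refine lintegral_congr fun z => ?_
    have : X.fresh 0 z := Or.inl rfl
    rw [X.x_succ, if_pos this]
  | succ n ih =>
    have h1 : ∀ z, H (X.st (n + 1 + 1) z).x
        = if X.fresh (n + 1) z then H (z (n + 1)).1 else H (X.st (n + 1) z).x := by
      intro z
      rw [X.x_succ]; split_ifs <;> rfl
    rw [lintegral_congr h1, X.lintegral_ite_fresh (Nat.add_one_ne_zero n)
      (hS (n + 1)) (hx (n + 1))
      (fun z c => by rw [sample_recoin]) (fun z c => by rw [st_recoin]), ih, key, ← add_mul,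
      ← ENNReal.ofReal_add X.p_mem.1.le (by linarith [X.p_mem.2])]
    simp

/-- `L²` norm of the change of the weights before the round `n`. -/
def dw (n : ℕ) : ENNReal := eLpNorm (fun z => (X.st n z).w - (X.st (n - 1) z).w) 2 X.μ

/-- `L²` norm of the change of the transmitted activation in the round `n`. -/
def dy (i : Fin (E + 1)) : ℕ → ENNReal
  | 0 => 0
  | n + 1 => eLpNorm
      (X.mask (n + 1) fun z => (X.st (n + 1 + 1) z).y i - (X.st (n + 1) z).y i) 2 X.μ

/-- `L²` error of the transmitted activation. -/
def errY (i : Fin (E + 1)) (n : ℕ) : ENNReal :=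
  eLpNorm (fun z => (X.st (n + 1) z).y i - X.trueY n z i) 2 X.μ

/-- `L²` error of the transmitted activation gradient. -/
def errV (i : Fin (E + 1)) (n : ℕ) : ENNReal :=
  eLpNorm (fun z => (X.st (n + 1) z).v i - X.trueV n z i) 2 X.μ

/-- `L²` norm of the vector compressed in the forward pass. -/
def innY (e : Fin E) (n : ℕ) : ENNReal :=
  eLpNorm (X.mask n fun z => X.preY n e z - (X.st n z).y e.succ) 2 X.μ

/-- `L²` norm of the vector compressed in the backward pass. -/
def innV (e : Fin E) (n : ℕ) : ENNReal :=
  eLpNorm (X.mask n fun z => X.preV n e z - (X.st n z).v e.castSucc) 2 X.μ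

/-- `L²` error of the gradient estimate. -/
def errG (n : ℕ) : ENNReal :=
  eLpNorm (fun z => (X.st (n + 1) z).g - X.P.lossGrad (X.st (n + 1) z).x (X.st n z).w) 2 X.μ

lemma norm_preY_sub_le (n m : ℕ) (z : X.Ω) {e : Fin E} (he : e.succ ≠ Fin.last E) :
    ‖X.preY n e z - X.preY m e z‖ ≤ K.c₀ * ‖(X.st (n + 1) z).y e.castSucc
      - (X.st (m + 1) z).y e.castSucc‖ + K.c₀ * ‖(X.st n z).w - (X.st m z).w‖ := by
  refine (X.smooth.a_lip e he _ _ _ _).trans ?_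
  rw [← mul_add]
  refine mul_le_mul K.le_c₀.2.2.2.1 ?_ (by positivity) (by linarith [K.one_le_c₀])
  gcongr
  exact Pipeline.norm_params_le ((X.st n z).w - (X.st m z).w) e

lemma norm_preY_sub_trueY_le (n : ℕ) (z : X.Ω) {e : Fin E} (he : e.succ ≠ Fin.last E) :
    ‖X.preY n e z - X.trueY n z e.succ‖
      ≤ K.c₀ * ‖(X.st (n + 1) z).y e.castSucc - X.trueY n z e.castSucc‖ := by
  rw [trueY, Pipeline.act_succ]
  refine (X.smooth.a_lip e he _ _ _ _).trans ?_
  rw [sub_self, norm_zero, add_zero]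
  exact mul_le_mul_of_nonneg_right K.le_c₀.2.2.2.1 (norm_nonneg _)

/-- The memory is zero at the start, so the first compressed vector is the activation itself. It
equals the exact activation at the initial weights, of second moment at most B² ≤ c₀², up to the
error of the incoming activation. -/
lemma innY_zero_le {e : Fin E} (he : e.succ ≠ Fin.last E) :
    X.innY e 0 ≤ ENNReal.ofReal K.c₀ * X.errY e.castSucc 0 + ENNReal.ofReal K.c₀ := by
  have h0 : (0 : ℝ) ≤ K.c₀ := by linarith [K.one_le_c₀]
  have h1 : eLpNorm (fun z => X.trueY 0 z e.succ) 2 X.μ ≤ ENNReal.ofReal K.c₀ := by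
    refine eLpNorm_two_le_const ?_
    have h2 := X.lintegral_sample 0 (H := fun x => ‖X.P.act x X.w₁ e.succ‖ₑ ^ 2)
      ((measurable_act X.smooth measurable_id measurable_const e.succ).enorm.pow_const 2)
    refine h2.trans_le ?_
    have h3 := X.init.act_bound e.succ (Fin.succ_ne_zero e) he
    simp_rw [ofReal_norm_sq] at h3
    refine h3.trans ?_
    rw [ENNReal.ofReal_pow K.B_nonneg]
    gcongr
    exact K.le_c₀.2.2.2.2.2
  refine (X.eLpNorm_mask_le 0 _).trans ?_
  refine (eLpNorm_le_add (g := fun z => (X.st (0 + 1) z).y e.castSucc - X.trueY 0 z e.castSucc)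
    (g' := fun z => X.trueY 0 z e.succ)
    (((X.meas 1).y e.castSucc).sub (X.measurable_trueY 0 e.castSucc)).aestronglyMeasurable
    (X.measurable_trueY 0 e.succ).aestronglyMeasurable h0 zero_le_one fun z => ?_).trans ?_
  · have h2 := X.norm_preY_sub_trueY_le 0 z he
    have h3 : (X.st 0 z).y e.succ = 0 := rfl
    rw [h3, sub_zero, one_mul]
    calc ‖X.preY 0 e z‖ = ‖(X.preY 0 e z - X.trueY 0 z e.succ) + X.trueY 0 z e.succ‖ := by
          rw [sub_add_cancel]
      _ ≤ _ := (norm_add_le _ _).trans (by gcongr)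
  · rw [ENNReal.ofReal_one, one_mul]
    gcongr
    exact le_rfl

/-- The error feedback recursion: the new input of the compressor is what the previous compression
missed, at most ω times its input, plus the motion of the target. Exact rounds are masked and
contribute nothing. -/
lemma innY_succ_le {e : Fin E} (he : e.succ ≠ Fin.last E) (n : ℕ) :
    X.innY e (n + 1) ≤ ENNReal.ofReal X.ωF * X.innY e n
      + (ENNReal.ofReal K.c₀ * X.dy e.castSucc (n + 1) + ENNReal.ofReal K.c₀ * X.dw (n + 1)) := by
  have h0 : (0 : ℝ) ≤ K.c₀ := by linarith [K.one_le_c₀]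
  have h1 := eLpNorm_le_add_three (μ := X.μ)
    (f := X.mask (n + 1) fun z => X.preY (n + 1) e z - (X.st (n + 1) z).y e.succ)
    (g₁ := fun z => (X.st (n + 1) z).y e.succ - X.preY n e z)
    (g₂ := X.mask (n + 1) fun z => (X.st (n + 1 + 1) z).y e.castSucc
      - (X.st (n + 1) z).y e.castSucc)
    (g₃ := fun z => (X.st (n + 1) z).w - (X.st n z).w) (c₁ := 1) (c₂ := K.c₀) (c₃ := K.c₀)
    (((X.meas _).y e.succ).sub (X.measurable_preY n e)).aestronglyMeasurable
    (X.measurable_mask _ (((X.meas _).y e.castSucc).sub ((X.meas _).y e.castSucc))).aestronglyMeasurable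
    ((X.meas _).w.sub (X.meas _).w).aestronglyMeasurable zero_le_one h0 h0 (fun z => ?_)
  · refine h1.trans ?_
    rw [ENNReal.ofReal_one, one_mul]
    exact add_le_add_left (X.eLpNorm_y_sub_preY_le n e) _
  · unfold mask
    split_ifs
    · rw [norm_zero]; positivity
    · have h2 := X.norm_preY_sub_le (n + 1) n z he
      have h3 : X.preY (n + 1) e z - (X.st (n + 1) z).y e.succ
          = (X.preY (n + 1) e z - X.preY n e z)
            - ((X.st (n + 1) z).y e.succ - X.preY n e z) := by abel
      dsimp only
      rw [h3]
      refine (norm_sub_le _ _).trans ?_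
      linarith

/-- The memory moves by the compressed vector up to the compression error, hence by at most (1 + ω)
≤ 2 times its norm. -/
lemma dy_succ_le (e : Fin E) (n : ℕ) : X.dy e.succ n ≤ ENNReal.ofReal 2 * X.innY e n := by
  cases n with
  | zero => simp [dy]
  | succ n =>
    have h1 := eLpNorm_le_add (μ := X.μ)
      (f := X.mask (n + 1) fun z => (X.st (n + 1 + 1) z).y e.succ - (X.st (n + 1) z).y e.succ)
      (g := fun z => (X.st (n + 1 + 1) z).y e.succ - X.preY (n + 1) e z)
      (g' := X.mask (n + 1) fun z => X.preY (n + 1) e z - (X.st (n + 1) z).y e.succ)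
      (((X.meas _).y e.succ).sub (X.measurable_preY _ e)).aestronglyMeasurable
      (X.measurable_mask _ ((X.measurable_preY _ e).sub ((X.meas _).y e.succ))).aestronglyMeasurable
      zero_le_one zero_le_one (fun z => ?_)
    · refine h1.trans ?_
      rw [ENNReal.ofReal_one, one_mul, one_mul, ENNReal.ofReal_ofNat, two_mul]
      refine add_le_add_left ((X.eLpNorm_y_sub_preY_le (n + 1) e).trans ?_) _
      refine mul_le_of_le_one_left (zero_le) ?_
      exact ENNReal.ofReal_le_one.2 X.ωF_mem.2.le
    · unfold mask
      split_ifs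
      · rw [norm_zero]; positivity
      · rw [one_mul, one_mul]
        dsimp only
        refine le_trans (le_of_eq ?_) (norm_add_le _ _)
        rw [sub_add_sub_cancel]

lemma errY_zero (n : ℕ) : X.errY 0 n = 0 := by
  have : (fun z => (X.st (n + 1) z).y 0 - X.trueY n z 0) = 0 := by
    funext z
    rw [X.y_zero, trueY, Pipeline.act_zero, sub_self]
    rfl
  rw [errY, this, eLpNorm_zero]

lemma errY_succ_le {e : Fin E} (he : e.succ ≠ Fin.last E) (n : ℕ) :
    X.errY e.succ n ≤ X.innY e n + ENNReal.ofReal K.c₀ * X.errY e.castSucc n := by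
  have h0 : (0 : ℝ) ≤ K.c₀ := by linarith [K.one_le_c₀]
  have h1 := eLpNorm_le_add (μ := X.μ)
    (f := fun z => (X.st (n + 1) z).y e.succ - X.trueY n z e.succ)
    (g := fun z => (X.st (n + 1) z).y e.succ - X.preY n e z)
    (g' := fun z => (X.st (n + 1) z).y e.castSucc - X.trueY n z e.castSucc)
    (((X.meas _).y e.succ).sub (X.measurable_preY _ e)).aestronglyMeasurable
    (((X.meas _).y e.castSucc).sub (X.measurable_trueY n e.castSucc)).aestronglyMeasurable
    zero_le_one h0 (fun z => ?_)
  · refine h1.trans ?_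
    rw [ENNReal.ofReal_one, one_mul]
    refine add_le_add_left ((X.eLpNorm_y_sub_preY_le n e).trans ?_) _
    refine mul_le_of_le_one_left (zero_le) ?_
    exact ENNReal.ofReal_le_one.2 X.ωF_mem.2.le
  · rw [one_mul]
    exact (norm_sub_le_norm_sub_add_norm_sub _ (X.preY n e z) _).trans
      (by gcongr; exact X.norm_preY_sub_trueY_le n z he)

/-- Induction along the workers. The motion of one transmitted activation forces the recursion of
the next, so motion and error must be controlled together; each link multiplies the constant by
8c₀/(1 − ω). -/
lemma ctrl_forward {T : ℕ} {U : ℝ} (hU : 0 ≤ U) (hd : Ctrl T U 1 1 X.dw)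
    (hj : Ctrl T U 1 1 (X.dy 0)) (i : Fin (E + 1)) (hi : i ≠ Fin.last E) :
    Ctrl T U 1 ((8 * K.c₀ / (1 - X.ωF)) ^ (i : ℕ)) (X.dy i) ∧
      Ctrl T U 1 ((8 * K.c₀ / (1 - X.ωF)) ^ (i : ℕ)) (X.errY i) := by
  have h0 := K.one_le_c₀
  have hθ : 0 < 1 - X.ωF := by linarith [X.ωF_mem.2]
  have hθ1 : 1 - X.ωF ≤ 1 := by linarith [X.ωF_mem.1]
  have hr : 1 ≤ 8 * K.c₀ / (1 - X.ωF) := by rw [le_div_iff₀ hθ]; linarith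
  induction i using Fin.induction with
  | zero =>
    simp only [Fin.val_zero, pow_zero]
    exact ⟨hj, (Ctrl.zero zero_le_one zero_le_one).mono fun n _ => (X.errY_zero n).le⟩
  | succ e ih =>
    obtain ⟨h1, h2⟩ := ih (Fin.castSucc_lt_last e).ne
    rw [Fin.val_castSucc] at h1 h2
    set α := (8 * K.c₀ / (1 - X.ωF)) ^ (e : ℕ) with hα
    have hα1 : 1 ≤ α := one_le_pow₀ hr
    have hc : (0 : ℝ) ≤ K.c₀ := by linarith
    -- Four forcing terms, each of size at most c₀α: motion of the incoming activation, motion of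
    -- the weights, incoming error and initial transient. The last two are needed only in round 0.
    -- The factor 8 is this 4 times the 2 of `dy_succ_le`.
    have hf := (((h1.smul hc).add (hd.smul hc) hU (by positivity) (by positivity)).add
      ((h2.smul hc).add (Ctrl.single (T := T) (U := U) hc zero_le_one (c := K.c₀) (by simp)) hU
        (by positivity) hc) hU (by positivity) (by positivity)).mono_const (α' := 4 * (K.c₀ * α))
        hU zero_le_one (by positivity) (by nlinarith)
    have hk : Ctrl T U 1 (4 * (K.c₀ * α) / (1 - X.ωF)) (X.innY e) := by
      refine hf.recursion X.ωF_mem.1 X.ωF_mem.2 (fun _ => ?_) (fun n _ => ?_)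
      · refine (X.innY_zero_le hi).trans ?_
        simp only [if_true]
        exact le_add_of_nonneg_left zero_le
      · refine (X.innY_succ_le hi n).trans ?_
        exact add_le_add_right (le_add_of_nonneg_right zero_le) _
    have e1 : 2 * (4 * (K.c₀ * α) / (1 - X.ωF)) = (8 * K.c₀ / (1 - X.ωF)) ^ (e.succ : ℕ) := by
      rw [Fin.val_succ, pow_succ, ← hα]; field_simp; norm_num
    refine ⟨?_, ?_⟩
    · rw [← e1]
      exact (hk.smul zero_le_two).mono fun n _ => X.dy_succ_le e n
    · have h3 : K.c₀ * α ≤ 4 * (K.c₀ * α) / (1 - X.ωF) := by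
        rw [le_div_iff₀ hθ]
        have : 0 ≤ K.c₀ * α := by positivity
        nlinarith
      rw [← e1]
      refine ((hk.add (h2.smul hc) hU (by positivity) (by positivity)).mono fun n _ =>
        X.errY_succ_le hi n).mono_const hU zero_le_one (by positivity) (by linarith)

end Setting

/-! ### Errors of the backward pass and of the gradient estimate -/

namespace Setting

variable {K : Constants} (X : Setting.{u} E K)

lemma norm_preV_sub_trueV_le (n : ℕ) (e : Fin E) (z : X.Ω) :
    ‖X.preV n e z - X.trueV n z e.castSucc‖
      ≤ K.c₀ * ‖(X.st (n + 1) z).v e.succ - X.trueV n z e.succ‖ := by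
  rw [trueV, Pipeline.bp_castSucc, preV, ← map_sub]
  refine (Pipeline.norm_adjoint_apply_le _ _).trans ?_
  exact mul_le_mul_of_nonneg_right ((X.smooth.jac₁_bound e _ _).trans K.le_c₀.2.2.1) (norm_nonneg _)

lemma innV_zero_le {e : Fin E} (he : (e : ℕ) ≠ 0) :
    X.innV e 0 ≤ ENNReal.ofReal K.c₀ * X.errV e.succ 0 + ENNReal.ofReal (K.c₁ E) := by
  have h0 : (0 : ℝ) ≤ K.c₀ := by linarith [K.one_le_c₀]
  have hne : e.castSucc ≠ 0 := fun h => he (by simpa using congrArg Fin.val h)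
  refine (X.eLpNorm_mask_le 0 _).trans ?_
  refine (eLpNorm_le_add (g := fun z => (X.st (0 + 1) z).v e.succ - X.trueV 0 z e.succ)
    (g' := fun _ => K.c₁ E)
    (((X.meas 1).v e.succ).sub (X.measurable_trueV 0 e.succ)).aestronglyMeasurable
    aestronglyMeasurable_const h0 zero_le_one fun z => ?_).trans ?_
  · have h2 := X.norm_preV_sub_trueV_le 0 e z
    have h3 : (X.st 0 z).v e.castSucc = 0 := rfl
    rw [h3, sub_zero, one_mul, Real.norm_of_nonneg (by linarith [K.one_le_c₁ E])]
    calc ‖X.preV 0 e z‖ = ‖(X.preV 0 e z - X.trueV 0 z e.castSucc) + X.trueV 0 z e.castSucc‖ := by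
          rw [sub_add_cancel]
      _ ≤ _ := (norm_add_le _ _).trans
        (add_le_add h2 (Pipeline.norm_bp_le X.smooth _ _ _ hne))
  · rw [ENNReal.ofReal_one, one_mul, eLpNorm_const _ two_ne_zero (NeZero.ne _), measure_univ,
      ENNReal.one_rpow, mul_one, Real.enorm_of_nonneg (by linarith [K.one_le_c₁ E])]
    exact le_rfl

/-- `L²` norm of the change of all transmitted activations in one round. -/
def dyAll (n : ℕ) : ENNReal :=
  ∑ e ∈ Finset.univ.filter (fun e : Fin E => (e : ℕ) ≠ 0), X.dy e.castSucc n

/-- The transmitted activation gradients have no a priori bound, so the variation of a Jacobian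
cannot be multiplied by them. The targets of the two rounds are instead compared through the exact
backward passes along the transmitted activations, whose variation is bounded by `norm_bp_sub_le`.
The price is the incoming backward error of both rounds. -/
lemma innV_succ_le {e : Fin E} (he : (e : ℕ) ≠ 0) (n : ℕ) :
    X.innV e (n + 1) ≤ ENNReal.ofReal X.ωB * X.innV e n
      + ((ENNReal.ofReal K.c₀ * X.errV e.succ (n + 1) + ENNReal.ofReal K.c₀ * X.errV e.succ n)
        + (ENNReal.ofReal (K.c₂ E) * X.dyAll (n + 1)
          + ENNReal.ofReal (K.c₂ E) * X.dw (n + 1))) := by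
  have h0 : (0 : ℝ) ≤ K.c₀ := by linarith [K.one_le_c₀]
  have hc2 : (0 : ℝ) ≤ K.c₂ E := by linarith [K.one_le_c₂ E]
  have hne : e.castSucc ≠ 0 := fun h => he (by simpa using congrArg Fin.val h)
  set s := Finset.univ.filter (fun e : Fin E => (e : ℕ) ≠ 0) with hs
  set S : ℕ → X.Ω → Vec (X.P.d e.succ) := fun n z =>
    (X.st (n + 1) z).v e.succ - X.trueV n z e.succ with hSd
  have hS : ∀ n, AEStronglyMeasurable (S n) X.μ := fun n =>
    (((X.meas _).v e.succ).sub (X.measurable_trueV n e.succ)).aestronglyMeasurable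
  set Y : (e : Fin E) → X.Ω → Vec (X.P.d e.castSucc) := fun e => X.mask (n + 1) fun z =>
    (X.st (n + 1 + 1) z).y e.castSucc - (X.st (n + 1) z).y e.castSucc with hYd
  have hY : ∀ e, AEStronglyMeasurable (Y e) X.μ := fun e =>
    (X.measurable_mask _ (((X.meas _).y e.castSucc).sub ((X.meas _).y
      e.castSucc))).aestronglyMeasurable
  set Wd : X.Ω → X.P.Params := fun z => (X.st (n + 1) z).w - (X.st n z).w with hWd
  have hW : AEStronglyMeasurable Wd X.μ := ((X.meas _).w.sub (X.meas _).w).aestronglyMeasurable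
  set G : X.Ω → ℝ := fun z => K.c₀ * ‖S (n + 1) z‖ + K.c₀ * ‖S n z‖ with hG
  set Z : X.Ω → ℝ := fun z => ∑ e ∈ s, ‖Y e z‖ with hZ
  have hZm : AEStronglyMeasurable Z X.μ :=
    Finset.aestronglyMeasurable_fun_sum _ fun e _ => (hY e).norm
  have hZ0 : ∀ z, 0 ≤ Z z := fun z => Finset.sum_nonneg fun _ _ => norm_nonneg _
  set H : X.Ω → ℝ := fun z => K.c₂ E * ‖Z z‖ + K.c₂ E * ‖Wd z‖ with hH
  have hGm : AEStronglyMeasurable G X.μ := ((hS _).norm.const_mul _).add ((hS _).norm.const_mul _)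
  have hHm : AEStronglyMeasurable H X.μ := (hZm.norm.const_mul _).add (hW.norm.const_mul _)
  have hGn : ∀ z, ‖G z‖ = K.c₀ * ‖S (n + 1) z‖ + K.c₀ * ‖S n z‖ := fun z =>
    Real.norm_of_nonneg (by positivity)
  have hHn : ∀ z, ‖H z‖ = K.c₂ E * ‖Z z‖ + K.c₂ E * ‖Wd z‖ := fun z =>
    Real.norm_of_nonneg (by positivity)
  have h1 := eLpNorm_le_add_three (μ := X.μ)
    (f := X.mask (n + 1) fun z => X.preV (n + 1) e z - (X.st (n + 1) z).v e.castSucc)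
    (g₁ := fun z => (X.st (n + 1) z).v e.castSucc - X.preV n e z) (g₂ := G) (g₃ := H)
    (((X.meas _).v e.castSucc).sub (X.measurable_preV n e)).aestronglyMeasurable
    hGm hHm zero_le_one zero_le_one zero_le_one (fun z => ?_)
  · refine h1.trans ?_
    rw [ENNReal.ofReal_one, one_mul, one_mul, one_mul]
    refine add_le_add (X.eLpNorm_v_sub_preV_le n e) (add_le_add ?_ ?_)
    · exact eLpNorm_le_add (hS _) (hS _) h0 h0 fun z => (hGn z).le
    · refine (eLpNorm_le_add hZm hW hc2 hc2 fun z => (hHn z).le).trans ?_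
      refine add_le_add_left (mul_le_mul_right ?_ _) _
      exact eLpNorm_le_sum s hY fun z => (Real.norm_of_nonneg (hZ0 z)).le
  · rw [hGn, hHn, one_mul, one_mul, one_mul]
    by_cases hex : X.exact (n + 1) z
    · have : X.mask (n + 1) (fun z => X.preV (n + 1) e z - (X.st (n + 1) z).v e.castSucc) z = 0 :=
        if_pos hex
      rw [this, norm_zero]; positivity
    · have hm : X.mask (n + 1) (fun z => X.preV (n + 1) e z - (X.st (n + 1) z).v e.castSucc) z
          = X.preV (n + 1) e z - (X.st (n + 1) z).v e.castSucc := if_neg hex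
      have h2 := X.norm_preV_sub_trueV_le (n + 1) e z
      have h3 := X.norm_preV_sub_trueV_le n e z
      have h4 := Pipeline.norm_bp_sub_le X.smooth (X.st (n + 1 + 1) z).y (X.st (n + 1) z).y
        (X.st (n + 1) z).w (X.st n z).w e.castSucc hne
      have h5 : X.P.layerDist (X.st (n + 1 + 1) z).y (X.st (n + 1) z).y = ‖Z z‖ := by
        rw [Real.norm_of_nonneg (hZ0 z), hZ, Pipeline.layerDist]
        refine Finset.sum_congr rfl fun e _ => ?_
        rw [hYd]
        simp only [mask, if_neg hex]
      rw [h5, mul_add] at h4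
      have h6 : X.preV (n + 1) e z - (X.st (n + 1) z).v e.castSucc
          = (X.preV (n + 1) e z - X.trueV (n + 1) z e.castSucc)
            + (X.trueV (n + 1) z e.castSucc - X.trueV n z e.castSucc)
            - (X.preV n e z - X.trueV n z e.castSucc)
            - ((X.st (n + 1) z).v e.castSucc - X.preV n e z) := by abel
      rw [hm, h6]
      refine (norm_sub_le _ _).trans ?_
      refine (add_le_add_left ((norm_sub_le _ _).trans
        (add_le_add_left (norm_add_le _ _) _)) _).trans ?_
      have h7 : ‖X.trueV (n + 1) z e.castSucc - X.trueV n z e.castSucc‖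
        ≤ K.c₂ E * ‖Z z‖ + K.c₂ E * ‖Wd z‖ := h4
      linarith

lemma errV_last (n : ℕ) : X.errV (Fin.last E) n = 0 := by
  have : (fun z => (X.st (n + 1) z).v (Fin.last E) - X.trueV n z (Fin.last E)) = 0 := by
    funext z
    rw [X.v_last, trueV, Pipeline.bp_last, sub_self]
    rfl
  rw [errV, this, eLpNorm_zero]

lemma errV_castSucc_le (e : Fin E) (n : ℕ) :
    X.errV e.castSucc n ≤ X.innV e n + ENNReal.ofReal K.c₀ * X.errV e.succ n := by
  have h0 : (0 : ℝ) ≤ K.c₀ := by linarith [K.one_le_c₀]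
  have h1 := eLpNorm_le_add (μ := X.μ)
    (f := fun z => (X.st (n + 1) z).v e.castSucc - X.trueV n z e.castSucc)
    (g := fun z => (X.st (n + 1) z).v e.castSucc - X.preV n e z)
    (g' := fun z => (X.st (n + 1) z).v e.succ - X.trueV n z e.succ)
    (((X.meas _).v e.castSucc).sub (X.measurable_preV _ e)).aestronglyMeasurable
    (((X.meas _).v e.succ).sub (X.measurable_trueV n e.succ)).aestronglyMeasurable
    zero_le_one h0 (fun z => ?_)
  · refine h1.trans ?_
    rw [ENNReal.ofReal_one, one_mul]
    refine add_le_add_left ((X.eLpNorm_v_sub_preV_le n e).trans ?_) _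
    refine mul_le_of_le_one_left (zero_le) ?_
    exact ENNReal.ofReal_le_one.2 X.ωB_mem.2.le
  · rw [one_mul]
    exact (norm_sub_le_norm_sub_add_norm_sub _ (X.preV n e z) _).trans
      (by gcongr; exact X.norm_preV_sub_trueV_le n e z)

/-- The induction of the forward pass, run from the last worker, where the transmitted vector is
exact. The motion of the activations enters once, through A₀, and is then amplified by the backward
links. -/
lemma ctrl_backward {T : ℕ} {U α : ℝ} (hU : 0 ≤ U) (hd : Ctrl T U 1 1 X.dw) (hα : 0 ≤ α)
    (hy : ∀ e : Fin E, (e : ℕ) ≠ 0 → Ctrl T U 1 α (X.dy e.castSucc)) (i : Fin (E + 1)) (hi : i ≠ 0) :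
    Ctrl T U 1 ((4 * K.c₀ / (1 - X.ωB)) ^ (E - (i : ℕ)) * (K.c₂ E * (E * α + 1) + K.c₁ E))
      (X.errV i) := by
  have h0 := K.one_le_c₀
  have hc1 := K.one_le_c₁ E
  have hc2 := K.one_le_c₂ E
  have hθ : 0 < 1 - X.ωB := by linarith [X.ωB_mem.2]
  have hθ1 : 1 - X.ωB ≤ 1 := by linarith [X.ωB_mem.1]
  have hr : 1 ≤ 4 * K.c₀ / (1 - X.ωB) := by rw [le_div_iff₀ hθ]; linarith
  set A₀ := K.c₂ E * (E * α + 1) + K.c₁ E with hA₀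
  have hA₀0 : 0 ≤ A₀ := by positivity
  have hcard : ((Finset.univ.filter (fun e : Fin E => (e : ℕ) ≠ 0)).card : ℝ) ≤ E := by
    exact_mod_cast (Finset.card_le_univ _).trans_eq (Fintype.card_fin E)
  have hall : Ctrl T U 1 (E * α) X.dyAll :=
    (Ctrl.sum _ hU zero_le_one hα fun e he => hy e (by simpa using he)).mono_const hU zero_le_one
      (by positivity) (by gcongr)
  induction i using Fin.reverseInduction with
  | last =>
    refine (Ctrl.zero (by positivity) zero_le_one).mono fun n _ => (X.errV_last n).le
  | cast e ih =>
    have he : (e : ℕ) ≠ 0 := fun h => hi (Fin.ext h)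
    have h1 := ih (Fin.succ_ne_zero e)
    set A := (4 * K.c₀ / (1 - X.ωB)) ^ (E - (e.succ : ℕ)) * A₀ with hA
    have hA1 : A₀ ≤ A := le_mul_of_one_le_left hA₀0 (one_le_pow₀ hr)
    have hA0 : 0 ≤ A := hA₀0.trans hA1
    have hc : (0 : ℝ) ≤ K.c₀ := by linarith
    have hc2' : (0 : ℝ) ≤ K.c₂ E := by linarith
    -- The errors of this round and of the preceding one give 2c₀A. Motion and transient add up to
    -- A₀ ≤ A ≤ c₀A, hence the factor 3; one more c₀A comes from `errV_castSucc_le`.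
    have hf := ((((h1.smul hc).add (h1.shift.smul hc) hU (by positivity) (by positivity)).add
      ((hall.smul hc2').add (hd.smul hc2') hU (by positivity) (by positivity)) hU (by positivity)
        (by positivity)).add (Ctrl.single (T := T) (U := U) (α := K.c₁ E) (by linarith) zero_le_one
        (c := K.c₁ E) (by simp)) hU (by positivity) (by linarith)).mono_const
        (α' := 3 * (K.c₀ * A)) hU zero_le_one (by positivity) (by nlinarith)
    have hk : Ctrl T U 1 (3 * (K.c₀ * A) / (1 - X.ωB)) (X.innV e) := by
      refine hf.recursion X.ωB_mem.1 X.ωB_mem.2 (fun _ => ?_) (fun n _ => ?_)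
      · refine (X.innV_zero_le he).trans ?_
        simp only [if_true]
        gcongr
        rw [add_assoc]
        exact le_add_of_nonneg_right zero_le
      · refine (X.innV_succ_le he n).trans ?_
        exact add_le_add_right (le_add_of_nonneg_right zero_le) _
    have h3 : K.c₀ * A ≤ K.c₀ * A / (1 - X.ωB) := by
      rw [le_div_iff₀ hθ]
      have : 0 ≤ K.c₀ * A := by positivity
      nlinarith
    have e1 : 3 * (K.c₀ * A) / (1 - X.ωB) + K.c₀ * A / (1 - X.ωB)
        = (4 * K.c₀ / (1 - X.ωB)) ^ (E - (e.castSucc : ℕ)) * A₀ := by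
      have : E - (e.castSucc : ℕ) = E - (e.succ : ℕ) + 1 := by
        have := e.2
        simp only [Fin.val_succ, Fin.val_castSucc]; omega
      rw [this, pow_succ, hA]; field_simp; ring
    rw [← e1]
    exact ((hk.add (h1.smul hc) hU (by positivity) (by positivity)).mono fun n _ =>
        X.errV_castSucc_le e n).mono_const hU zero_le_one (by positivity) (by linarith)

lemma errG_le (n : ℕ) : X.errG n ≤ ENNReal.ofReal (K.c₃ E) * (∑ e : Fin E, X.errV e.succ n)
    + ENNReal.ofReal (K.c₃ E)
      * ∑ e ∈ Finset.univ.filter (fun e : Fin E => (e : ℕ) ≠ 0), X.errY e.castSucc n := by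
  have hc3 : (0 : ℝ) ≤ K.c₃ E := by linarith [K.one_le_c₃ E]
  have hVm : ∀ e : Fin E, AEStronglyMeasurable
      (fun z => (X.st (n + 1) z).v e.succ - X.trueV n z e.succ) X.μ := fun e =>
    (((X.meas _).v e.succ).sub (X.measurable_trueV n e.succ)).aestronglyMeasurable
  have hYm : ∀ e : Fin E, AEStronglyMeasurable
      (fun z => (X.st (n + 1) z).y e.castSucc - X.trueY n z e.castSucc) X.μ := fun e =>
    (((X.meas _).y e.castSucc).sub (X.measurable_trueY n e.castSucc)).aestronglyMeasurable
  have hV0 : ∀ z, 0 ≤ ∑ e : Fin E, ‖(X.st (n + 1) z).v e.succ - X.trueV n z e.succ‖ := fun z =>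
    Finset.sum_nonneg fun _ _ => norm_nonneg _
  have h1 := eLpNorm_le_add (μ := X.μ)
    (f := fun z => (X.st (n + 1) z).g - X.P.lossGrad (X.st (n + 1) z).x (X.st n z).w)
    (g := fun z => ∑ e : Fin E, ‖(X.st (n + 1) z).v e.succ - X.trueV n z e.succ‖)
    (g' := fun z => X.P.layerDist (X.st (n + 1) z).y (X.trueY n z))
    (Finset.aestronglyMeasurable_fun_sum _ fun e _ => (hVm e).norm)
    (Finset.aestronglyMeasurable_fun_sum _ fun e _ => (hYm e).norm) hc3 hc3 (fun z => ?_)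
  · refine h1.trans (add_le_add (mul_le_mul_right ?_ _) (mul_le_mul_right ?_ _))
    · exact eLpNorm_le_sum _ hVm fun z => (Real.norm_of_nonneg (hV0 z)).le
    · exact eLpNorm_le_sum _ hYm fun z =>
        (Real.norm_of_nonneg (Pipeline.layerDist_nonneg _ _)).le
  · have h2 := Pipeline.norm_gradAt_sub_le X.smooth (X.st (n + 1) z).y (X.trueY n z)
      (X.st (n + 1) z).v (X.st n z).w (X.st n z).w rfl
    rw [sub_self, norm_zero, add_zero, mul_add] at h2
    rw [Real.norm_of_nonneg (hV0 z), Real.norm_of_nonneg (Pipeline.layerDist_nonneg _ _)]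
    exact h2

end Setting

/-- Constant of the bound of the error of the gradient estimates. -/
def Constants.c₅ (K : Constants) (E : ℕ) : ℝ :=
  K.c₃ E * (E * ((4 * K.c₀) ^ (E - 1) * (K.c₂ E * (E * (8 * K.c₀) ^ (E - 1) + 1) + K.c₁ E))
    + E * (8 * K.c₀) ^ (E - 1))

/-- The contraction of all compressions of one pass. -/
def contraction (E : ℕ) (ωF ωB : ℝ) : ℝ := (1 - ωF) ^ (E - 1) * (1 - ωB) ^ (E - 1)

lemma contraction_pos {ωF ωB : ℝ} (hF : ωF ∈ Set.Ico (0 : ℝ) 1) (hB : ωB ∈ Set.Ico (0 : ℝ) 1) :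
    0 < contraction E ωF ωB :=
  mul_pos (pow_pos (by linarith [hF.2]) _) (pow_pos (by linarith [hB.2]) _)

namespace Setting

variable {K : Constants} (X : Setting.{u} E K)

/-- The contraction of all compressions of one pass of the run. -/
def θ : ℝ := contraction E X.ωF X.ωB

lemma θ_pos : 0 < X.θ := contraction_pos X.ωF_mem X.ωB_mem

/-- A forward chain contributes at most E − 1 factors 1/(1 − ωF), and a backward chain at most E − 1
factors 1/(1 − ωB). Forward factors enter the backward bound only once and linearly, so the product
is 1/θ and no higher power. -/
lemma ctrl_errG {T : ℕ} {U : ℝ} (hU : 0 ≤ U) (hd : Ctrl T U 1 1 X.dw)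
    (hj : Ctrl T U 1 1 (X.dy 0)) : Ctrl T U 1 (K.c₅ E / X.θ) X.errG := by
  have h0 := K.one_le_c₀
  have hc1 := K.one_le_c₁ E
  have hc2 := K.one_le_c₂ E
  have hc3 := K.one_le_c₃ E
  have hθF : 0 < 1 - X.ωF := by linarith [X.ωF_mem.2]
  have hθB : 0 < 1 - X.ωB := by linarith [X.ωB_mem.2]
  have hrF : 1 ≤ 8 * K.c₀ / (1 - X.ωF) := by
    rw [le_div_iff₀ hθF]; linarith [X.ωF_mem.1]
  have hrB : 1 ≤ 4 * K.c₀ / (1 - X.ωB) := by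
    rw [le_div_iff₀ hθB]; linarith [X.ωB_mem.1]
  set αF := (8 * K.c₀ / (1 - X.ωF)) ^ (E - 1) with hαF
  have hαF0 : 0 ≤ αF := by positivity
  have hfw : ∀ e : Fin E, Ctrl T U 1 αF (X.dy e.castSucc) ∧ Ctrl T U 1 αF (X.errY e.castSucc) := by
    intro e
    obtain ⟨h1, h2⟩ := X.ctrl_forward hU hd hj e.castSucc (Fin.castSucc_lt_last e).ne
    have h3 : (8 * K.c₀ / (1 - X.ωF)) ^ (e.castSucc : ℕ) ≤ αF := by
      refine pow_le_pow_right₀ hrF ?_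
      have := e.2
      simp only [Fin.val_castSucc]; omega
    exact ⟨h1.mono_const hU zero_le_one (by positivity) h3,
      h2.mono_const hU zero_le_one (by positivity) h3⟩
  set A₀ := K.c₂ E * (E * αF + 1) + K.c₁ E with hA₀
  have hA₀0 : 0 ≤ A₀ := by positivity
  set αB := (4 * K.c₀ / (1 - X.ωB)) ^ (E - 1) with hαB
  have hbw : ∀ e : Fin E, Ctrl T U 1 (αB * A₀) (X.errV e.succ) := by
    intro e
    refine (X.ctrl_backward hU hd hαF0 (fun e _ => (hfw e).1) e.succ
      (Fin.succ_ne_zero e)).mono_const hU zero_le_one (by positivity) ?_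
    refine mul_le_mul_of_nonneg_right (pow_le_pow_right₀ hrB ?_) hA₀0
    simp only [Fin.val_succ]; omega
  have hcard : ((Finset.univ.filter (fun e : Fin E => (e : ℕ) ≠ 0)).card : ℝ) ≤ E := by
    exact_mod_cast (Finset.card_le_univ _).trans_eq (Fintype.card_fin E)
  have hV := Ctrl.sum (T := T) (U := U) (V := 1) Finset.univ hU zero_le_one
    (by positivity : 0 ≤ αB * A₀) fun e _ => hbw e
  have hY := (Ctrl.sum (T := T) (U := U) (V := 1)
    (Finset.univ.filter (fun e : Fin E => (e : ℕ) ≠ 0)) hU zero_le_one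
    hαF0 fun e _ => (hfw e).2).mono_const (α' := E * αF) hU zero_le_one (by positivity)
    (by gcongr)
  rw [Finset.card_univ, Fintype.card_fin] at hV
  have hc3' : (0 : ℝ) ≤ K.c₃ E := by linarith
  refine (((hV.smul hc3').add (hY.smul hc3') hU (by positivity) (by positivity)).mono
    fun n _ => X.errG_le n).mono_const hU zero_le_one (by positivity) ?_
  rw [← mul_add, Constants.c₅, mul_div_assoc]
  refine mul_le_mul_of_nonneg_left ?_ hc3'
  have e1 : αF = (8 * K.c₀) ^ (E - 1) / (1 - X.ωF) ^ (E - 1) := div_pow _ _ _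
  have e2 : αB = (4 * K.c₀) ^ (E - 1) / (1 - X.ωB) ^ (E - 1) := div_pow _ _ _
  set tF := (1 - X.ωF) ^ (E - 1) with htF
  set tB := (1 - X.ωB) ^ (E - 1) with htB
  have htF0 : 0 < tF := by positivity
  have htB0 : 0 < tB := by positivity
  have htF1 : tF ≤ 1 := pow_le_one₀ hθF.le (by linarith [X.ωF_mem.1])
  have htB1 : tB ≤ 1 := pow_le_one₀ hθB.le (by linarith [X.ωB_mem.1])
  have hθ : X.θ = tF * tB := rfl
  set a := (8 * K.c₀) ^ (E - 1) with ha
  set b := (4 * K.c₀) ^ (E - 1) with hb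
  have ha0 : 0 ≤ a := by positivity
  have hb0 : 0 ≤ b := by positivity
  -- Only the summand with αF carries 1/tF; the others are enlarged by it, because tF ≤ 1.
  have h1 : A₀ ≤ (K.c₂ E * (E * a + 1) + K.c₁ E) / tF := by
    rw [le_div_iff₀ htF0, hA₀, e1]
    have : (K.c₂ E * (E * (a / tF) + 1) + K.c₁ E) * tF
        = K.c₂ E * (E * a) + (K.c₂ E + K.c₁ E) * tF := by field_simp; ring
    rw [this]
    nlinarith
  have h2 : αB * A₀ ≤ b * (K.c₂ E * (E * a + 1) + K.c₁ E) / X.θ := by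
    rw [e2, hθ, mul_comm tF, mul_div_mul_comm]
    gcongr
  have h3 : αF ≤ a / X.θ := by
    rw [e1, hθ]
    gcongr
    exact mul_le_of_le_one_right htF0.le htB1
  calc (E : ℝ) * (αB * A₀) + E * αF
      ≤ E * (b * (K.c₂ E * (E * a + 1) + K.c₁ E) / X.θ) + E * (a / X.θ) := by gcongr
    _ = _ := by ring

end Setting

lemma Ctrl.of_sum_sq {T : ℕ} {U V α : ℝ} {a : ℕ → ENNReal}
    (h : ∑ n ∈ Finset.range T, a n ^ 2 ≤ ENNReal.ofReal ((α * U) ^ 2)) (hV : 0 ≤ α * V) :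
    Ctrl T U V α a := by
  have hfin : ∀ n < T, a n ≠ ⊤ := by
    intro n hn htop
    have h1 := (Finset.single_le_sum (f := fun n => a n ^ 2) (fun _ _ => zero_le)
      (Finset.mem_range.2 hn)).trans h
    rw [htop] at h1
    simp at h1
  refine ⟨fun n => (a n).toReal, 0, fun _ => ENNReal.toReal_nonneg, fun _ => le_rfl,
    fun n hn => ?_, ?_, by simpa using hV⟩
  · simp [ENNReal.ofReal_toReal (hfin n hn)]
  · have h1 : ∑ n ∈ Finset.range T, a n ^ 2
        = ENNReal.ofReal (∑ n ∈ Finset.range T, (a n).toReal ^ 2) := by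
      rw [ENNReal.ofReal_sum_of_nonneg fun _ _ => sq_nonneg _]
      refine Finset.sum_congr rfl fun n hn => ?_
      rw [ENNReal.ofReal_pow ENNReal.toReal_nonneg,
        ENNReal.ofReal_toReal (hfin n (Finset.mem_range.1 hn))]
    rw [h1] at h
    exact (ENNReal.ofReal_le_ofReal_iff (sq_nonneg _)).1 h

/-! ### Lazy sampling: sample changes and age of the sample -/

lemma integral_resample {α β : Type*} [MeasurableSpace α] [MeasurableSpace β] {μ : Measure α}
    {ρ : Measure β} [SFinite μ] [SFinite ρ] {ψ : α × β → α}
    (h : MeasurePreserving ψ (μ.prod ρ) μ) {f : α → ℝ} (hf : Integrable f μ) :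
    ∫ z, f z ∂μ = ∫ z, ∫ s, f (ψ (z, s)) ∂ρ ∂μ := by
  have h1 : ∫ z, f z ∂μ = ∫ q, f (ψ q) ∂(μ.prod ρ) := by
    conv_lhs => rw [← h.map_eq]
    refine integral_map h.measurable.aemeasurable ?_
    rw [h.map_eq]
    exact hf.aestronglyMeasurable
  rw [h1]
  exact integral_prod _ (h.integrable_comp_of_integrable hf)

lemma integral_coin {p : ℝ} (hp : p ∈ Set.Ioc (0 : ℝ) 1) {n : ℕ} (hn : n ≠ 0) (A B : ℝ)
    [DecidablePred fun c : unitInterval => Fresh p n c] :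
    ∫ c : unitInterval, (if Fresh p n c then A else B) = p * A + (1 - p) * B := by
  set S : Set unitInterval := Set.Iic ⟨p, hp.1.le, hp.2⟩ with hS
  have hmem : ∀ c : unitInterval, Fresh p n c ↔ c ∈ S := by
    intro c
    simp only [Fresh, hn, false_or]
    rfl
  have h1 : (volume : Measure unitInterval).real S = p := by
    rw [measureReal_def, unitInterval.volume_Iic, ENNReal.toReal_ofReal hp.1.le]
  have hSm : MeasurableSet S := measurableSet_Iic
  have h2 : ∀ c : unitInterval, (if Fresh p n c then A else B)
      = S.indicator (fun _ => A - B) c + B := by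
    intro c
    by_cases hc : c ∈ S
    · simp [hc, (hmem c).2 hc]
    · rw [if_neg fun h => hc ((hmem c).1 h), Set.indicator_of_notMem hc, zero_add]
  simp_rw [h2]
  rw [integral_add ((integrable_const _).indicator hSm) (integrable_const _),
    integral_indicator_const _ hSm, h1]
  simp; ring

namespace Setting

variable {K : Constants} (X : Setting.{u} E K)

lemma integrable_of_bound {f : X.Ω → ℝ} (hf : Measurable f) {C : ℝ} (h : ∀ z, ‖f z‖ ≤ C) :
    Integrable f X.μ :=
  Integrable.of_bound hf.aestronglyMeasurable C (Filter.Eventually.of_forall h)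

open Classical in
lemma integral_ite_fresh {n : ℕ} (hn : n ≠ 0) {a b : X.Ω → ℝ} (ha : Integrable a X.μ)
    (hb : Integrable b X.μ) (ha' : ∀ z c, a (X.recoin n z c) = a z)
    (hb' : ∀ z c, b (X.recoin n z c) = b z) :
    ∫ z, (if X.fresh n z then a z else b z) ∂X.μ
      = X.h.p * ∫ z, a z ∂X.μ + (1 - X.h.p) * ∫ z, b z ∂X.μ := by
  have hi : Integrable (fun z => if X.fresh n z then a z else b z) X.μ :=
    Integrable.piecewise (X.measurableSet_fresh' n) ha.integrableOn hb.integrableOn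
  rw [integral_resample (X.measurePreserving_recoin n) hi]
  simp only [fresh_recoin, ha', hb', integral_coin X.p_mem hn]
  rw [integral_add (ha.const_mul _) (hb.const_mul _), integral_const_mul, integral_const_mul]

/-- A bound of the `L²` norm of the change of the sample in one compressed round. -/
def jump : ℝ :=
  match X.vr with
  | Variant.FU => 0
  | Variant.FC => Real.sqrt X.h.p * X.φ

lemma jump_nonneg : 0 ≤ X.jump := by
  unfold jump
  split
  · exact le_rfl
  · exact mul_nonneg (Real.sqrt_nonneg _) X.φ_nonneg

/-- In FU every draw is an exact round and is masked, so the sample never moves in a compressed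
round. In FC a draw has probability p and replaces a sample of law D by an independent one, so the
mean square change is at most pφ². -/
lemma dy_zero_le (n : ℕ) : X.dy 0 n ≤ ENNReal.ofReal X.jump := by
  classical
  cases n with
  | zero => simp [dy]
  | succ n =>
    unfold jump
    split
    · next hvr =>
      have : (X.mask (n + 1) fun z => (X.st (n + 1 + 1) z).y 0 - (X.st (n + 1) z).y 0) = 0 := by
        funext z
        simp only [mask, exact, hvr, true_and, y_zero]
        split_ifs with hf
        · rfl
        · rw [X.x_succ, if_neg hf, sub_self]; rfl
      rw [dy, this, eLpNorm_zero]
      exact zero_le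
    · refine (X.eLpNorm_mask_le _ _).trans (eLpNorm_two_le_const ?_)
      have h1 : ∀ z, ‖(X.st (n + 1 + 1) z).y 0 - (X.st (n + 1) z).y 0‖ₑ ^ 2
          = if X.fresh (n + 1) z then ‖(z (n + 1)).1 - (X.st (n + 1) z).x‖ₑ ^ 2 else 0 := by
        intro z
        rw [X.y_zero, X.y_zero, X.x_succ]
        split_ifs
        · rfl
        · simp
      have hxm : Measurable fun z : X.Ω => (z (n + 1)).1 := (measurable_pi_apply (n + 1)).fst
      have hm : Measurable fun z : X.Ω => ‖(z (n + 1)).1 - (X.st (n + 1) z).x‖ₑ ^ 2 :=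
        ((hxm.sub (X.meas (n + 1)).x).enorm).pow_const 2
      have hH : Measurable fun q : Vec (X.P.d 0) × Vec (X.P.d 0) => ‖q.1 - q.2‖ₑ ^ 2 :=
        ((measurable_fst.sub measurable_snd).enorm).pow_const 2
      rw [lintegral_congr h1, X.lintegral_ite_fresh (Nat.add_one_ne_zero n) hm measurable_const
        (fun z c => by rw [sample_recoin, st_recoin]) (fun z c => rfl), lintegral_zero, mul_zero,
        add_zero, lintegral_resample (X.measurePreserving_resample (n + 1)) hm]
      simp only [sample_resample, st_resample]
      have h2 := X.lintegral_sample n (H := fun x => ∫⁻ s, ‖s - x‖ₑ ^ 2 ∂X.P.D)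
        (hH.lintegral_prod_left')
      rw [h2]
      have h3 := X.spread
      unfold BoundedSpread at h3
      simp_rw [ofReal_norm_sq] at h3
      rw [lintegral_prod_symm _ hH.aemeasurable] at h3
      rw [← ENNReal.ofReal_pow (mul_nonneg (Real.sqrt_nonneg _) X.φ_nonneg), mul_pow,
        Real.sq_sqrt X.p_mem.1.le, ENNReal.ofReal_mul X.p_mem.1.le]
      gcongr

open Classical in
/-- The weights at the time of the last new sample. -/
def frozenW : ℕ → X.Ω → X.P.Params
  | 0, _ => X.w₁
  | n + 1, z => if X.fresh n z then (X.st n z).w else frozenW n z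

lemma measurable_frozenW (n : ℕ) : Measurable (X.frozenW n) := by
  classical
  induction n with
  | zero => exact measurable_const
  | succ n ih => exact Measurable.ite (X.measurableSet_fresh' n) (X.meas n).w ih

lemma fresh_update {k n : ℕ} (hkn : k < n) (z : X.Ω) (r : Round X.P X.CF X.CB) :
    X.fresh k (Function.update z n r) ↔ X.fresh k z := by
  rw [fresh, Function.update_of_ne hkn.ne]; rfl

lemma frozenW_update {k n : ℕ} (hkn : k ≤ n) (z : X.Ω) (r : Round X.P X.CF X.CB) :
    X.frozenW k (Function.update z n r) = X.frozenW k z := by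
  induction k with
  | zero => rfl
  | succ k ih =>
    have h1 := X.fresh_update hkn z r
    have h2 : X.st k (Function.update z n r) = X.st k z := run_update _ _ _ _ _ _ (by omega) _ _
    rw [frozenW, frozenW]
    by_cases hf : X.fresh k z
    · rw [if_pos hf, if_pos (h1.2 hf), h2]
    · rw [if_neg hf, if_neg fun h => hf (h1.1 h), ih (by omega)]

/-- `L²` distance of the weights from those at the time of the last new sample. -/
def lag (n : ℕ) : ENNReal := eLpNorm (fun z => (X.st n z).w - X.frozenW (n + 1) z) 2 X.μ

lemma lag_zero : X.lag 0 = 0 := by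
  have : (fun z => (X.st 0 z).w - X.frozenW (0 + 1) z) = 0 := by
    funext z
    have h : X.fresh 0 z := Or.inl rfl
    simp [frozenW, h]
  rw [lag, this, eLpNorm_zero]

/-- A draw resets the distance to zero. Its coin is independent of the weights before the round, so
the mean square shrinks by 1 − p. -/
lemma lag_succ_le (n : ℕ) :
    X.lag (n + 1) ≤ ENNReal.ofReal (1 - X.h.p / 2) * (X.lag n + X.dw (n + 1)) := by
  classical
  have hp := X.p_mem
  set f : X.Ω → X.P.Params := fun z => (X.st (n + 1) z).w - X.frozenW (n + 1) z with hf
  have hfm : Measurable f := (X.meas _).w.sub (X.measurable_frozenW _)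
  have h1 : X.lag (n + 1) ≤ ENNReal.ofReal (1 - X.h.p / 2) * eLpNorm f 2 X.μ := by
    refine eLpNorm_two_le ?_
    have h2 : ∀ z, ‖(X.st (n + 1) z).w - X.frozenW (n + 1 + 1) z‖ₑ ^ 2
        = if X.fresh (n + 1) z then 0 else ‖f z‖ₑ ^ 2 := by
      intro z
      rw [frozenW]
      split_ifs
      · simp
      · rfl
    rw [lintegral_congr h2, X.lintegral_ite_fresh (Nat.add_one_ne_zero n) measurable_const
      (hfm.enorm.pow_const 2) (fun z c => rfl) (fun z c => by
        rw [hf]; dsimp only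
        rw [st_recoin, recoin, X.frozenW_update le_rfl]), lintegral_zero, mul_zero, zero_add,
      ← ENNReal.ofReal_pow (by linarith [hp.2])]
    gcongr
    -- 1 − p ≤ (1 − p/2)² avoids a square root and leads to the gain 2/p in `ctrl_lag`.
    nlinarith [sq_nonneg X.h.p]
  refine h1.trans (mul_le_mul_right ?_ _)
  have h3 := eLpNorm_le_add (μ := X.μ) (f := f)
    (g := fun z => (X.st n z).w - X.frozenW (n + 1) z)
    (g' := fun z => (X.st (n + 1) z).w - (X.st (n + 1 - 1) z).w)
    ((X.meas _).w.sub (X.measurable_frozenW _)).aestronglyMeasurable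
    ((X.meas _).w.sub (X.meas _).w).aestronglyMeasurable zero_le_one zero_le_one (fun z => ?_)
  · rwa [ENNReal.ofReal_one, one_mul, one_mul] at h3
  · rw [one_mul, one_mul, add_comm, hf]
    exact norm_sub_le_norm_sub_add_norm_sub _ _ _

lemma ctrl_lag {T : ℕ} {U : ℝ} (hd : Ctrl T U 0 1 X.dw) :
    Ctrl T U 0 (2 / X.h.p) X.lag := by
  have hp := X.p_mem
  have h1 : (2 / X.h.p) = 1 / (1 - (1 - X.h.p / 2)) := by
    rw [sub_sub_cancel, one_div_div]
  rw [h1]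
  refine hd.recursion (by linarith [hp.2]) (by linarith [hp.1]) (fun _ => ?_) fun n _ => ?_
  · rw [X.lag_zero]; exact zero_le
  · refine (X.lag_succ_le n).trans ?_
    rw [mul_add]
    gcongr
    exact mul_le_of_le_one_left zero_le (ENNReal.ofReal_le_one.2 (by linarith [hp.1]))

/-! ### Gradient noise frozen at the time of the draw -/

/-- Gradient noise of one sample. -/
def noise (x : Vec (X.P.d 0)) (w : X.P.Params) : X.P.Params := X.P.lossGrad x w - ∇ X.P.risk w

lemma continuous_gradient_risk : Continuous (∇ X.P.risk) := by
  refine (LipschitzWith.of_dist_le_mul (K := K.Lℓ.toNNReal) fun w w' => ?_).continuous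
  rw [dist_eq_norm, dist_eq_norm, Real.coe_toNNReal _ K.Lℓ_nonneg]
  exact X.smooth.risk_grad_lip w w'

lemma norm_noise_le (x : Vec (X.P.d 0)) (w : X.P.Params) : ‖X.noise x w‖ ≤ 2 * K.c₃ E := by
  have h1 := Pipeline.norm_lossGrad_le X.smooth x w
  have h2 := Pipeline.norm_gradient_risk_le X.smooth X.unbiased w
  exact (norm_sub_le _ _).trans (by linarith)

lemma norm_noise_sub_le (x : Vec (X.P.d 0)) (w w' : X.P.Params) :
    ‖X.noise x w - X.noise x w'‖ ≤ (K.c₄ E + K.Lℓ) * ‖w - w'‖ := by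
  have h1 := Pipeline.norm_lossGrad_sub_le X.smooth x w w'
  have h2 := X.smooth.risk_grad_lip w w'
  have h3 : X.noise x w - X.noise x w' = (X.P.lossGrad x w - X.P.lossGrad x w')
    - (∇ X.P.risk w - ∇ X.P.risk w') := by unfold noise; abel
  rw [h3]
  exact (norm_sub_le _ _).trans (by linarith)

lemma measurable_noise {Ω' : Type*} [MeasurableSpace Ω'] {x : Ω' → Vec (X.P.d 0)}
    {w : Ω' → X.P.Params} (hx : Measurable x) (hw : Measurable w) :
    Measurable fun z => X.noise (x z) (w z) :=
  (measurable_lossGrad X.smooth hx hw).sub (X.continuous_gradient_risk.measurable.comp hw)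

lemma integral_noise (w : X.P.Params) : ∫ x, X.noise x w ∂X.P.D = 0 := by
  have h1 := X.unbiased.unbiased w
  have h2 := X.unbiased.grad_integrable w
  simp_rw [Pipeline.gradient_loss X.smooth] at h1 h2
  simp only [noise]
  rw [integral_sub h2 (integrable_const _), h1]
  simp

lemma integral_norm_noise_sq_le (w : X.P.Params) :
    ∫ x, ‖X.noise x w‖ ^ 2 ∂X.P.D ≤ X.σ ^ 2 := by
  have h1 := X.unbiased.variance w
  simp_rw [Pipeline.gradient_loss X.smooth] at h1
  have hm : Measurable fun x => ‖X.noise x w‖ ^ 2 :=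
    ((X.measurable_noise measurable_id measurable_const).norm).pow_const 2
  rw [integral_eq_lintegral_of_nonneg_ae (Filter.Eventually.of_forall fun _ => sq_nonneg _)
    hm.aestronglyMeasurable]
  exact ENNReal.toReal_le_of_le_ofReal (sq_nonneg _) h1

open Classical in
/-- Noise of the current sample at the weights at which it was drawn. -/
def frozenNoise : ℕ → X.Ω → X.P.Params
  | 0, _ => 0
  | n + 1, z => if X.fresh n z then X.noise (z n).1 (X.st n z).w else frozenNoise n z

/-- Exponential average of the frozen noise. -/
def avgNoise : ℕ → X.Ω → X.P.Params
  | 0, _ => 0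
  | n + 1, z => (1 - X.h.β₁) • avgNoise n z + X.h.β₁ • X.frozenNoise (n + 1) z

/-- This identity lets the difference between true and frozen noise be measured by the distance
between current and frozen weights. -/
lemma frozenNoise_succ (n : ℕ) (z : X.Ω) :
    X.frozenNoise (n + 1) z = X.noise (X.st (n + 1) z).x (X.frozenW (n + 1) z) := by
  classical
  induction n with
  | zero =>
    have h : X.fresh 0 z := Or.inl rfl
    rw [frozenNoise, frozenW, X.x_succ, if_pos h, if_pos h, if_pos h]
  | succ n ih =>
    rw [frozenNoise, frozenW, X.x_succ]
    split_ifs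
    · rfl
    · exact ih

lemma measurable_sampleNoise (n : ℕ) :
    Measurable fun z : X.Ω => X.noise (z n).1 (X.st n z).w :=
  X.measurable_noise (measurable_pi_apply n).fst (X.meas n).w

lemma measurable_frozenNoise (n : ℕ) : Measurable (X.frozenNoise n) := by
  classical
  induction n with
  | zero => exact measurable_const
  | succ n ih => exact Measurable.ite (X.measurableSet_fresh' n) (X.measurable_sampleNoise n) ih

lemma measurable_avgNoise (n : ℕ) : Measurable (X.avgNoise n) := by
  induction n with
  | zero => exact measurable_const
  | succ n ih => exact (ih.const_smul (1 - X.h.β₁)).add ((X.measurable_frozenNoise (n + 1)).const_smul X.h.β₁)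

lemma norm_frozenNoise_le (n : ℕ) (z : X.Ω) : ‖X.frozenNoise n z‖ ≤ 2 * K.c₃ E := by
  cases n with
  | zero => rw [frozenNoise, norm_zero]; linarith [K.one_le_c₃ E]
  | succ n => rw [frozenNoise_succ]; exact X.norm_noise_le _ _

lemma norm_avgNoise_le (n : ℕ) (z : X.Ω) : ‖X.avgNoise n z‖ ≤ 2 * K.c₃ E := by
  have hβ := X.β₁_mem
  induction n with
  | zero => rw [avgNoise, norm_zero]; linarith [K.one_le_c₃ E]
  | succ n ih =>
    rw [avgNoise]
    refine (norm_add_le _ _).trans ?_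
    rw [norm_smul, norm_smul, Real.norm_of_nonneg (by linarith [hβ.2]),
      Real.norm_of_nonneg hβ.1.le]
    have := X.norm_frozenNoise_le (n + 1) z
    calc (1 - X.h.β₁) * ‖X.avgNoise n z‖ + X.h.β₁ * ‖X.frozenNoise (n + 1) z‖
        ≤ (1 - X.h.β₁) * (2 * K.c₃ E) + X.h.β₁ * (2 * K.c₃ E) := by
          gcongr
          · linarith [hβ.2]
          · exact hβ.1.le
      _ = _ := by ring

lemma frozenNoise_update {k n : ℕ} (hkn : k ≤ n) (z : X.Ω) (r : Round X.P X.CF X.CB) :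
    X.frozenNoise k (Function.update z n r) = X.frozenNoise k z := by
  induction k with
  | zero => rfl
  | succ k ih =>
    have h1 := X.fresh_update hkn z r
    have h2 : X.st k (Function.update z n r) = X.st k z := run_update _ _ _ _ _ _ (by omega) _ _
    have h3 : Function.update z n r k = z k := Function.update_of_ne (by omega) _ _
    rw [frozenNoise, frozenNoise]
    by_cases hf : X.fresh k z
    · rw [if_pos hf, if_pos (h1.2 hf), h2, h3]
    · rw [if_neg hf, if_neg fun h => hf (h1.1 h), ih (by omega)]

lemma avgNoise_update {k n : ℕ} (hkn : k ≤ n) (z : X.Ω) (r : Round X.P X.CF X.CB) :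
    X.avgNoise k (Function.update z n r) = X.avgNoise k z := by
  induction k with
  | zero => rfl
  | succ k ih =>
    rw [avgNoise, avgNoise, ih (by omega), X.frozenNoise_update hkn]

lemma integrable_inner_noise {f g : X.Ω → X.P.Params} (hf : Measurable f) (hg : Measurable g)
    {A B : ℝ} (hA : ∀ z, ‖f z‖ ≤ A) (hB : ∀ z, ‖g z‖ ≤ B) :
    Integrable (fun z => inner ℝ (f z) (g z)) X.μ := by
  refine X.integrable_of_bound (hf.inner hg) (C := A * B) fun z => ?_
  exact (norm_inner_le_norm _ _).trans
    (mul_le_mul (hA z) (hB z) (norm_nonneg _) ((norm_nonneg _).trans (hA z)))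

lemma integrable_norm_sq {V : Type*} [NormedAddCommGroup V] [MeasurableSpace V] [BorelSpace V]
    {f : X.Ω → V} (hf : Measurable f) {A : ℝ} (hA : ∀ z, ‖f z‖ ≤ A) :
    Integrable (fun z => ‖f z‖ ^ 2) X.μ := by
  refine X.integrable_of_bound (hf.norm.pow_const 2) (C := A ^ 2) fun z => ?_
  rw [norm_pow, norm_norm]
  exact pow_le_pow_left₀ (norm_nonneg _) (hA z) 2

lemma integral_sampleNoise_sq_le (n : ℕ) :
    ∫ z, ‖X.noise (z n).1 (X.st n z).w‖ ^ 2 ∂X.μ ≤ X.σ ^ 2 := by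
  rw [integral_resample (X.measurePreserving_resample n)
    (X.integrable_norm_sq (X.measurable_sampleNoise n) fun z => X.norm_noise_le _ _)]
  simp only [sample_resample, st_resample]
  refine (integral_mono_of_nonneg (Filter.Eventually.of_forall fun z =>
    integral_nonneg fun _ => sq_nonneg _) (integrable_const (X.σ ^ 2))
    (Filter.Eventually.of_forall fun z => X.integral_norm_noise_sq_le _)).trans_eq ?_
  simp

lemma integral_frozenNoise_sq_le (n : ℕ) : ∫ z, ‖X.frozenNoise n z‖ ^ 2 ∂X.μ ≤ X.σ ^ 2 := by
  classical
  have hp := X.p_mem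
  induction n with
  | zero => simpa [frozenNoise] using sq_nonneg _
  | succ n ih =>
    by_cases hn : n = 0
    · subst hn
      refine le_trans (le_of_eq (integral_congr_ae (Filter.Eventually.of_forall fun z => ?_)))
        (X.integral_sampleNoise_sq_le 0)
      have h : X.fresh 0 z := Or.inl rfl
      dsimp only
      rw [frozenNoise, if_pos h]
    · have h1 : ∀ z, ‖X.frozenNoise (n + 1) z‖ ^ 2 = if X.fresh n z then
          ‖X.noise (z n).1 (X.st n z).w‖ ^ 2 else ‖X.frozenNoise n z‖ ^ 2 := by
        intro z
        rw [frozenNoise]; split_ifs <;> rfl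
      simp_rw [h1]
      rw [X.integral_ite_fresh hn
        (X.integrable_norm_sq (X.measurable_sampleNoise n) fun z => X.norm_noise_le _ _)
        (X.integrable_norm_sq (X.measurable_frozenNoise n) fun z => X.norm_frozenNoise_le _ _)
        (fun z c => by rw [sample_recoin, st_recoin])
        (fun z c => by rw [recoin, X.frozenNoise_update le_rfl])]
      have h2 := X.integral_sampleNoise_sq_le n
      have h3 := mul_le_mul_of_nonneg_left h2 hp.1.le
      have h4 := mul_le_mul_of_nonneg_left ih (by linarith [hp.2] : 0 ≤ 1 - X.h.p)
      linarith

/-- The average of the earlier noise and the current weights are determined before the candidate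
sample of round n, and given them the noise of this candidate has mean zero. -/
lemma integral_inner_sampleNoise (n : ℕ) :
    ∫ z, inner ℝ (X.avgNoise n z) (X.noise (z n).1 (X.st n z).w) ∂X.μ = 0 := by
  rw [integral_resample (X.measurePreserving_resample n)
    (X.integrable_inner_noise (X.measurable_avgNoise n) (X.measurable_sampleNoise n)
      (X.norm_avgNoise_le n) fun z => X.norm_noise_le _ _)]
  simp only [sample_resample, st_resample]
  rw [← integral_zero X.Ω ℝ (μ := X.μ)]
  refine integral_congr_ae (Filter.Eventually.of_forall fun z => ?_)
  have h1 : ∀ s, X.avgNoise n (X.resample n z s) = X.avgNoise n z := fun s =>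
    X.avgNoise_update le_rfl _ _
  simp only [h1]
  rw [integral_inner, integral_noise, inner_zero_right]
  exact Integrable.of_bound
    (X.measurable_noise measurable_id measurable_const).aestronglyMeasurable (2 * K.c₃ E)
    (Filter.Eventually.of_forall fun s => X.norm_noise_le _ _)

/-- If a sample is drawn, its noise is uncorrelated with the past; otherwise the noise is unchanged.
The correlation thus survives only with probability 1 − p. -/
lemma integral_inner_frozenNoise_succ (n : ℕ) :
    ∫ z, inner ℝ (X.avgNoise n z) (X.frozenNoise (n + 1) z) ∂X.μ
      = (1 - X.h.p) * ∫ z, inner ℝ (X.avgNoise n z) (X.frozenNoise n z) ∂X.μ := by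
  classical
  by_cases hn : n = 0
  · subst hn; simp [avgNoise]
  · have h1 : ∀ z, inner ℝ (X.avgNoise n z) (X.frozenNoise (n + 1) z) = if X.fresh n z then
        inner ℝ (X.avgNoise n z) (X.noise (z n).1 (X.st n z).w)
          else inner ℝ (X.avgNoise n z) (X.frozenNoise n z) := by
      intro z
      rw [frozenNoise]; split_ifs <;> rfl
    simp_rw [h1]
    rw [X.integral_ite_fresh hn
      (X.integrable_inner_noise (X.measurable_avgNoise n) (X.measurable_sampleNoise n)
        (X.norm_avgNoise_le n) fun z => X.norm_noise_le _ _)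
      (X.integrable_inner_noise (X.measurable_avgNoise n) (X.measurable_frozenNoise n)
        (X.norm_avgNoise_le n) (X.norm_frozenNoise_le n))
      (fun z c => by rw [sample_recoin, st_recoin, recoin, X.avgNoise_update le_rfl])
      (fun z c => by
        rw [recoin, X.frozenNoise_update le_rfl, X.avgNoise_update le_rfl]),
      X.integral_inner_sampleNoise, mul_zero, zero_add]

/-- With s = βσ²/p, the correlation c obeys c' ≤ (1 − p)s + βσ² = s, since ps = βσ². In the
expansion of the squared average the cross term is then at most 2βs, and β²σ² ≤ βs, so (1 − β)·3s +
3βs = 3s closes the induction. The two bounds are proved together because the second uses the first.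
-/
lemma integral_avgNoise_le (n : ℕ) :
    ∫ z, inner ℝ (X.avgNoise n z) (X.frozenNoise n z) ∂X.μ ≤ X.h.β₁ / X.h.p * X.σ ^ 2 ∧
      ∫ z, ‖X.avgNoise n z‖ ^ 2 ∂X.μ ≤ 3 * (X.h.β₁ / X.h.p * X.σ ^ 2) := by
  have hβ := X.β₁_mem
  have hp := X.p_mem
  set β := X.h.β₁
  set p := X.h.p
  set s := β / p * X.σ ^ 2 with hs
  have hp0 : 0 < p := hp.1
  have hs0 : 0 ≤ s := mul_nonneg (div_nonneg hβ.1.le hp0.le) (sq_nonneg _)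
  have hps : p * s = β * X.σ ^ 2 := by rw [hs]; field_simp
  have hβs : β * X.σ ^ 2 ≤ s := by rw [← hps]; nlinarith [hp.2]
  induction n with
  | zero => simp only [avgNoise, inner_zero_left, integral_zero, norm_zero]; norm_num; linarith
  | succ n ih =>
    obtain ⟨ih1, ih2⟩ := ih
    have hI := X.integral_inner_frozenNoise_succ n
    have hF := X.integral_frozenNoise_sq_le (n + 1)
    have i1 := X.integrable_inner_noise (X.measurable_avgNoise n)
      (X.measurable_frozenNoise (n + 1)) (X.norm_avgNoise_le n) (X.norm_frozenNoise_le (n + 1))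
    have i2 := X.integrable_norm_sq (X.measurable_frozenNoise (n + 1))
      (X.norm_frozenNoise_le (n + 1))
    have i3 := X.integrable_norm_sq (X.measurable_avgNoise n) (X.norm_avgNoise_le n)
    set I := ∫ z, inner ℝ (X.avgNoise n z) (X.frozenNoise (n + 1) z) ∂X.μ
    set F := ∫ z, ‖X.frozenNoise (n + 1) z‖ ^ 2 ∂X.μ
    have hIs : I ≤ (1 - p) * s := by
      rw [hI]; exact mul_le_mul_of_nonneg_left ih1 (by linarith [hp.2])
    have hIs' : I ≤ s := hIs.trans (by nlinarith)
    constructor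
    · have h1 : ∀ z, inner ℝ (X.avgNoise (n + 1) z) (X.frozenNoise (n + 1) z)
          = (1 - β) * inner ℝ (X.avgNoise n z) (X.frozenNoise (n + 1) z)
            + β * ‖X.frozenNoise (n + 1) z‖ ^ 2 := by
        intro z
        rw [avgNoise, inner_add_left, real_inner_smul_left, real_inner_smul_left,
          real_inner_self_eq_norm_sq]
      simp_rw [h1]
      rw [integral_add (i1.const_mul _) (i2.const_mul _), integral_const_mul, integral_const_mul]
      have h2 : (1 - β) * I ≤ (1 - p) * s := by
        calc (1 - β) * I ≤ (1 - β) * ((1 - p) * s) :=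
              mul_le_mul_of_nonneg_left hIs (by linarith [hβ.2])
          _ ≤ 1 * ((1 - p) * s) := by
              refine mul_le_mul_of_nonneg_right (by linarith [hβ.1]) ?_
              exact mul_nonneg (by linarith [hp.2]) hs0
          _ = _ := one_mul _
      have h3 := mul_le_mul_of_nonneg_left hF hβ.1.le
      linarith
    · have h1 : ∀ z, ‖X.avgNoise (n + 1) z‖ ^ 2 = (1 - β) ^ 2 * ‖X.avgNoise n z‖ ^ 2
            + (2 * (1 - β) * β * inner ℝ (X.avgNoise n z) (X.frozenNoise (n + 1) z)
            + β ^ 2 * ‖X.frozenNoise (n + 1) z‖ ^ 2) := by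
        intro z
        rw [avgNoise, norm_add_sq_real, real_inner_smul_left, real_inner_smul_right, norm_smul,
          norm_smul, mul_pow, mul_pow, Real.norm_eq_abs, Real.norm_eq_abs, sq_abs, sq_abs]
        ring
      have i4 : Integrable (fun z => 2 * (1 - β) * β * inner ℝ (X.avgNoise n z)
          (X.frozenNoise (n + 1) z) + β ^ 2 * ‖X.frozenNoise (n + 1) z‖ ^ 2) X.μ :=
        (i1.const_mul _).add (i2.const_mul _)
      simp_rw [h1]
      rw [integral_add (i3.const_mul _) i4,
        integral_add (i1.const_mul _) (i2.const_mul _), integral_const_mul, integral_const_mul,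
        integral_const_mul]
      have hβ0 := hβ.1
      have hβ1 := hβ.2
      have hV0 : 0 ≤ ∫ z, ‖X.avgNoise n z‖ ^ 2 ∂X.μ := integral_nonneg fun _ => sq_nonneg _
      have h2 : (1 - β) ^ 2 * ∫ z, ‖X.avgNoise n z‖ ^ 2 ∂X.μ ≤ (1 - β) * (3 * s) := by
        calc _ ≤ (1 - β) * ∫ z, ‖X.avgNoise n z‖ ^ 2 ∂X.μ :=
              mul_le_mul_of_nonneg_right (by nlinarith) hV0
          _ ≤ _ := mul_le_mul_of_nonneg_left ih2 (by linarith)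
      have h3 : 2 * (1 - β) * β * I ≤ 2 * β * s := by
        calc 2 * (1 - β) * β * I ≤ 2 * (1 - β) * β * s :=
              mul_le_mul_of_nonneg_left hIs'
                (mul_nonneg (by linarith) hβ0.le)
          _ ≤ 2 * β * s := mul_le_mul_of_nonneg_right (by nlinarith) hs0
      have h4 : β ^ 2 * F ≤ β * s := by
        calc β ^ 2 * F ≤ β ^ 2 * X.σ ^ 2 := by gcongr
          _ = β * (β * X.σ ^ 2) := by ring
          _ ≤ _ := mul_le_mul_of_nonneg_left hβs hβ0.le
      linarith

end Setting

/-! ### The residual of the averaged gradient estimate -/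

namespace Setting

variable {K : Constants} (X : Setting.{u} E K)

/-- Error of the averaged gradient estimate, without the averaged frozen noise. -/
def resid (n : ℕ) (z : X.Ω) : X.P.Params :=
  (X.st (n + 1) z).m - ∇ X.P.risk (X.st n z).w - X.avgNoise (n + 1) z

/-- `L²` norm of the change of the noise since the last new sample. -/
def lagNoise (n : ℕ) : ENNReal :=
  eLpNorm (fun z => X.noise (X.st (n + 1) z).x (X.st n z).w - X.frozenNoise (n + 1) z) 2 X.μ

lemma measurable_gradient_risk (n : ℕ) : Measurable fun z => ∇ X.P.risk (X.st n z).w :=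
  X.continuous_gradient_risk.measurable.comp (X.meas n).w

lemma measurable_resid (n : ℕ) : Measurable (X.resid n) :=
  ((X.meas _).m.sub (X.measurable_gradient_risk n)).sub (X.measurable_avgNoise _)

lemma ae_sample (n : ℕ) {q : Vec (X.P.d 0) → Prop} (h : ∀ᵐ x ∂X.P.D, q x) :
    ∀ᵐ z ∂X.μ, q (X.st (n + 1) z).x := by
  have hx := (X.meas (n + 1)).x
  have h1 : X.μ.map (fun z => (X.st (n + 1) z).x) = X.P.D :=
    Measure.ext_of_lintegral _ fun f hf => by
      rw [lintegral_map hf hx]; exact X.lintegral_sample n hf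
  rw [← h1] at h
  exact ae_of_ae_map hx.aemeasurable h

/-- The Lipschitz constant Λ is kept free: it is `c₄` + Lℓ in general and 0 if σ = 0. The weights
depend on the sample, so one null set must serve all pairs of weights. -/
lemma lagNoise_le {Λ : ℝ} (hΛ : 0 ≤ Λ)
    (h : ∀ᵐ x ∂X.P.D, ∀ w w', ‖X.noise x w - X.noise x w'‖ ≤ Λ * ‖w - w'‖) (n : ℕ) :
    X.lagNoise n ≤ ENNReal.ofReal Λ * X.lag n := by
  rw [lag, ← eLpNorm_const_mul_norm hΛ]
  refine eLpNorm_mono_ae_real ?_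
  filter_upwards [X.ae_sample n h] with z hz
  rw [frozenNoise_succ]
  exact hz _ _

/-- The first moment starts at zero, which leaves the bias −(1 − β)∇ℓ. It is bounded by `c₃` and
will be part of the transient. -/
lemma resid_zero_le : eLpNorm (X.resid 0) 2 X.μ
    ≤ ENNReal.ofReal X.h.β₁ * X.errG 0 + ENNReal.ofReal (K.c₃ E) := by
  have hβ := X.β₁_mem
  have hc := K.one_le_c₃ E
  have h1 := eLpNorm_le_add (μ := X.μ) (f := X.resid 0)
    (g := fun z => (X.st (0 + 1) z).g - X.P.lossGrad (X.st (0 + 1) z).x (X.st 0 z).w)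
    (g' := fun _ => K.c₃ E)
    ((X.meas _).g.sub (measurable_lossGrad X.smooth (X.meas _).x (X.meas _).w)).aestronglyMeasurable
    aestronglyMeasurable_const hβ.1.le zero_le_one (fun z => ?_)
  · refine h1.trans (add_le_add_right ?_ _)
    rw [ENNReal.ofReal_one, one_mul, eLpNorm_const _ two_ne_zero (NeZero.ne _), measure_univ,
      ENNReal.one_rpow, mul_one, Real.enorm_of_nonneg (by linarith)]
  · have h2 : X.resid 0 z
        = X.h.β₁ • ((X.st (0 + 1) z).g - X.P.lossGrad (X.st (0 + 1) z).x (X.st 0 z).w)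
          - (1 - X.h.β₁) • ∇ X.P.risk (X.st 0 z).w := by
      have h3 : (X.st (0 + 1) z).m = (1 - X.h.β₁) • (0 : X.P.Params)
        + X.h.β₁ • (X.st (0 + 1) z).g := rfl
      have h4 : X.frozenW (0 + 1) z = (X.st 0 z).w := if_pos (Or.inl rfl)
      rw [resid, h3, avgNoise, frozenNoise_succ, h4, noise, avgNoise]
      module
    rw [h2, one_mul, Real.norm_of_nonneg (by linarith : 0 ≤ K.c₃ E)]
    refine (norm_sub_le _ _).trans ?_
    rw [norm_smul, norm_smul, Real.norm_of_nonneg hβ.1.le,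
      Real.norm_of_nonneg (by linarith [hβ.2])]
    have h5 := Pipeline.norm_gradient_risk_le X.smooth X.unbiased (X.st 0 z).w
    have h6 := norm_nonneg (∇ X.P.risk (X.st 0 z).w)
    nlinarith [hβ.1]

/-- Subtracting the averaged frozen noise, which obeys the same averaging recursion, leaves three
forcing terms: drift of ∇ℓ, and with weight β the compression error and the ageing of the noise. -/
lemma resid_succ_le (n : ℕ) : eLpNorm (X.resid (n + 1)) 2 X.μ
    ≤ ENNReal.ofReal (1 - X.h.β₁) * eLpNorm (X.resid n) 2 X.μ
      + (ENNReal.ofReal K.Lℓ * X.dw (n + 1)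
        + (ENNReal.ofReal X.h.β₁ * X.errG (n + 1)
          + ENNReal.ofReal X.h.β₁ * X.lagNoise (n + 1))) := by
  have hβ := X.β₁_mem
  set A : X.Ω → X.P.Params := fun z =>
    (X.st (n + 1 + 1) z).g - X.P.lossGrad (X.st (n + 1 + 1) z).x (X.st (n + 1) z).w with hA
  set B : X.Ω → X.P.Params := fun z =>
    X.noise (X.st (n + 1 + 1) z).x (X.st (n + 1) z).w - X.frozenNoise (n + 1 + 1) z with hB
  have hAm : AEStronglyMeasurable A X.μ := ((X.meas _).g.sub
    (measurable_lossGrad X.smooth (X.meas _).x (X.meas _).w)).aestronglyMeasurable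
  have hBm : AEStronglyMeasurable B X.μ := ((X.measurable_noise (X.meas _).x (X.meas _).w).sub
    (X.measurable_frozenNoise _)).aestronglyMeasurable
  have hG : ∀ z, ‖X.h.β₁ * ‖A z‖ + X.h.β₁ * ‖B z‖‖ = X.h.β₁ * ‖A z‖ + X.h.β₁ * ‖B z‖ := fun z =>
    Real.norm_of_nonneg (by have := hβ.1; positivity)
  have h1 := eLpNorm_le_add_three (μ := X.μ) (f := X.resid (n + 1)) (g₁ := X.resid n)
    (g₂ := fun z => (X.st (n + 1) z).w - (X.st n z).w)
    (g₃ := fun z => X.h.β₁ * ‖A z‖ + X.h.β₁ * ‖B z‖)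
    (X.measurable_resid n).aestronglyMeasurable
    ((X.meas _).w.sub (X.meas _).w).aestronglyMeasurable
    ((hAm.norm.const_mul _).add (hBm.norm.const_mul _))
    (by linarith [hβ.2] : 0 ≤ 1 - X.h.β₁) K.Lℓ_nonneg zero_le_one (fun z => ?_)
  · refine h1.trans (add_le_add_right (add_le_add_right ?_ _) _)
    rw [ENNReal.ofReal_one, one_mul]
    exact eLpNorm_le_add hAm hBm hβ.1.le hβ.1.le fun z => (hG z).le
  · have h2 : X.resid (n + 1) z = (1 - X.h.β₁) • X.resid n z
        - (1 - X.h.β₁) • (∇ X.P.risk (X.st (n + 1) z).w - ∇ X.P.risk (X.st n z).w)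
        + (X.h.β₁ • A z + X.h.β₁ • B z) := by
      have h3 : (X.st (n + 1 + 1) z).m = (1 - X.h.β₁) • (X.st (n + 1) z).m
        + X.h.β₁ • (X.st (n + 1 + 1) z).g := rfl
      have h4 : X.avgNoise (n + 1 + 1) z = (1 - X.h.β₁) • X.avgNoise (n + 1) z
        + X.h.β₁ • X.frozenNoise (n + 1 + 1) z := rfl
      rw [resid, h3, h4, resid, hA, hB]
      simp only [noise]
      module
    rw [h2, hG, one_mul]
    have h5 := X.smooth.risk_grad_lip (X.st (n + 1) z).w (X.st n z).w
    have h6 : ‖(1 - X.h.β₁) • (∇ X.P.risk (X.st (n + 1) z).w - ∇ X.P.risk (X.st n z).w)‖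
        ≤ K.Lℓ * ‖(X.st (n + 1) z).w - (X.st n z).w‖ := by
      rw [norm_smul, Real.norm_of_nonneg (by linarith [hβ.2])]
      refine le_trans (mul_le_of_le_one_left (norm_nonneg _) (by linarith [hβ.1])) h5
    have h7 : ‖X.h.β₁ • A z + X.h.β₁ • B z‖ ≤ X.h.β₁ * ‖A z‖ + X.h.β₁ * ‖B z‖ := by
      refine (norm_add_le _ _).trans_eq ?_
      rw [norm_smul, norm_smul, Real.norm_of_nonneg hβ.1.le]
    have h8 : ‖(1 - X.h.β₁) • X.resid n z‖ = (1 - X.h.β₁) * ‖X.resid n z‖ := by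
      rw [norm_smul, Real.norm_of_nonneg (by linarith [hβ.2])]
    refine (norm_add_le _ _).trans ((add_le_add_left (norm_sub_le _ _) _).trans ?_)
    linarith

lemma sum_resid_sq_le {T : ℕ} {D Λ : ℝ} (hD : 0 ≤ D) (hΛ : 0 ≤ Λ)
    (h : ∀ᵐ x ∂X.P.D, ∀ w w', ‖X.noise x w - X.noise x w'‖ ≤ Λ * ‖w - w'‖)
    (hdw : ∑ n ∈ Finset.range T, X.dw n ^ 2 ≤ ENNReal.ofReal (D ^ 2)) :
    ∑ n ∈ Finset.range T, eLpNorm (X.resid n) 2 X.μ ^ 2 ≤ ENNReal.ofReal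
      (2 * ((K.c₅ E / X.θ * Real.sqrt (D ^ 2 + T * X.jump ^ 2)
        + (K.Lℓ / X.h.β₁ + Λ * (2 / X.h.p)) * D) ^ 2
        + X.h.β₁ * (K.c₅ E / X.θ + K.c₃ E / X.h.β₁) ^ 2)) := by
  have hβ := X.β₁_mem
  have hp := X.p_mem
  set β := X.h.β₁
  set p := X.h.p
  have hβ0 : 0 < β := hβ.1
  have hp0 : 0 < p := hp.1
  -- The pipeline is forced by the weight changes and by the sample changes. The gradient drift and
  -- the age of the sample see the weight changes only, hence the second scale D.
  set U := Real.sqrt (D ^ 2 + T * X.jump ^ 2) with hU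
  have hU0 : 0 ≤ U := Real.sqrt_nonneg _
  have hU2 : U ^ 2 = D ^ 2 + T * X.jump ^ 2 := Real.sq_sqrt (by positivity)
  have hd : Ctrl T U 1 1 X.dw := by
    refine Ctrl.of_sum_sq (hdw.trans (ENNReal.ofReal_le_ofReal ?_)) (by norm_num)
    rw [one_mul, hU2]
    have : 0 ≤ (T : ℝ) * X.jump ^ 2 := by positivity
    linarith
  have hj : Ctrl T U 1 1 (X.dy 0) := by
    refine Ctrl.of_sum_sq ?_ (by norm_num)
    calc ∑ n ∈ Finset.range T, X.dy 0 n ^ 2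
        ≤ ∑ n ∈ Finset.range T, ENNReal.ofReal (X.jump ^ 2) := by
          refine Finset.sum_le_sum fun n _ => ?_
          rw [ENNReal.ofReal_pow X.jump_nonneg]
          gcongr
          exact X.dy_zero_le n
      _ = ENNReal.ofReal (T * X.jump ^ 2) := by
          rw [Finset.sum_const, Finset.card_range, nsmul_eq_mul,
            ENNReal.ofReal_mul (Nat.cast_nonneg _), ENNReal.ofReal_natCast]
      _ ≤ _ := ENNReal.ofReal_le_ofReal (by rw [one_mul, hU2]; linarith [sq_nonneg D])
  have hd' : Ctrl T D 0 1 X.dw := Ctrl.of_sum_sq (by rwa [one_mul]) (by norm_num)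
  obtain ⟨p₁, q₁, hp₁, hq₁, hpq₁, hs₁, hS₁⟩ := X.ctrl_errG hU0 hd hj
  obtain ⟨p₂, q₂, hp₂, hq₂, hpq₂, hs₂, hS₂⟩ := hd'
  obtain ⟨p₃, q₃, hp₃, hq₃, hpq₃, hs₃, hS₃⟩ := X.ctrl_lag (Ctrl.of_sum_sq (by rwa [one_mul])
    (by norm_num) : Ctrl T D 0 1 X.dw)
  set L := K.Lℓ with hL
  have hL0 : 0 ≤ L := K.Lℓ_nonneg
  have hc3 : 0 ≤ K.c₃ E := by linarith [K.one_le_c₃ E]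
  -- The averaging lemma expects forcing of the form β(P + Q), so the terms without a factor β are
  -- divided by it; this is the origin of L/β and, for the initial bias, of `c₃`/β.
  set P : ℕ → ℝ := fun n => p₁ n + (L / β * p₂ n + Λ * p₃ n) with hP
  set Q : ℕ → ℝ := fun n => q₁ n + (L / β * q₂ n + Λ * q₃ n)
    + if n = 0 then K.c₃ E / β else 0 with hQ
  have hP0 : ∀ n, 0 ≤ P n := fun n => by
    have := hp₁ n; have := hp₂ n; have := hp₃ n
    positivity
  have hQ0 : ∀ n, 0 ≤ Q n := fun n => by
    have := hq₁ n; have := hq₂ n; have := hq₃ n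
    simp only [hQ]
    split_ifs <;> positivity
  have e1 : ∀ n < T, ENNReal.ofReal β * X.errG n ≤ ENNReal.ofReal (β * (p₁ n + q₁ n)) := by
    intro n hn
    rw [ENNReal.ofReal_mul hβ0.le]
    gcongr
    exact hpq₁ n hn
  have key := sum_sq_averaging_le (T := T) (a := fun n => eLpNorm (X.resid n) 2 X.μ) hβ0 hβ.2.le
    hP0 hQ0 (fun hT => ?_) (fun n hn => ?_)
  · refine key.trans (ENNReal.ofReal_le_ofReal ?_)
    have hα0 : 0 ≤ K.c₅ E / X.θ := by
      refine div_nonneg ?_ X.θ_pos.le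
      unfold Constants.c₅
      have h0 := K.one_le_c₀
      have h1 := K.one_le_c₁ E
      have h2 := K.one_le_c₂ E
      positivity
    have hs₂' : ∑ n ∈ Finset.range T, (L / β * p₂ n) ^ 2 ≤ (L / β * D) ^ 2 := by
      simp_rw [mul_pow]
      rw [← Finset.mul_sum]
      rw [one_mul] at hs₂
      gcongr
    have hs₃' : ∑ n ∈ Finset.range T, (Λ * p₃ n) ^ 2 ≤ (Λ * (2 / p) * D) ^ 2 := by
      simp_rw [mul_pow Λ]
      rw [← Finset.mul_sum, mul_assoc, mul_pow]
      gcongr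
    have h1 : ∑ n ∈ Finset.range T, P n ^ 2
        ≤ (K.c₅ E / X.θ * U + (L / β + Λ * (2 / p)) * D) ^ 2 := by
      have := sum_add_sq_le (by positivity) (by positivity) hs₁
        (sum_add_sq_le (by positivity) (by positivity) hs₂' hs₃')
      rw [add_mul]
      exact this
    have h2 : ∑ n ∈ Finset.range T, Q n ≤ K.c₅ E / X.θ + K.c₃ E / β := by
      simp only [hQ]
      rw [Finset.sum_add_distrib, Finset.sum_add_distrib, Finset.sum_add_distrib, ← Finset.mul_sum,
        ← Finset.mul_sum]
      rw [mul_zero] at hS₂ hS₃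
      rw [mul_one] at hS₁
      have h3 : (∑ n ∈ Finset.range T, if n = 0 then K.c₃ E / β else 0) ≤ K.c₃ E / β := by
        rw [Finset.sum_ite_eq']
        split_ifs
        · exact le_rfl
        · positivity
      have h4 := mul_nonpos_of_nonneg_of_nonpos (by positivity : 0 ≤ L / β) hS₂
      have h5 := mul_nonpos_of_nonneg_of_nonpos hΛ hS₃
      linarith
    have h3 : 0 ≤ ∑ n ∈ Finset.range T, Q n := Finset.sum_nonneg fun n _ => hQ0 n
    gcongr
  · refine X.resid_zero_le.trans ((add_le_add_left (e1 0 hT) _).trans ?_)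
    rw [← ENNReal.ofReal_add (mul_nonneg hβ0.le (add_nonneg (hp₁ 0) (hq₁ 0))) hc3]
    refine ENNReal.ofReal_le_ofReal ?_
    have h2 : β * (K.c₃ E / β) = K.c₃ E := by field_simp
    have h3 : 0 ≤ β * (L / β * p₂ 0 + Λ * p₃ 0) := by
      have := hp₂ 0; have := hp₃ 0; positivity
    have h4 : 0 ≤ β * (L / β * q₂ 0 + Λ * q₃ 0) := by
      have := hq₂ 0; have := hq₃ 0; positivity
    simp only [hP, hQ, if_true]
    nlinarith
  · refine (X.resid_succ_le n).trans (add_le_add_right ?_ _)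
    have e2 : ENNReal.ofReal K.Lℓ * X.dw (n + 1)
        ≤ ENNReal.ofReal (L * (p₂ (n + 1) + q₂ (n + 1))) := by
      rw [ENNReal.ofReal_mul hL0]
      gcongr
      exact hpq₂ _ hn
    have e3 : ENNReal.ofReal β * X.lagNoise (n + 1)
        ≤ ENNReal.ofReal (β * (Λ * (p₃ (n + 1) + q₃ (n + 1)))) := by
      rw [ENNReal.ofReal_mul hβ0.le, ENNReal.ofReal_mul hΛ]
      gcongr
      refine (X.lagNoise_le hΛ h _).trans ?_
      gcongr
      exact hpq₃ _ hn
    refine (add_le_add e2 (add_le_add (e1 _ hn) e3)).trans_eq ?_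
    have n1 := add_nonneg (hp₁ (n + 1)) (hq₁ (n + 1))
    have n2 := add_nonneg (hp₂ (n + 1)) (hq₂ (n + 1))
    have n3 := add_nonneg (hp₃ (n + 1)) (hq₃ (n + 1))
    rw [← ENNReal.ofReal_add (by positivity) (by positivity),
      ← ENNReal.ofReal_add (by positivity) (by positivity)]
    congr 1
    simp only [hP, hQ, Nat.add_eq_zero_iff, one_ne_zero, and_false, if_false]
    field_simp
    ring

end Setting

/-! ### Descent with the preconditioner of Adam -/

lemma Pipeline.norm_params_sq {P : Pipeline E} (v : P.Params) : ‖v‖ ^ 2 = ∑ e, ∑ j, v e j ^ 2 := by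
  rw [PiLp.norm_sq_eq_of_L2]
  exact Finset.sum_congr rfl fun e _ => EuclideanSpace.real_norm_sq_eq _

lemma Pipeline.inner_params {P : Pipeline E} (v v' : P.Params) :
    inner ℝ v v' = ∑ e, ∑ j, v e j * v' e j := by
  rw [PiLp.inner_apply]
  refine Finset.sum_congr rfl fun e _ => ?_
  rw [PiLp.inner_apply]
  exact Finset.sum_congr rfl fun j _ => mul_comm _ _

namespace Constants

variable (K : Constants)

/-- Lower bound of the preconditioner of Adam. -/
def precondLo : ℝ := 1 / Real.sqrt (K.M₁ ^ 2 + K.ε)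

/-- Upper bound of the preconditioner of Adam. -/
def precondUp : ℝ := 1 / Real.sqrt K.ε

lemma precondLo_pos : 0 < K.precondLo := by
  have := K.ε_pos
  unfold precondLo
  positivity

lemma precondUp_pos : 0 < K.precondUp := by
  have := K.ε_pos
  unfold precondUp
  positivity

/-- Ratio of the step size to the momentum parameter. -/
def ratio (E : ℕ) : ℝ :=
  min 1 (K.precondLo / (4 * (1 + K.Lℓ * K.precondUp ^ 2
    + 4 * K.precondUp ^ 3 * (K.c₅ E ^ 2 + (K.Lℓ + 2 * (K.c₄ E + K.Lℓ)) ^ 2))))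

/-- Constant of the bound of the average squared gradient. -/
def rateConst (E : ℕ) : ℝ :=
  2 / K.precondLo * (K.Δ / K.ratio E + 3 * K.precondUp + 4 * K.precondUp * K.c₅ E ^ 2
    + 2 * K.precondUp * (K.c₅ E + K.c₃ E) ^ 2)

lemma c₅_nonneg (E : ℕ) : 0 ≤ K.c₅ E := by
  have h0 := K.one_le_c₀
  have h1 := K.one_le_c₁ E
  have h2 := K.one_le_c₂ E
  have h3 := K.one_le_c₃ E
  have h4 := K.one_le_c₄ E
  unfold c₅
  positivity

lemma ratio_pos (E : ℕ) : 0 < K.ratio E := by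
  have h1 := K.precondLo_pos
  have h2 := K.precondUp_pos
  have h3 := K.Lℓ_nonneg
  exact lt_min one_pos (by positivity)

lemma rateConst_nonneg (E : ℕ) : 0 ≤ K.rateConst E := by
  have h1 := K.precondLo_pos
  have h2 := K.precondUp_pos
  have h3 := K.Δ_nonneg
  have h4 := K.ratio_pos E
  unfold rateConst
  positivity

/-- The first condition makes the quadratic term of the descent inequality harmless. The second
absorbs the feedback of the weight changes through the residual. Since the ratio is at most 1, its
square is bounded by itself. -/
lemma ratio_mul_le (E : ℕ) :
    K.Lℓ * K.ratio E * K.precondUp ^ 2 ≤ K.precondLo / 4 ∧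
    4 * K.precondUp ^ 3 * (K.c₅ E ^ 2 + (K.Lℓ + 2 * (K.c₄ E + K.Lℓ)) ^ 2) * K.ratio E ^ 2
      ≤ K.precondLo / 4 := by
  have h1 := K.precondLo_pos
  have h2 := K.precondUp_pos
  have h3 := K.Lℓ_nonneg
  have h4 := K.ratio_pos E
  set Q := 4 * K.precondUp ^ 3 * (K.c₅ E ^ 2 + (K.Lℓ + 2 * (K.c₄ E + K.Lℓ)) ^ 2) with hQ
  have hQ0 : 0 ≤ Q := by positivity
  have hL0 : 0 ≤ K.Lℓ * K.precondUp ^ 2 := by positivity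
  have h5 : K.ratio E ≤ 1 := min_le_left _ _
  have h6 : K.ratio E * (4 * (1 + K.Lℓ * K.precondUp ^ 2 + Q)) ≤ K.precondLo :=
    (le_div_iff₀ (by positivity)).1 (min_le_right _ _)
  have h7 := mul_nonneg h4.le hQ0
  have h8 := mul_nonneg h4.le hL0
  constructor
  · linarith
  · have h9 : Q * K.ratio E ^ 2 ≤ K.ratio E * Q := by
      rw [sq]; nlinarith
    linarith

end Constants

/-- Polarization: −2ab = (b − a)² − a² − b². After multiplication by h/2, the negative squares are
bounded with the lower bound of h and the positive one with the upper bound, so the dependence of h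
on a and b does not matter. -/
lemma adam_coordinate {lo up h a b : ℝ} (hlo : lo ≤ h) (hup : h ≤ up) :
    -(a * (h * b)) ≤ -(lo / 2) * a ^ 2 - lo / 2 * b ^ 2 + up / 2 * (b - a) ^ 2 := by
  nlinarith [mul_nonneg (sub_nonneg.2 hlo) (add_nonneg (sq_nonneg a) (sq_nonneg b)),
    mul_nonneg (sub_nonneg.2 hup) (sq_nonneg (b - a))]

namespace Setting

variable {K : Constants} (X : Setting.{u} E K)

lemma w_succ (n : ℕ) (z : X.Ω) (e : Fin E) (j : Fin (X.P.dw e)) :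
    (X.st (n + 1) z).w e j = (X.st n z).w e j
      - X.h.γ * ((X.st (n + 1) z).m e j / Real.sqrt ((X.st (n + 1) z).s e j + X.h.ε)) := rfl

lemma moments_le {T : ℕ} {z : X.Ω} (hz : ∀ t < T, ∀ e, ‖(X.st (t + 1) z).g e‖ ≤ K.M₁) :
    ∀ t ≤ T, (∀ e, ‖(X.st t z).m e‖ ≤ K.M₁)
      ∧ ∀ e j, 0 ≤ (X.st t z).s e j ∧ (X.st t z).s e j ≤ K.M₁ ^ 2 := by
  have hβ := X.β₁_mem
  have hβ' := X.β₂_mem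
  intro t
  induction t with
  | zero =>
    intro _
    refine ⟨fun e => ?_, fun e j => ⟨le_rfl, sq_nonneg K.M₁⟩⟩
    change ‖(0 : Vec _)‖ ≤ _
    rw [norm_zero]
    exact K.M₁_nonneg
  | succ t ih =>
    intro ht
    obtain ⟨ihm, ihs⟩ := ih (by omega)
    have hg := hz t (by omega)
    refine ⟨fun e => ?_, fun e j => ?_⟩
    · have h1 : (X.st (t + 1) z).m e
        = (1 - X.h.β₁) • (X.st t z).m e + X.h.β₁ • (X.st (t + 1) z).g e := rfl
      rw [h1]
      refine (norm_add_le _ _).trans ?_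
      rw [norm_smul, norm_smul, Real.norm_of_nonneg hβ.1.le,
        Real.norm_of_nonneg (by linarith [hβ.2])]
      nlinarith [ihm e, hg e, hβ.1, hβ.2]
    · have h1 : (X.st (t + 1) z).s e j
        = (1 - X.h.β₂) * (X.st t z).s e j + X.h.β₂ * (X.st (t + 1) z).g e j ^ 2 := rfl
      have h2 : (X.st (t + 1) z).g e j ^ 2 ≤ K.M₁ ^ 2 := by
        rw [sq_le_sq, abs_of_nonneg K.M₁_nonneg]
        exact (PiLp.norm_apply_le ((X.st (t + 1) z).g e) j).trans (hg e)
      obtain ⟨h3, h4⟩ := ihs e j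
      rw [h1]
      have h5 := sq_nonneg ((X.st (t + 1) z).g e j)
      constructor
      · have := mul_nonneg (by linarith [hβ'.2] : 0 ≤ 1 - X.h.β₂) h3
        have := mul_nonneg hβ'.1.le h5
        linarith
      · nlinarith [hβ'.1, hβ'.2]

/-- The only properties of the second moments that are used. The bounds do not involve β₂, so the
final constants are uniform in it. -/
lemma precond_mem {s : ℝ} (h0 : 0 ≤ s) (h1 : s ≤ K.M₁ ^ 2) :
    K.precondLo ≤ 1 / Real.sqrt (s + X.h.ε) ∧ 1 / Real.sqrt (s + X.h.ε) ≤ K.precondUp := by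
  have hε := K.ε_pos
  rw [X.ε_eq]
  have h2 : 0 < Real.sqrt (s + K.ε) := Real.sqrt_pos.2 (by linarith)
  exact ⟨one_div_le_one_div_of_le h2 (Real.sqrt_le_sqrt (by linarith)),
    one_div_le_one_div_of_le (Real.sqrt_pos.2 hε) (Real.sqrt_le_sqrt (by linarith))⟩

lemma norm_update_sq_le {n : ℕ} {z : X.Ω}
    (hs : ∀ e j, 0 ≤ (X.st (n + 1) z).s e j ∧ (X.st (n + 1) z).s e j ≤ K.M₁ ^ 2) :
    ‖(X.st (n + 1) z).w - (X.st n z).w‖ ^ 2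
      ≤ X.h.γ ^ 2 * K.precondUp ^ 2 * ‖(X.st (n + 1) z).m‖ ^ 2 := by
  rw [Pipeline.norm_params_sq, Pipeline.norm_params_sq, Finset.mul_sum]
  refine Finset.sum_le_sum fun e _ => ?_
  rw [Finset.mul_sum]
  refine Finset.sum_le_sum fun j _ => ?_
  obtain ⟨h1, h2⟩ := X.precond_mem (hs e j).1 (hs e j).2
  have h3 : ((X.st (n + 1) z).w - (X.st n z).w) e j
      = -(X.h.γ * (1 / Real.sqrt ((X.st (n + 1) z).s e j + X.h.ε)) * (X.st (n + 1) z).m e j) := by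
    rw [PiLp.sub_apply, PiLp.sub_apply, w_succ]
    ring
  rw [h3, neg_sq, mul_pow, mul_pow]
  have h4 := K.precondLo_pos.le.trans h1
  gcongr

lemma inner_update_le {n : ℕ} {z : X.Ω}
    (hs : ∀ e j, 0 ≤ (X.st (n + 1) z).s e j ∧ (X.st (n + 1) z).s e j ≤ K.M₁ ^ 2) (a : X.P.Params) :
    inner ℝ a ((X.st (n + 1) z).w - (X.st n z).w)
      ≤ X.h.γ * (-(K.precondLo / 2) * ‖a‖ ^ 2 - K.precondLo / 2 * ‖(X.st (n + 1) z).m‖ ^ 2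
        + K.precondUp / 2 * ‖(X.st (n + 1) z).m - a‖ ^ 2) := by
  rw [Pipeline.inner_params, Pipeline.norm_params_sq, Pipeline.norm_params_sq,
    Pipeline.norm_params_sq, Finset.mul_sum, Finset.mul_sum, Finset.mul_sum,
    ← Finset.sum_sub_distrib, ← Finset.sum_add_distrib, Finset.mul_sum]
  refine Finset.sum_le_sum fun e _ => ?_
  rw [Finset.mul_sum, Finset.mul_sum, Finset.mul_sum,
    ← Finset.sum_sub_distrib, ← Finset.sum_add_distrib, Finset.mul_sum]
  refine Finset.sum_le_sum fun j _ => ?_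
  obtain ⟨h1, h2⟩ := X.precond_mem (hs e j).1 (hs e j).2
  have h3 : a e j * ((X.st (n + 1) z).w - (X.st n z).w) e j = X.h.γ *
      -(a e j * (1 / Real.sqrt ((X.st (n + 1) z).s e j + X.h.ε) * (X.st (n + 1) z).m e j)) := by
    rw [PiLp.sub_apply, PiLp.sub_apply, w_succ]
    ring
  rw [h3]
  exact mul_le_mul_of_nonneg_left (adam_coordinate h1 h2) X.γ_pos.le

/-- Of the gain `precondLo`/2 in ‖m‖², one half pays for the quadratic term of the smoothness
inequality. The other half is kept to absorb the weight changes in the residual. -/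
lemma sum_descent_le {T : ℕ} {z : X.Ω} (hz : ∀ t < T, ∀ e, ‖(X.st (t + 1) z).g e‖ ≤ K.M₁)
    (hγ : K.Lℓ * X.h.γ * K.precondUp ^ 2 ≤ K.precondLo / 4) :
    ∑ t ∈ Finset.range T, (K.precondLo / 2 * ‖∇ X.P.risk (X.st t z).w‖ ^ 2
        + K.precondLo / 4 * ‖(X.st (t + 1) z).m‖ ^ 2)
      ≤ K.Δ / X.h.γ + K.precondUp / 2 * ∑ t ∈ Finset.range T,
        ‖(X.st (t + 1) z).m - ∇ X.P.risk (X.st t z).w‖ ^ 2 := by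
  have hγ0 := X.γ_pos
  have key : ∀ t ∈ Finset.range T, X.h.γ * (K.precondLo / 2 * ‖∇ X.P.risk (X.st t z).w‖ ^ 2
        + K.precondLo / 4 * ‖(X.st (t + 1) z).m‖ ^ 2)
      ≤ (X.P.risk (X.st t z).w - X.P.risk (X.st (t + 1) z).w)
        + X.h.γ * (K.precondUp / 2 * ‖(X.st (t + 1) z).m - ∇ X.P.risk (X.st t z).w‖ ^ 2) := by
    intro t ht
    have hs := (X.moments_le hz (t + 1) (by simpa using ht)).2
    have h1 := Pipeline.risk_descent X.smooth (X.st t z).w (X.st (t + 1) z).w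
    have h2 := X.inner_update_le hs (∇ X.P.risk (X.st t z).w)
    have h3 := mul_le_mul_of_nonneg_left (X.norm_update_sq_le hs) K.Lℓ_nonneg
    have h4 := mul_le_mul_of_nonneg_left hγ
      (mul_nonneg hγ0.le (sq_nonneg ‖(X.st (t + 1) z).m‖))
    nlinarith
  have h1 := Finset.sum_le_sum key
  rw [← Finset.mul_sum] at h1
  rw [Finset.sum_add_distrib (s := Finset.range T) (f := fun t => X.P.risk (X.st t z).w
    - X.P.risk (X.st (t + 1) z).w), Finset.sum_range_sub', ← Finset.mul_sum, ← Finset.mul_sum] at h1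
  have h2 : X.P.risk (X.st 0 z).w - X.P.risk (X.st T z).w ≤ K.Δ := X.init.gap _
  rw [← mul_le_mul_iff_right₀ hγ0, mul_add, mul_div_cancel₀ _ hγ0.ne']
  linarith

end Setting

/-- The final computation in the bound of the average squared gradient: `G` and `M` are the sums of
the squared gradients and momenta, `R` is the sum of the squared residuals. -/
lemma descent_arith {T β p c lo up c₃ c₅ c₆ L Λ θ M G R D J Δ s γ : ℝ} (hT : 0 < T) (hβ : 0 < β)
    (hp : 0 < p) (hlo : 0 < lo) (hup : 0 < up) (hc : 0 < c) (hθ : 0 < θ) (hM : 0 ≤ M) (hL : 0 ≤ L)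
    (hΛ : 0 ≤ Λ) (hc₃ : 0 ≤ c₃) (hc₅ : 0 ≤ c₅) (hJ : 0 ≤ J) (hD : 0 ≤ D) (hΔ : 0 ≤ Δ) (hs : 0 ≤ s)
    (hγ : γ = c * β) (hβθ : β ≤ θ) (hΛβ : Λ * β ≤ c₆ * p) (hD2 : D ^ 2 = γ ^ 2 * up ^ 2 * M)
    (hcM : 4 * up ^ 3 * (c₅ ^ 2 + (L + 2 * c₆) ^ 2) * c ^ 2 ≤ lo / 4)
    (h1 : lo / 2 * G + lo / 4 * M ≤ Δ / γ + up * (T * (3 * (β / p * s)) + R))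
    (h3 : R ≤ 2 * ((c₅ / θ * Real.sqrt (D ^ 2 + T * J) + (L / β + Λ * (2 / p)) * D) ^ 2
        + β * (c₅ / θ + c₃ / β) ^ 2)) :
    1 / T * G ≤ 2 / lo * (Δ / c + 3 * up + 4 * up * c₅ ^ 2 + 2 * up * (c₅ + c₃) ^ 2)
      * (1 / (β * T) + β / p * s + J / θ ^ 2) := by
  subst hγ
  -- All coefficients of D are O(1/β): 1/θ ≤ 1/β because β ≤ θ, and Λ/p ≤ c₆/β by `hΛβ`. Since D² is
  -- proportional to (cβ)²M, the powers of β cancel and c²M remains.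
  have h4 : (c₅ / θ * Real.sqrt (D ^ 2 + T * J) + (L / β + Λ * (2 / p)) * D) ^ 2
      ≤ 2 * (c₅ ^ 2 + (L + 2 * c₆) ^ 2) * c ^ 2 * up ^ 2 * M + 2 * c₅ ^ 2 * (T * J) / θ ^ 2 := by
    have e1 : Λ * (2 / p) ≤ 2 * c₆ / β := by
      rw [mul_div_assoc', div_le_div_iff₀ hp hβ]
      linarith
    have e2 : ((L / β + Λ * (2 / p)) * D) ^ 2 ≤ (L + 2 * c₆) ^ 2 * (c ^ 2 * up ^ 2 * M) := by
      have e3 : (L / β + Λ * (2 / p)) * D ≤ (L + 2 * c₆) / β * D := by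
        rw [add_div]
        gcongr
      refine (pow_le_pow_left₀ (by positivity) e3 2).trans_eq ?_
      rw [mul_pow, hD2]
      field_simp
    have e4 : (c₅ / θ * Real.sqrt (D ^ 2 + T * J)) ^ 2
        ≤ c₅ ^ 2 * (c ^ 2 * up ^ 2 * M) + c₅ ^ 2 * (T * J) / θ ^ 2 := by
      rw [mul_pow, Real.sq_sqrt (by positivity), mul_add]
      refine add_le_add ?_ (le_of_eq (by ring))
      have e5 : (c₅ / θ) ^ 2 ≤ (c₅ / β) ^ 2 := by gcongr
      refine (mul_le_mul_of_nonneg_right e5 (sq_nonneg D)).trans_eq ?_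
      rw [hD2]
      field_simp
    have e6 := add_sq_le (a := c₅ / θ * Real.sqrt (D ^ 2 + T * J)) (b := (L / β + Λ * (2 / p)) * D)
    refine e6.trans ((mul_le_mul_of_nonneg_left (add_le_add e4 e2) zero_le_two).trans_eq ?_)
    ring
  -- Here the ℓ¹ treatment of the transient pays off: its square of order 1/β² is multiplied by β.
  have h5 : β * (c₅ / θ + c₃ / β) ^ 2 ≤ (c₅ + c₃) ^ 2 / β := by
    have e1 : c₅ / θ + c₃ / β ≤ (c₅ + c₃) / β := by rw [add_div]; gcongr
    refine (mul_le_mul_of_nonneg_left (pow_le_pow_left₀ (by positivity) e1 2) hβ.le).trans_eq ?_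
    field_simp
  -- By the choice of c, the multiple of M is at most lo/4 and cancels against the momentum term on
  -- the left of `h1`.
  have h6 : up * R ≤ lo / 4 * M + 4 * up * c₅ ^ 2 * (T * J) / θ ^ 2
      + 2 * up * (c₅ + c₃) ^ 2 / β := by
    have e1 := mul_le_mul_of_nonneg_left
      (h3.trans (mul_le_mul_of_nonneg_left (add_le_add h4 h5) zero_le_two)) hup.le
    have e2 := mul_le_mul_of_nonneg_right hcM hM
    refine e1.trans (le_trans (le_of_eq ?_) (add_le_add_left (add_le_add_left e2 _) _))
    ring
  have h7 : lo / 2 * G ≤ Δ / (c * β) + 3 * up * (T * (β / p * s))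
      + 4 * up * c₅ ^ 2 * (T * J) / θ ^ 2 + 2 * up * (c₅ + c₃) ^ 2 / β := by
    linarith
  have h8 : 1 / T * G ≤ 2 / lo * (Δ / c * (1 / (β * T)) + 3 * up * (β / p * s)
      + 4 * up * c₅ ^ 2 * (J / θ ^ 2) + 2 * up * (c₅ + c₃) ^ 2 * (1 / (β * T))) := by
    have e1 := mul_le_mul_of_nonneg_left h7 (by positivity : 0 ≤ 2 / (lo * T))
    refine le_trans (le_of_eq ?_) (e1.trans_eq ?_)
    · field_simp
    · field_simp
  refine h8.trans (le_trans (mul_le_mul_of_nonneg_left ?_ (by positivity))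
    (mul_assoc _ _ _).ge)
  have hx0 : 0 ≤ 1 / (β * T) := by positivity
  have hy0 : 0 ≤ β / p * s := by positivity
  have hv0 : 0 ≤ J / θ ^ 2 := by positivity
  have n1 := mul_nonneg (by positivity : 0 ≤ Δ / c) (add_nonneg hy0 hv0)
  have n2 := mul_nonneg (by positivity : 0 ≤ 3 * up) (add_nonneg hx0 hv0)
  have n3 := mul_nonneg (by positivity : 0 ≤ 4 * up * c₅ ^ 2) (add_nonneg hx0 hy0)
  have n4 := mul_nonneg (by positivity : 0 ≤ 2 * up * (c₅ + c₃) ^ 2) (add_nonneg hy0 hv0)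
  linarith

/-! ### Expectations, and closing the loop -/

namespace Setting

variable {K : Constants} (X : Setting.{u} E K)

/-- The gradient estimates are bounded in the first `T` iterations. -/
def Bounded (T : ℕ) : Prop := BoundedEstimates K X.P X.CF X.CB X.vr X.h X.w₁ T

lemma integrable_norm_gradient_risk_sq (n : ℕ) :
    Integrable (fun z => ‖∇ X.P.risk (X.st n z).w‖ ^ 2) X.μ :=
  X.integrable_norm_sq (X.measurable_gradient_risk n)
    fun z => Pipeline.norm_gradient_risk_le X.smooth X.unbiased (X.st n z).w

lemma ae_norm_m_le {T n : ℕ} (hb : X.Bounded T) (hn : n < T) :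
    ∀ᵐ z ∂X.μ, ‖(X.st (n + 1) z).m‖ ≤ E * K.M₁ := by
  filter_upwards [hb] with z hz
  refine (Pipeline.norm_params_le_sum _).trans ?_
  refine (Finset.sum_le_sum fun e _ => (X.moments_le hz (n + 1) hn).1 e).trans_eq ?_
  simp

lemma integrable_sq_of_ae_bound {f : X.Ω → X.P.Params} (hf : Measurable f) {C : ℝ}
    (h : ∀ᵐ z ∂X.μ, ‖f z‖ ≤ C) : Integrable (fun z => ‖f z‖ ^ 2) X.μ := by
  refine Integrable.of_bound (hf.norm.pow_const 2).aestronglyMeasurable (C ^ 2) ?_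
  filter_upwards [h] with z hz
  rw [Real.norm_of_nonneg (sq_nonneg _)]
  gcongr

lemma integrable_norm_m_sq {T n : ℕ} (hb : X.Bounded T) (hn : n < T) :
    Integrable (fun z => ‖(X.st (n + 1) z).m‖ ^ 2) X.μ :=
  X.integrable_sq_of_ae_bound (X.meas (n + 1)).m (X.ae_norm_m_le hb hn)

lemma integrable_norm_resid_sq {T n : ℕ} (hb : X.Bounded T) (hn : n < T) :
    Integrable (fun z => ‖X.resid n z‖ ^ 2) X.μ := by
  refine X.integrable_sq_of_ae_bound (X.measurable_resid n)
    (C := E * K.M₁ + K.c₃ E + 2 * K.c₃ E) ?_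
  filter_upwards [X.ae_norm_m_le hb hn] with z hz
  refine (norm_sub_le _ _).trans (add_le_add ((norm_sub_le _ _).trans (add_le_add hz ?_))
    (X.norm_avgNoise_le _ z))
  exact Pipeline.norm_gradient_risk_le X.smooth X.unbiased _

lemma integrable_norm_avgNoise_sq (n : ℕ) : Integrable (fun z => ‖X.avgNoise n z‖ ^ 2) X.μ :=
  X.integrable_norm_sq (X.measurable_avgNoise n) (X.norm_avgNoise_le n)

lemma eLpNorm_sq_eq_ofReal {f : X.Ω → X.P.Params}
    (hf : Integrable (fun z => ‖f z‖ ^ 2) X.μ) :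
    eLpNorm f 2 X.μ ^ 2 = ENNReal.ofReal (∫ z, ‖f z‖ ^ 2 ∂X.μ) := by
  rw [eLpNorm_two_sq, ofReal_integral_eq_lintegral_ofReal hf (ae_of_all _ fun z => sq_nonneg _)]
  exact lintegral_congr fun z => (ofReal_norm_sq _).symm

lemma sum_dw_sq_le {T : ℕ} (hb : X.Bounded T) :
    ∑ n ∈ Finset.range T, X.dw n ^ 2 ≤ ENNReal.ofReal (X.h.γ ^ 2 * K.precondUp ^ 2
      * ∑ n ∈ Finset.range T, ∫ z, ‖(X.st (n + 1) z).m‖ ^ 2 ∂X.μ) := by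
  -- Truncated subtraction gives 0 − 1 = 0, so the sum may be shifted by one and each change matched
  -- with the momentum that caused it.
  have h0 : X.dw 0 = 0 := by simp [dw]
  have h1 : ∑ n ∈ Finset.range T, X.dw n ^ 2 ≤ ∑ n ∈ Finset.range T, X.dw (n + 1) ^ 2 := by
    have h2 := Finset.sum_range_succ' (fun n => X.dw n ^ 2) T
    rw [h0] at h2
    rw [zero_pow two_ne_zero, add_zero] at h2
    rw [← h2]
    exact Finset.sum_le_sum_of_subset (Finset.range_mono (Nat.le_succ T))
  refine h1.trans ?_
  rw [Finset.mul_sum, ENNReal.ofReal_sum_of_nonneg]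
  swap
  · exact fun n _ => mul_nonneg (by positivity) (integral_nonneg fun z => sq_nonneg _)
  refine Finset.sum_le_sum fun n hn => ?_
  have hn' : n < T := Finset.mem_range.1 hn
  have hi := (X.integrable_norm_m_sq hb hn').const_mul (X.h.γ ^ 2 * K.precondUp ^ 2)
  rw [dw, Nat.add_sub_cancel, eLpNorm_two_sq, ← integral_const_mul,
    ofReal_integral_eq_lintegral_ofReal hi (ae_of_all _ fun z => by positivity)]
  refine lintegral_mono_ae ?_
  filter_upwards [hb] with z hz
  rw [← ofReal_norm_sq]
  exact ENNReal.ofReal_le_ofReal (X.norm_update_sq_le (X.moments_le hz (n + 1) hn').2)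

lemma norm_m_sub_sq_le (n : ℕ) (z : X.Ω) :
    ‖(X.st (n + 1) z).m - ∇ X.P.risk (X.st n z).w‖ ^ 2
      ≤ 2 * ‖X.avgNoise (n + 1) z‖ ^ 2 + 2 * ‖X.resid n z‖ ^ 2 := by
  have h1 : (X.st (n + 1) z).m - ∇ X.P.risk (X.st n z).w
      = X.avgNoise (n + 1) z + X.resid n z := by rw [resid]; abel
  rw [h1]
  have h2 := norm_add_le (X.avgNoise (n + 1) z) (X.resid n z)
  have h3 := pow_le_pow_left₀ (norm_nonneg _) h2 2
  nlinarith [sq_nonneg (‖X.avgNoise (n + 1) z‖ - ‖X.resid n z‖)]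

lemma sum_integral_descent_le {T : ℕ} (hb : X.Bounded T)
    (hγ : K.Lℓ * X.h.γ * K.precondUp ^ 2 ≤ K.precondLo / 4) :
    K.precondLo / 2 * ∑ n ∈ Finset.range T, ∫ z, ‖∇ X.P.risk (X.st n z).w‖ ^ 2 ∂X.μ
      + K.precondLo / 4 * ∑ n ∈ Finset.range T, ∫ z, ‖(X.st (n + 1) z).m‖ ^ 2 ∂X.μ
    ≤ K.Δ / X.h.γ + K.precondUp * (T * (3 * (X.h.β₁ / X.h.p * X.σ ^ 2))
      + ∑ n ∈ Finset.range T, ∫ z, ‖X.resid n z‖ ^ 2 ∂X.μ) := by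
  have i1 : ∀ n ∈ Finset.range T, Integrable (fun z => K.precondLo / 2
      * ‖∇ X.P.risk (X.st n z).w‖ ^ 2 + K.precondLo / 4 * ‖(X.st (n + 1) z).m‖ ^ 2) X.μ :=
    fun n hn => ((X.integrable_norm_gradient_risk_sq n).const_mul _).add
      ((X.integrable_norm_m_sq hb (Finset.mem_range.1 hn)).const_mul _)
  have i2 : ∀ n ∈ Finset.range T, Integrable (fun z =>
      ‖X.avgNoise (n + 1) z‖ ^ 2 + ‖X.resid n z‖ ^ 2) X.μ :=
    fun n hn => (X.integrable_norm_avgNoise_sq (n + 1)).add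
      (X.integrable_norm_resid_sq hb (Finset.mem_range.1 hn))
  have h1 : ∫ z, ∑ n ∈ Finset.range T, (K.precondLo / 2
      * ‖∇ X.P.risk (X.st n z).w‖ ^ 2 + K.precondLo / 4 * ‖(X.st (n + 1) z).m‖ ^ 2) ∂X.μ
      ≤ ∫ z, (K.Δ / X.h.γ + K.precondUp * ∑ n ∈ Finset.range T,
        (‖X.avgNoise (n + 1) z‖ ^ 2 + ‖X.resid n z‖ ^ 2)) ∂X.μ := by
    refine integral_mono_ae (integrable_finsetSum _ i1)
      ((integrable_const _).add ((integrable_finsetSum _ i2).const_mul _)) ?_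
    filter_upwards [hb] with z hz
    refine (X.sum_descent_le hz hγ).trans (add_le_add_right ?_ _)
    have h2 := Finset.sum_le_sum fun n (_ : n ∈ Finset.range T) => X.norm_m_sub_sq_le n z
    have h3 := mul_le_mul_of_nonneg_left h2 (by linarith [K.precondUp_pos] : 0 ≤ K.precondUp / 2)
    refine h3.trans_eq ?_
    rw [Finset.mul_sum, Finset.mul_sum]
    exact Finset.sum_congr rfl fun n _ => by ring
  rw [integral_finsetSum _ i1, integral_add (integrable_const _)
    ((integrable_finsetSum _ i2).const_mul _), integral_const_mul, integral_finsetSum _ i2,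
    integral_const, probReal_univ, one_smul] at h1
  have h2 : ∑ n ∈ Finset.range T, ∫ z, (K.precondLo / 2
      * ‖∇ X.P.risk (X.st n z).w‖ ^ 2 + K.precondLo / 4 * ‖(X.st (n + 1) z).m‖ ^ 2) ∂X.μ
      = K.precondLo / 2 * ∑ n ∈ Finset.range T, ∫ z, ‖∇ X.P.risk (X.st n z).w‖ ^ 2 ∂X.μ
      + K.precondLo / 4 * ∑ n ∈ Finset.range T, ∫ z, ‖(X.st (n + 1) z).m‖ ^ 2 ∂X.μ := by
    rw [Finset.mul_sum, Finset.mul_sum, ← Finset.sum_add_distrib]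
    refine Finset.sum_congr rfl fun n hn => ?_
    rw [integral_add ((X.integrable_norm_gradient_risk_sq n).const_mul _)
      ((X.integrable_norm_m_sq hb (Finset.mem_range.1 hn)).const_mul _), integral_const_mul,
      integral_const_mul]
  have h3 : ∑ n ∈ Finset.range T, ∫ z, (‖X.avgNoise (n + 1) z‖ ^ 2 + ‖X.resid n z‖ ^ 2) ∂X.μ
      ≤ T * (3 * (X.h.β₁ / X.h.p * X.σ ^ 2))
        + ∑ n ∈ Finset.range T, ∫ z, ‖X.resid n z‖ ^ 2 ∂X.μ := by
    rw [← Finset.card_range T, ← nsmul_eq_mul, ← Finset.sum_const, Finset.card_range,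
      ← Finset.sum_add_distrib]
    refine Finset.sum_le_sum fun n hn => ?_
    rw [integral_add (X.integrable_norm_avgNoise_sq (n + 1))
      (X.integrable_norm_resid_sq hb (Finset.mem_range.1 hn))]
    exact add_le_add_left (X.integral_avgNoise_le (n + 1)).2 _
  rw [← h2]
  exact h1.trans (add_le_add_right (mul_le_mul_of_nonneg_left h3 K.precondUp_pos.le) _)

lemma sum_integral_resid_le {T : ℕ} {D Λ : ℝ} (hD : 0 ≤ D) (hΛ : 0 ≤ Λ)
    (h : ∀ᵐ x ∂X.P.D, ∀ w w', ‖X.noise x w - X.noise x w'‖ ≤ Λ * ‖w - w'‖)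
    (hb : X.Bounded T) (hD2 : D ^ 2 = X.h.γ ^ 2 * K.precondUp ^ 2
      * ∑ n ∈ Finset.range T, ∫ z, ‖(X.st (n + 1) z).m‖ ^ 2 ∂X.μ) :
    ∑ n ∈ Finset.range T, ∫ z, ‖X.resid n z‖ ^ 2 ∂X.μ ≤
      2 * ((K.c₅ E / X.θ * Real.sqrt (D ^ 2 + T * X.jump ^ 2)
        + (K.Lℓ / X.h.β₁ + Λ * (2 / X.h.p)) * D) ^ 2
        + X.h.β₁ * (K.c₅ E / X.θ + K.c₃ E / X.h.β₁) ^ 2) := by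
  have hβ := X.β₁_mem.1
  have hdw := X.sum_dw_sq_le hb
  rw [← hD2] at hdw
  have h2 := X.sum_resid_sq_le hD hΛ h hdw
  rw [← ENNReal.ofReal_le_ofReal_iff (by positivity), ENNReal.ofReal_sum_of_nonneg
    fun n _ => integral_nonneg fun z => sq_nonneg _]
  refine le_trans (Finset.sum_le_sum fun n hn => ?_) h2
  exact (X.eLpNorm_sq_eq_ofReal (X.integrable_norm_resid_sq hb (Finset.mem_range.1 hn))).ge

/-- The sum of the squared momenta bounds the weight changes, these bound the residual, and the
residual enters the descent inequality that contains the same sum. All sums are finite by the almost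
sure bounds, so it may be cancelled. -/
lemma avgGradSqLE {T : ℕ} {Λ : ℝ} (hT : 1 ≤ T) (hΛ : 0 ≤ Λ)
    (h : ∀ᵐ x ∂X.P.D, ∀ w w', ‖X.noise x w - X.noise x w'‖ ≤ Λ * ‖w - w'‖)
    (hb : X.Bounded T) (hγ : X.h.γ = K.ratio E * X.h.β₁) (hβθ : X.h.β₁ ≤ X.θ)
    (hΛβ : Λ * X.h.β₁ ≤ (K.c₄ E + K.Lℓ) * X.h.p) :
    AvgGradSqLE X.P X.CF X.CB X.vr X.h X.w₁ T (K.rateConst E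
      * (1 / (X.h.β₁ * T) + X.h.β₁ / X.h.p * X.σ ^ 2 + X.jump ^ 2 / X.θ ^ 2)) := by
  refine ⟨fun t _ => X.integrable_norm_gradient_risk_sq t, ?_⟩
  have hβ := X.β₁_mem
  have hc3 : 0 ≤ K.c₃ E := by linarith [K.one_le_c₃ E]
  obtain ⟨hr1, hr2⟩ := K.ratio_mul_le E
  have hM : 0 ≤ ∑ n ∈ Finset.range T, ∫ z, ‖(X.st (n + 1) z).m‖ ^ 2 ∂X.μ :=
    Finset.sum_nonneg fun n _ => integral_nonneg fun z => sq_nonneg _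
  have hD2 := Real.sq_sqrt (mul_nonneg (mul_nonneg (sq_nonneg X.h.γ) (sq_nonneg K.precondUp)) hM)
  have hγL : K.Lℓ * X.h.γ * K.precondUp ^ 2 ≤ K.precondLo / 4 := by
    have h0 : 0 ≤ K.Lℓ * K.ratio E * K.precondUp ^ 2 := by
      have := K.Lℓ_nonneg
      have := K.ratio_pos E
      positivity
    have : K.Lℓ * X.h.γ * K.precondUp ^ 2
        = X.h.β₁ * (K.Lℓ * K.ratio E * K.precondUp ^ 2) := by rw [hγ]; ring
    rw [this]
    exact (mul_le_of_le_one_left h0 hβ.2.le).trans hr1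
  exact descent_arith (by exact_mod_cast hT) hβ.1 X.p_mem.1 K.precondLo_pos K.precondUp_pos
    (K.ratio_pos E) X.θ_pos hM K.Lℓ_nonneg hΛ hc3 (K.c₅_nonneg E) (sq_nonneg _) (Real.sqrt_nonneg _)
    K.Δ_nonneg (sq_nonneg _) hγ hβθ hΛβ hD2 hr2 (X.sum_integral_descent_le hb hγL)
    (X.sum_integral_resid_le (Real.sqrt_nonneg _) hΛ h hb hD2)

end Setting

/-- Zero variance gives a null set for each w separately. A countable dense set of weights and the
continuity of the noise in w merge them into a single one. -/
lemma Setting.noise_eq_zero {K : Constants} (X : Setting.{u} E K) (hσ : X.σ = 0) :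
    ∀ᵐ x ∂X.P.D, ∀ w, X.noise x w = 0 := by
  have h1 : ∀ w, ∀ᵐ x ∂X.P.D, X.noise x w = 0 := by
    intro w
    have hv := X.unbiased.variance w
    rw [hσ, zero_pow two_ne_zero, ENNReal.ofReal_zero] at hv
    have hm : Measurable fun x => X.noise x w := X.measurable_noise measurable_id measurable_const
    have h2 : ∫⁻ x, ENNReal.ofReal (‖X.noise x w‖ ^ 2) ∂X.P.D = 0 := by
      rw [← nonpos_iff_eq_zero]
      refine le_trans (le_of_eq (lintegral_congr fun x => ?_)) hv
      rw [Pipeline.gradient_loss X.smooth, noise]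
    rw [lintegral_eq_zero_iff (hm.norm.pow_const 2).ennreal_ofReal] at h2
    filter_upwards [h2] with x hx
    have h3 : ‖X.noise x w‖ ^ 2 ≤ 0 := ENNReal.ofReal_eq_zero.1 hx
    exact norm_eq_zero.1 (pow_eq_zero_iff two_ne_zero |>.1 (le_antisymm h3 (sq_nonneg _)))
  have h2 := ae_all_iff.2 fun n => h1 (TopologicalSpace.denseSeq X.P.Params n)
  filter_upwards [h2] with x hx
  have hc : Continuous (X.noise x) := by
    have : LipschitzWith (K.c₄ E + K.Lℓ).toNNReal (X.noise x) :=
      LipschitzWith.of_dist_le' fun w w' => by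
        rw [dist_eq_norm, dist_eq_norm]; exact X.norm_noise_sub_le x w w'
    exact this.continuous
  intro w
  exact congrFun ((TopologicalSpace.denseRange_denseSeq X.P.Params).equalizer hc
    (continuous_const (y := (0 : X.P.Params))) (funext hx)) w

lemma contraction_le_one {ωF ωB : ℝ} (hF : ωF ∈ Set.Ico (0 : ℝ) 1)
    (hB : ωB ∈ Set.Ico (0 : ℝ) 1) : contraction E ωF ωB ≤ 1 :=
  mul_le_one₀ (pow_le_one₀ (by linarith [hF.2]) (by linarith [hF.1]))
    (pow_nonneg (by linarith [hB.2]) _) (pow_le_one₀ (by linarith [hB.2]) (by linarith [hB.1]))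

/-- The change of the samples enters the bound only in the variant `FC`. -/
def driftSq (vr : Variant) (p φ : ℝ) : ℝ :=
  match vr with
  | Variant.FU => 0
  | Variant.FC => p * φ ^ 2

/-- Two ways to satisfy the condition on Λ: β ≤ p with the general Lipschitz constant, or Λ = 0 when
σ = 0, which leaves p free. -/
lemma guarantee_of_le {K : Constants} {vr : Variant} {σ φ ωF ωB β p R : ℝ} {T : ℕ}
    (hφ : 0 ≤ φ) (hF : ωF ∈ Set.Ico (0 : ℝ) 1) (hB : ωB ∈ Set.Ico (0 : ℝ) 1)
    (hT : 1 ≤ T) (hβ : β ∈ Set.Ioo (0 : ℝ) 1) (hp : p ∈ Set.Ioc (0 : ℝ) 1)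
    (hβθ : β ≤ contraction E ωF ωB) (hβp : β ≤ p ∨ σ = 0)
    (hR : K.rateConst E * (1 / (β * T) + β / p * σ ^ 2
      + driftSq vr p φ / contraction E ωF ωB ^ 2) ≤ R) :
    Guarantee.{u} E K vr σ φ ωF ωB T (K.ratio E * β) β p R := by
  intro P CF CB w₁ β₂ hβ₂ hP hU hCF hCB hS hI hb
  let X : Setting.{u} E K := ⟨P, CF, CB, vr, ⟨K.ratio E * β, β, β₂, K.ε, p⟩, w₁, σ, φ, ωF, ωB,
    hP, hU, hCF, hCB, hS, hI, hφ, hF, hB, mul_pos (K.ratio_pos E) hβ.1, hβ, hβ₂, hp, rfl⟩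
  have hj : X.jump ^ 2 = driftSq vr p φ := by
    cases vr with
    | FU => exact zero_pow two_ne_zero
    | FC =>
      change (Real.sqrt p * φ) ^ 2 = p * φ ^ 2
      rw [mul_pow, Real.sq_sqrt hp.1.le]
  have hc : 0 ≤ K.c₄ E + K.Lℓ := by linarith [K.one_le_c₄ E, K.Lℓ_nonneg]
  have key : AvgGradSqLE X.P X.CF X.CB X.vr X.h X.w₁ T (K.rateConst E
      * (1 / (X.h.β₁ * T) + X.h.β₁ / X.h.p * X.σ ^ 2 + X.jump ^ 2 / X.θ ^ 2)) := by
    rcases hβp with hβp | h0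
    · exact X.avgGradSqLE hT hc (ae_of_all _ X.norm_noise_sub_le) hb rfl hβθ
        (mul_le_mul_of_nonneg_left hβp hc)
    · refine X.avgGradSqLE hT le_rfl ?_ hb rfl hβθ ?_
      · filter_upwards [X.noise_eq_zero h0] with x hx w w'
        rw [hx, hx, sub_zero, norm_zero, zero_mul]
      · rw [zero_mul]
        exact mul_nonneg hc hp.1.le
  rw [hj] at key
  exact ⟨key.1, key.2.trans hR⟩

/-! ### Choice of the momentum parameter and of the sampling rate -/

/-- β is half the reciprocal of 1/p + 1/θ + σ√T, a smooth version of min(p, θ, 1/(σ√T)). Thus 1/(βT)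
splits exactly into three terms, and βσ² is of order σ/√T. -/
lemma exists_momentum_FU {p θ σ T : ℝ} (hp : p ∈ Set.Ioc (0 : ℝ) 1) (hθ : 0 < θ) (hθ1 : θ ≤ 1)
    (hσ : 0 ≤ σ) (hT : 1 ≤ T) :
    ∃ β ∈ Set.Ioo (0 : ℝ) 1, β ≤ θ ∧ β ≤ p ∧
      1 / (β * T) + β / p * σ ^ 2 ≤ (2 + 2 / p) * (σ / Real.sqrt T + 1 / (T * θ)) := by
  obtain ⟨hp0, hp1⟩ := hp
  have hT0 : 0 < T := by linarith
  set r := Real.sqrt T with hr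
  have hr0 : 0 < r := Real.sqrt_pos.2 hT0
  have hr2 : T = r ^ 2 := (Real.sq_sqrt hT0.le).symm
  set q := 1 / p + 1 / θ + σ * r with hq
  have hσr : 0 ≤ σ * r := by positivity
  have hp' : 1 ≤ 1 / p := by rw [le_div_iff₀ hp0]; linarith
  have hθ' : 1 ≤ 1 / θ := by rw [le_div_iff₀ hθ]; linarith
  have hq0 : 0 < q := by positivity
  have h1 : ∀ c : ℝ, 0 < c → 1 / c ≤ q → 1 / (2 * q) ≤ c := fun c hc h => by
    rw [div_le_iff₀ hc] at h
    rw [div_le_iff₀ (by positivity)]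
    nlinarith
  refine ⟨1 / (2 * q), ⟨by positivity, ?_⟩, h1 θ hθ (by linarith), h1 p hp0 (by linarith), ?_⟩
  · rw [div_lt_one (by positivity)]; linarith
  · have e1 : 1 / (1 / (2 * q) * T) = 2 / p * (1 / T) + 2 * (1 / (T * θ)) + 2 * (σ / r) := by
      rw [hq, hr2]; field_simp
    have e2 : 1 / T ≤ 1 / (T * θ) :=
      one_div_le_one_div_of_le (by positivity) (mul_le_of_le_one_right hT0.le hθ1)
    have e3 : 1 / (2 * q) / p * σ ^ 2 ≤ 2 / p * (σ / r) := by
      have e4 : 1 / (2 * q) * σ ^ 2 ≤ 2 * (σ / r) := by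
        rw [div_mul_eq_mul_div, mul_div_assoc', div_le_div_iff₀ (by positivity) hr0]
        have : σ * (σ * r) ≤ σ * q := mul_le_mul_of_nonneg_left (by linarith) hσ
        nlinarith [mul_nonneg hσ hq0.le]
      have e5 := div_le_div_of_nonneg_right e4 hp0.le
      rwa [← div_mul_eq_mul_div, ← div_mul_eq_mul_div] at e5
    rw [e1]
    have e5 := mul_le_mul_of_nonneg_left e2 (by positivity : 0 ≤ 2 / p)
    linarith

lemma exists_momentum_FC {κ θ σ φ T : ℝ} (hθ : 0 < θ) (hθ1 : θ ≤ 1) (hσ : 0 ≤ σ) (hφ : 0 ≤ φ)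
    (hφσ : σ = 0 ∨ φ ≤ κ * σ) (hT : 1 ≤ T) :
    ∃ β ∈ Set.Ioo (0 : ℝ) 1, ∃ p ∈ Set.Ioc (0 : ℝ) 1, β ≤ θ ∧ (β ≤ p ∨ σ = 0) ∧
      1 / (β * T) + β / p * σ ^ 2 + p * φ ^ 2 / θ ^ 2 ≤ (3 + κ ^ 2)
        * (σ ^ (4 / 3 : ℝ) / (T ^ (1 / 3 : ℝ) * θ ^ (4 / 3 : ℝ)) + 1 / (T * θ)) := by
  have hT0 : 0 < T := by linarith
  set R := σ ^ (4 / 3 : ℝ) / (T ^ (1 / 3 : ℝ) * θ ^ (4 / 3 : ℝ)) with hR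
  have hR0 : 0 ≤ R := by positivity
  have hR3 : R ^ 3 = σ ^ 4 / (T * θ ^ 4) := by
    have e : ∀ x : ℝ, 0 ≤ x → (x ^ (4 / 3 : ℝ)) ^ 3 = x ^ 4 := fun x hx => by
      rw [← Real.rpow_natCast, ← Real.rpow_mul hx, ← Real.rpow_natCast]; norm_num
    have e' : (T ^ (1 / 3 : ℝ)) ^ 3 = T := by
      rw [← Real.rpow_natCast, ← Real.rpow_mul hT0.le]; norm_num
    rw [hR, div_pow, mul_pow, e _ hσ, e _ hθ.le, e']
  set S := 1 / (T * θ) with hS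
  have hS0 : 0 < S := by positivity
  have hTS : 1 / T ≤ S :=
    one_div_le_one_div_of_le (by positivity) (mul_le_of_le_one_right hT0.le hθ1)
  have hκR : 0 ≤ κ ^ 2 * R := by positivity
  have hκS : 0 ≤ κ ^ 2 * S := by positivity
  have hβS : 1 / (θ / 2 * T) = 2 * S := by rw [hS]; field_simp
  rcases hσ.eq_or_lt with h0 | hσ0
  · have hq : 1 ≤ 1 + T * (φ ^ 2 / θ ^ 2) := by
      have : 0 ≤ T * (φ ^ 2 / θ ^ 2) := by positivity
      linarith
    -- Without noise, β need not be below p, so p is taken so small that the drift pφ²/θ² is at most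
    -- 1/T.
    refine ⟨θ / 2, ⟨by linarith, by linarith⟩, 1 / (1 + T * (φ ^ 2 / θ ^ 2)),
      ⟨by positivity, div_le_one_of_le₀ hq (by positivity)⟩, by linarith, Or.inr h0.symm, ?_⟩
    have e1 : 1 / (1 + T * (φ ^ 2 / θ ^ 2)) * φ ^ 2 / θ ^ 2 ≤ 1 / T := by
      rw [mul_div_assoc, div_mul_eq_mul_div, div_le_div_iff₀ (by positivity) hT0]
      linarith
    rw [hβS, ← h0]
    linarith
  · have hφκ : φ ^ 2 ≤ κ ^ 2 * σ ^ 2 := by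
      rw [← mul_pow]
      exact pow_le_pow_left₀ hφ (hφσ.resolve_left hσ0.ne') 2
    rcases le_total 1 (σ ^ 2 * T / θ ^ 2) with hx | hx
    -- This p equates 1/(p²T), which is 1/(βT) for β of order p², with the drift pσ²/θ²; their
    -- common value is R. The case assumption says p ≤ 1.
    · set p := (θ ^ 2 / (σ ^ 2 * T)) ^ (1 / 3 : ℝ) with hp
      have hp0 : 0 < p := by positivity
      have hp3 : p ^ 3 = θ ^ 2 / (σ ^ 2 * T) := by
        rw [hp, ← Real.rpow_natCast, ← Real.rpow_mul (by positivity)]; norm_num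
      have hp1 : p ≤ 1 := by
        refine Real.rpow_le_one (by positivity) ?_ (by norm_num)
        rw [le_div_iff₀ (by positivity)] at hx
        rw [div_le_one (by positivity)]
        linarith
      have hpR : p * σ ^ 2 / θ ^ 2 = R := by
        refine (pow_left_inj₀ (by positivity) hR0 three_ne_zero).1 ?_
        rw [hR3, div_pow, mul_pow, hp3]
        field_simp
      have hpT : 1 / (p ^ 2 * T) = R := by
        rw [← hpR, div_eq_div_iff (by positivity) (by positivity)]
        have : p * σ ^ 2 * (p ^ 2 * T) = p ^ 3 * (σ ^ 2 * T) := by ring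
        rw [this, hp3]
        field_simp
      -- 1/(2q) is a smooth version of min(p², θ). It satisfies β ≤ p² ≤ p, hence βσ²/p ≤ pσ² ≤ R.
      set q := 1 / p ^ 2 + 1 / θ with hq
      have hp' : 1 ≤ 1 / p ^ 2 := by
        rw [le_div_iff₀ (by positivity), one_mul]; exact pow_le_one₀ hp0.le hp1
      have hθ' : 1 ≤ 1 / θ := by rw [le_div_iff₀ hθ]; linarith
      have hq0 : 0 < q := by positivity
      have h1 : ∀ c : ℝ, 0 < c → 1 / c ≤ q → 1 / (2 * q) ≤ c := fun c hc h => by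
        rw [div_le_iff₀ hc] at h
        rw [div_le_iff₀ (by positivity)]
        nlinarith
      have h2 : 1 / (2 * q) ≤ p ^ 2 := h1 _ (by positivity) (by linarith)
      refine ⟨1 / (2 * q), ⟨by positivity, ?_⟩, p, ⟨hp0, hp1⟩, h1 θ hθ (by linarith), Or.inl
        (h2.trans (by nlinarith)), ?_⟩
      · rw [div_lt_one (by positivity)]; linarith
      have e1 : 1 / (1 / (2 * q) * T) = 2 * R + 2 * S := by
        rw [← hpT, hS, hq]; field_simp
      have e2 : 1 / (2 * q) / p * σ ^ 2 ≤ R := by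
        have e3 : 1 / (2 * q) / p ≤ p := by
          rw [div_le_iff₀ hp0]; linarith
        have e4 : θ ^ 2 ≤ 1 := pow_le_one₀ hθ.le hθ1
        rw [← hpR, le_div_iff₀ (by positivity)]
        exact (mul_le_of_le_one_right (by positivity) e4).trans (by gcongr)
      have e5 : p * φ ^ 2 / θ ^ 2 ≤ κ ^ 2 * R := by
        rw [← hpR, mul_div_assoc']
        refine div_le_div_of_nonneg_right ?_ (by positivity)
        have := mul_le_mul_of_nonneg_left hφκ hp0.le
        linarith
      rw [e1]
      linarith
    · rw [div_le_one (by positivity)] at hx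
      -- Here σ² ≤ θ²/T, so fresh sampling in every round is affordable: noise and drift are both
      -- O(1/T).
      refine ⟨θ / 2, ⟨by linarith, by linarith⟩, 1, ⟨one_pos, le_rfl⟩, by linarith,
        Or.inl (by linarith), ?_⟩
      have e1 : σ ^ 2 / θ ^ 2 ≤ 1 / T := by
        rw [div_le_div_iff₀ (by positivity) hT0]; linarith
      have e2 : φ ^ 2 / θ ^ 2 ≤ κ ^ 2 * S := by
        refine (div_le_div_of_nonneg_right hφκ (by positivity)).trans ?_
        rw [mul_div_assoc]
        exact mul_le_mul_of_nonneg_left (e1.trans hTS) (sq_nonneg _)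
      have e3 : θ / 2 * σ ^ 2 ≤ S := by
        refine le_trans ?_ (e1.trans hTS)
        rw [le_div_iff₀ (by positivity)]
        have e4 : θ ^ 2 ≤ 1 := pow_le_one₀ hθ.le hθ1
        have e5 : θ / 2 * θ ^ 2 ≤ 1 := by nlinarith
        calc θ / 2 * σ ^ 2 * θ ^ 2 = θ / 2 * θ ^ 2 * σ ^ 2 := by ring
          _ ≤ σ ^ 2 := mul_le_of_le_one_left (sq_nonneg _) e5
      rw [hβS, div_one, one_mul]
      linarith

end Clapping

end


/-! ### The rates -/

theorem mainTheorem4 (E : ℕ) (hE : 2 ≤ E) (K : Clapping.Constants) :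
    (∀ p ∈ Set.Ioc (0 : ℝ) 1, ∃ C : ℝ, ∀ (σ φ ωF ωB : ℝ) (T : ℕ),
      0 ≤ σ → 0 ≤ φ → ωF ∈ Set.Ico (0 : ℝ) 1 → ωB ∈ Set.Ico (0 : ℝ) 1 → 1 ≤ T →
      ∃ γ β₁ : ℝ, 0 < γ ∧ β₁ ∈ Set.Ioo (0 : ℝ) 1 ∧
        Clapping.Guarantee E K Clapping.Variant.FU σ φ ωF ωB T γ β₁ p
          (C * (σ / Real.sqrt T
            + 1 / (T * (1 - ωB) ^ (E - 1) * (1 - ωF) ^ (E - 1))))) ∧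
    (∀ κ : ℝ, 0 ≤ κ → ∃ C : ℝ, ∀ (σ φ ωF ωB : ℝ) (T : ℕ),
      0 ≤ σ → 0 ≤ φ → (σ = 0 ∨ φ ≤ κ * σ) →
      ωF ∈ Set.Ico (0 : ℝ) 1 → ωB ∈ Set.Ico (0 : ℝ) 1 → 1 ≤ T →
      ∃ γ β₁ p : ℝ, 0 < γ ∧ β₁ ∈ Set.Ioo (0 : ℝ) 1 ∧ p ∈ Set.Ioc (0 : ℝ) 1 ∧
        Clapping.Guarantee E K Clapping.Variant.FC σ φ ωF ωB T γ β₁ p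
          (C * (σ ^ (4 / 3 : ℝ) / ((T : ℝ) ^ (1 / 3 : ℝ)
              * (1 - ωB) ^ (4 * ((E : ℝ) - 1) / 3) * (1 - ωF) ^ (4 * ((E : ℝ) - 1) / 3))
            + (1 / T) * (1 / ((1 - ωB) ^ (E - 1) * (1 - ωF) ^ (E - 1))
              + (ωF ^ 2 + ωB) / ((1 - ωB) ^ (2 * (E - 1)) * (1 - ωF) ^ 2)
              + 1 / (1 - ωF) ^ (2 * ((E : ℤ) - 2) - 1))))) := by
  constructor
  · intro p hp
    refine ⟨K.rateConst E * (2 + 2 / p), fun σ φ ωF ωB T hσ hφ hF hB hT => ?_⟩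
    obtain ⟨β, hβ, hβθ, hβp, h⟩ := Clapping.exists_momentum_FU hp
      (Clapping.contraction_pos (E := E) hF hB) (Clapping.contraction_le_one hF hB) hσ
      (by exact_mod_cast hT : (1 : ℝ) ≤ T)
    refine ⟨K.ratio E * β, β, mul_pos (K.ratio_pos E) hβ.1, hβ,
      Clapping.guarantee_of_le hφ hF hB hT hβ hp hβθ (Or.inl hβp) ?_⟩
    have h1 : (T : ℝ) * (1 - ωB) ^ (E - 1) * (1 - ωF) ^ (E - 1)
        = T * Clapping.contraction E ωF ωB := by
      rw [Clapping.contraction]; ring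
    rw [h1, mul_assoc]
    refine mul_le_mul_of_nonneg_left ?_ (K.rateConst_nonneg E)
    rw [Clapping.driftSq, zero_div, add_zero]
    exact h
  · intro κ _
    refine ⟨K.rateConst E * (3 + κ ^ 2), fun σ φ ωF ωB T hσ hφ hφσ hF hB hT => ?_⟩
    have hF1 : 0 < 1 - ωF := by linarith [hF.2]
    have hB1 : 0 < 1 - ωB := by linarith [hB.2]
    obtain ⟨β, hβ, p, hp, hβθ, hβp, h⟩ := Clapping.exists_momentum_FC
      (Clapping.contraction_pos (E := E) hF hB) (Clapping.contraction_le_one hF hB) hσ hφ hφσ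
      (by exact_mod_cast hT : (1 : ℝ) ≤ T)
    refine ⟨K.ratio E * β, β, p, mul_pos (K.ratio_pos E) hβ.1, hβ, hp,
      Clapping.guarantee_of_le hφ hF hB hT hβ hp hβθ hβp ?_⟩
    have hpow : ∀ x : ℝ, 0 < x →
        (x ^ (E - 1)) ^ (4 / 3 : ℝ) = x ^ (4 * ((E : ℝ) - 1) / 3) := fun x hx => by
      rw [← Real.rpow_natCast, ← Real.rpow_mul hx.le, Nat.cast_sub (by omega), Nat.cast_one]
      ring_nf
    have h1 : (T : ℝ) ^ (1 / 3 : ℝ) * (1 - ωB) ^ (4 * ((E : ℝ) - 1) / 3)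
          * (1 - ωF) ^ (4 * ((E : ℝ) - 1) / 3)
        = (T : ℝ) ^ (1 / 3 : ℝ) * Clapping.contraction E ωF ωB ^ (4 / 3 : ℝ) := by
      rw [Clapping.contraction, Real.mul_rpow (by positivity) (by positivity), hpow _ hF1,
        hpow _ hB1]
      ring
    rw [h1, mul_assoc]
    refine mul_le_mul_of_nonneg_left (h.trans ?_) (K.rateConst_nonneg E)
    refine mul_le_mul_of_nonneg_left (add_le_add_right ?_ _) (by positivity)
    have h2 : 1 / ((T : ℝ) * Clapping.contraction E ωF ωB)
        = 1 / T * (1 / ((1 - ωB) ^ (E - 1) * (1 - ωF) ^ (E - 1))) := by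
      rw [Clapping.contraction, one_div_mul_one_div, mul_comm ((1 - ωF) ^ (E - 1))]
    rw [h2]
    refine mul_le_mul_of_nonneg_left ?_ (by positivity)
    -- The first of the three terms of order 1/T already dominates the proved bound; the other two
    -- are only needed to be nonnegative.
    have h3 : 0 ≤ (ωF ^ 2 + ωB) / ((1 - ωB) ^ (2 * (E - 1)) * (1 - ωF) ^ 2) :=
      div_nonneg (add_nonneg (sq_nonneg _) hB.1) (by positivity)
    have h4 : 0 ≤ 1 / (1 - ωF) ^ (2 * ((E : ℤ) - 2) - 1) := by positivity
    linarith
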